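/- **Systems and states.** A system $A=(\Omega,\mathcal H)$ consists of a nonempty measurable space $\Omega$ (classical alphabet) and a nonzero complex Hilbert space $\mathcal H=\ell^2(\iota)$ of arbitrary dimension; it is quantum if $\Omega$ is a point and classical if $\dim\mathcal H=1$. A state of $A$ is a countably additive measure on $\Omega$ whose values are positive trace class operators on $\mathcal H$, of total trace $1$ (a density operator, resp. a probability measure, for quantum, resp. classical, systems). $V(A)$ is the complex span of the states. Composite systems are $A\otimes R=(\Omega_A\times\Omega_R,\mathcal H_A\otimes\mathcal H_R)$. A channel $\Phi:A\to B$ is a completely positive trace preserving map, i.e. a linear map $V(A)\to V(B)$ such that $\Phi\otimes\mathbf I_R$ exists and sends states to states for every system $R$. A tangent vector is a map $\Delta=c(\Psi_1-\Psi_2):V(A)\to V(B)$ with $c\in\mathbb R$ and channels $\Psi_1,\Psi_2:A\to B$. States, and tangent vectors at states, are regarded as channels, and tangent vectors, with trivial input. Let $\Delta^{(n)}=\sum_{k=1}^n\Phi^{\otimes(k-1)}\otimes\Delta\otimes\Phi^{\otimes(n-k)}$. $\|\cdot\|_{\rm cb}$ is the completely bounded norm with respect to trace norms, $\sup_k\|\cdot\otimes\mathbf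 I_{M_k}\|$. $J_p(\delta)=\int(d\delta/dp)^2\,dp$ is the classical Fisher information, equal to $\infty$ if $\delta\not\ll p$. $\mathrm N(a,\sigma^2)$ is the Gaussian distribution and $\delta\mathrm N(a,\sigma^2)$ the signed measure with density $\frac{x-a}{\sigma^2}$ with respect to it. **Metrics.** A metric $G$ assigns to every channel $\Phi$ and tangent vector $\Delta$ (between arbitrary systems) a number $G_\Phi(\Delta)\in[0,\infty]$ such that $\sqrt{G_\Phi(\cdot)}$ is a norm with values in $[0,\infty]$. The axioms are: * (M) $G_\Phi(\Delta)\ge G_{\Phi\circ\Psi}(\Delta\circ\Psi)$ and $G_\Phi(\Delta)\ge G_{\Psi\circ\Phi}(\Psi\circ\Delta)$ for all composable channels $\Psi$; * (E) $G_{\Phi\otimes\mathbf I_R}(\Delta\otimes\mathbf I_R)=G_\Phi(\Delta)$ for every system $R$; * (A1) $\lim_{n\to\infty}\frac1nG_{\Phi^{\otimes n}}(\Delta^{(n)})=G_\Phi(\Delta)$; * (C1) if channels $\Phi^n$ and tangent vectors $\Delta^n$ satisfy $\|\Phi^n-\Phi^{\otimes n}\|_{\rm cb}\to0$ and $\frac1{\sqrt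 n}\|\Delta^n-\Delta^{(n)}\|_{\rm cb}\to0$, then $\liminf_{n\to\infty}\frac1n\bigl(G_{\Phi^n}(\Delta^n)-\min\{G_{\Phi^{\otimes n}}(\Delta^{(n)}),nK\}\bigr)\ge0$ for every finite $K$ (the cut-off $nK$ only serves to avoid infinite subtrahends: under (A1) it has no effect if $G_\Phi(\Delta)<\infty$, and if $G_\Phi(\Delta)=\infty$ the condition says $\frac1nG_{\Phi^n}(\Delta^n)\to\infty$); * (N') $G_q(\delta)=1$ for $q=\mathrm N(0,1)$, $\delta=\delta\mathrm N(0,1)$. **Extremal quantities.** Let $$G^{\min}_\Phi(\Delta)=\sup_{\mathcal K,\rho,M}J_{M((\Phi\otimes\mathbf I)(\rho))}\bigl(M((\Delta\otimes\mathbf I)(\rho))\bigr),$$ over all Hilbert spaces $\mathcal K$, states $\rho$ of the input system tensored with $\mathcal K$, and measurements $M$ (channels to classical systems) on the output system tensored with $\mathcal K$, and $$G^{p,\min}_\Phi(\Delta)=\limsup_{n\to\infty}\tfrac1nG^{\min}_{\Phi^{\otimes n}}(\Delta^{(n)})$$ (which is the limit whenever the limit exists). An asymptotic parallel tangent simulation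 of $(\Phi,\Delta)$ by Gaussian shifts consists of $q^n=\mathrm N(a_n,\sigma_n^2)$, $\delta^n=c_n\,\delta\mathrm N(a_n,\sigma_n^2)$ with $a_n,c_n\in\mathbb R$, $\sigma_n>0$, and of channels $\Lambda^n$ from $A^{\otimes n}\otimes\mathbb R$ to $B^{\otimes n}$ ($A$, $B$ being the input and output systems of $\Phi$, and $\mathbb R$ a classical system), such that $$\lim_{n\to\infty}\|\Phi^{\otimes n}-\Lambda^n\circ(\mathbf I\otimes q^n)\|_{\rm cb}=0,\qquad\lim_{n\to\infty}\tfrac1{\sqrt n}\|\Delta^{(n)}-\Lambda^n\circ(\mathbf I\otimes\delta^n)\|_{\rm cb}=0.$$ Let $\tilde G^{p,\max}_\Phi(\Delta)\in[0,\infty]$ be the infimum of $\liminf_{n\to\infty}\frac1nJ_{q^n}(\delta^n)$ over all such simulations ($\inf\emptyset=\infty$). **Theorem.** Let $G$ be a metric that satisfies (M), (E), (A1), (C1) and (N'). Then for every channel $\Phi$ and every tangent vector $\Delta$, $$G^{p,\min}_\Phi(\Delta)\le G_\Phi(\Delta)\le\tilde G^{p,\max}_\Phi(\Delta).$$ -/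

import Mathlib

open MeasureTheory ProbabilityTheory Filter Topology
open scoped ENNReal NNReal ComplexOrder

namespace ChannelMetric

noncomputable section

/-! ### Systems, states and the state space -/

/-- A (hybrid classical-quantum) system: a classical alphabet `Ω` (any measurable space) together
with the Hilbert space `ℓ²(ι)`.  Every Hilbert space is of the form `ℓ²(ι)` for the index set `ι` of
an orthonormal basis, and `ℓ²(ι) ⊗ ℓ²(κ) = ℓ²(ι × κ)`; the dimension is arbitrary. -/
structure Sys : Type 1 where
  Ω : Type
  ι : Type
  [measΩ : MeasurableSpace Ω]
  [nonemptyΩ : Nonempty Ω]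
  [nonemptyι : Nonempty ι]

attribute [instance] Sys.measΩ Sys.nonemptyΩ Sys.nonemptyι

/-- The purely quantum system with Hilbert space `ℓ²(ι)`. -/
abbrev quantum (ι : Type) [Nonempty ι] : Sys := ⟨Unit, ι⟩

/-- The purely classical system with alphabet `Ω`. -/
abbrev classical (Ω : Type) [MeasurableSpace Ω] [Nonempty Ω] : Sys := ⟨Ω, Unit⟩

/-- The trivial system. -/
abbrev unit : Sys := ⟨Unit, Unit⟩

/-- The real line as a classical system. -/
abbrev line : Sys := classical ℝ

/-- The composite system. -/
abbrev prod (A R : Sys) : Sys := ⟨A.Ω × R.Ω, A.ι × R.ι⟩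

/-- The `n`-fold composite system. -/
def pow (A : Sys) : ℕ → Sys
  | 0 => unit
  | n + 1 => prod A (pow A n)

/-- Countably additive set functions on `Ω` whose values are operators on `ℓ²(ι)`, given by their
matrices in the standard basis. -/
abbrev Pre (A : Sys) : Type := VectorMeasure A.Ω (Matrix A.ι A.ι ℂ)

/-- A state: a countably additive measure whose values are positive operators, of total trace `1`.
If `Ω` is a point this is a density operator; if `ι` is a point this is a probability measure. -/
structure IsState {A : Sys} (X : Pre A) : Prop where
  posSemidef : ∀ B : Set A.Ω, (X B).PosSemidef
  trace_eq : HasSum (fun i : A.ι => X Set.univ i i) 1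

/-- The complex linear span of the states: trace class operators if `Ω` is a point, complex measures
if `ι` is a point, trace-class-operator-valued measures in general. -/
def V (A : Sys) : Submodule ℂ (Pre A) := Submodule.span ℂ {X | IsState X}

instance (A : Sys) : AddCommGroup (V A) := (V A).addCommGroup

/-- Linear maps from the state space of `A` to the state space of `B`. -/
abbrev Map (A B : Sys) : Type := V A →ₗ[ℂ] V B

/-! ### Helper facts -/

theorem exists_state (A : Sys) : ∃ X : Pre A, IsState X := by
  classical
  obtain ⟨w⟩ := A.nonemptyΩ
  obtain ⟨i⟩ := A.nonemptyι
  refine ⟨VectorMeasure.dirac w (Matrix.diagonal (Pi.single i 1)), ?_, ?_⟩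
  · intro B
    have h : (Matrix.diagonal (Pi.single i (1 : ℂ))).PosSemidef := by
      refine Matrix.PosSemidef.diagonal ?_
      intro j
      by_cases hj : j = i
      · subst hj; simp
      · simp [hj]
    by_cases hB : MeasurableSet B
    · by_cases hw : w ∈ B
      · rw [VectorMeasure.dirac_apply_of_mem hB hw]; exact h
      · rw [VectorMeasure.dirac_apply_of_notMem hw]; exact Matrix.PosSemidef.zero
    · rw [VectorMeasure.not_measurable _ hB]; exact Matrix.PosSemidef.zero
  · rw [VectorMeasure.dirac_apply_of_mem MeasurableSet.univ (Set.mem_univ _)]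
    have h := hasSum_ite_eq i (1 : ℂ)
    refine h.congr_fun ?_
    intro j
    by_cases hj : j = i
    · subst hj; simp
    · simp [hj]

/-- A measure with positive values and summable diagonal belongs to the state space. -/
theorem mem_V_of_posSemidef {A : Sys} (Y : Pre A) (hY : ∀ B, (Y B).PosSemidef)
    (hs : Summable fun i => Y Set.univ i i) : Y ∈ V A := by
  obtain ⟨X, hX⟩ := exists_state A
  obtain ⟨t, ht⟩ := hs
  have ht0 : 0 ≤ t := ht.nonneg fun i => (hY _).diag_nonneg
  have hu : (0 : ℂ) < t + 1 := add_pos_of_nonneg_of_pos ht0 one_pos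
  have hst : IsState ((t + 1)⁻¹ • (Y + X)) := by
    constructor
    · intro B
      have h1 : ((t + 1)⁻¹ • (Y + X)) B = (t + 1)⁻¹ • (Y B + X B) := by simp
      rw [h1]
      exact ((hY B).add (hX.posSemidef B)).smul (inv_nonneg.mpr hu.le)
    · have h2 := (ht.add hX.trace_eq).mul_left (t + 1)⁻¹
      rw [inv_mul_cancel₀ hu.ne'] at h2
      exact h2.congr_fun (fun i => by simp [mul_add])
  have h3 : Y = (t + 1) • ((t + 1)⁻¹ • (Y + X)) - X := by
    rw [smul_smul, mul_inv_cancel₀ hu.ne', one_smul, add_sub_cancel_right]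
  rw [h3]
  exact (V A).sub_mem ((V A).smul_mem _ (Submodule.subset_span hst)) (Submodule.subset_span hX)

/-- Picking the block of a matrix on a composite index set belonging to `a`, `b`. -/
def block {ι κ : Type} (a b : κ) : Matrix (ι × κ) (ι × κ) ℂ →ₗ[ℂ] Matrix ι ι ℂ where
  toFun M := Matrix.of fun i j => M (i, a) (j, b)
  map_add' _ _ := rfl
  map_smul' _ _ := rfl

theorem block_apply {ι κ : Type} (a b : κ) (M : Matrix (ι × κ) (ι × κ) ℂ) (i j : ι) :
    block a b M i j = M (i, a) (j, b) := rfl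

theorem continuous_block {ι κ : Type} (a b : κ) :
    Continuous (block (ι := ι) a b) := by
  refine continuous_matrix fun i j => ?_
  exact Continuous.matrix_elem continuous_id (i, a) (j, b)

/-- The slice of a measure on a composite system by the outcome set `C` and the matrix unit of the
pair `(a, b)` on the second factor:  `B ↦ (X (B ×ˢ C) (i, a) (j, b))_{i j}`. -/
def preSlice {A R : Sys} (C : Set R.Ω) (a b : R.ι) : Pre (prod A R) →ₗ[ℂ] Pre A :=
  VectorMeasure.mapRangeₗ (block a b) (continuous_block a b) ∘ₗ
    VectorMeasure.mapₗ (Prod.fst : A.Ω × R.Ω → A.Ω) ∘ₗ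
      VectorMeasure.restrictₗ (Prod.snd ⁻¹' C : Set (A.Ω × R.Ω))

theorem preSlice_apply {A R : Sys} {C : Set R.Ω} (hC : MeasurableSet C) (a b : R.ι)
    (X : Pre (prod A R)) {B : Set A.Ω} (hB : MeasurableSet B) (i j : A.ι) :
    preSlice C a b X B i j = X (B ×ˢ C) (i, a) (j, b) := by
  have h1 : MeasurableSet (Prod.fst ⁻¹' B : Set (A.Ω × R.Ω)) := measurable_fst hB
  have h2 : MeasurableSet (Prod.snd ⁻¹' C : Set (A.Ω × R.Ω)) := measurable_snd hC
  have h3 : (preSlice C a b X) B = block a b (((X.restrict (Prod.snd ⁻¹' C)).map Prod.fst) B) := rfl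
  rw [h3, VectorMeasure.map_apply _ measurable_fst hB, VectorMeasure.restrict_apply _ h2 h1]
  rfl

theorem block_polar_posSemidef {ι κ : Type} (a b : κ) (w : ℂ) (hw : star w * w = 1)
    {M : Matrix (ι × κ) (ι × κ) ℂ} (hM : M.PosSemidef) :
    (block a a M + w • block a b M + star w • block b a M + block b b M).PosSemidef := by
  classical
  constructor
  · have h := hM.1
    ext i j
    have h1 := h.apply (i, a) (j, a)
    have h2 := h.apply (i, a) (j, b)
    have h3 := h.apply (i, b) (j, a)
    have h4 := h.apply (i, b) (j, b)
    simp only [block_apply, Matrix.conjTranspose_apply, Matrix.add_apply,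
      Matrix.smul_apply, smul_eq_mul, star_add, star_mul', star_star, h1, h2, h3, h4]
    ring
  · intro x
    have h := hM.2 (x.mapDomain (fun i => (i, a)) + w • x.mapDomain (fun i => (i, b)))
    have hl : ∀ (p : ι × κ) (y z : ι × κ →₀ ℂ) (u : ℂ),
        ((y + z).sum fun q zq => u * M p q * zq)
          = (y.sum fun q zq => u * M p q * zq) + z.sum fun q zq => u * M p q * zq := by
      intro p y z u
      exact Finsupp.sum_add_index' (by simp) (by intros; ring)
    have hr : ∀ (p : ι × κ) (c : κ) (v u : ℂ),
        ((v • x.mapDomain (fun i => (i, c))).sum fun q zq => u * M p q * zq)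
          = x.sum fun j xj => u * M p (j, c) * (v * xj) := by
      intro p c v u
      rw [Finsupp.sum_smul_index (by simp), Finsupp.sum_mapDomain_index (by simp) (by intros; ring)]
    have hr1 : ∀ (p : ι × κ) (c : κ) (u : ℂ),
        ((x.mapDomain (fun i => (i, c))).sum fun q zq => u * M p q * zq)
          = x.sum fun j xj => u * M p (j, c) * xj := by
      intro p c u
      rw [Finsupp.sum_mapDomain_index (by simp) (by intros; ring)]
    have hz : (x.mapDomain (fun i => (i, a)) + w • x.mapDomain (fun i => (i, b))).sum
        (fun p zp => (x.mapDomain (fun i => (i, a)) + w • x.mapDomain (fun i => (i, b))).sum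
          fun q zq => star zp * M p q * zq)
        = x.sum fun i xi => x.sum fun j xj => star xi *
            (block a a M + w • block a b M + star w • block b a M + block b b M) i j * xj := by
      simp only [hl, hr, hr1]
      rw [Finsupp.sum_add_index' (by simp)
          (by intros; simp only [star_add, add_mul, Finsupp.sum_add]; ring),
        Finsupp.sum_smul_index (by simp),
        Finsupp.sum_mapDomain_index (by simp)
          (by intros; simp only [star_add, add_mul, Finsupp.sum_add]; ring),
        Finsupp.sum_mapDomain_index (by simp)
          (by intros; simp only [mul_add, star_add, add_mul, Finsupp.sum_add]; ring)]
      simp only [← Finsupp.sum_add]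
      refine Finsupp.sum_congr fun i _ => Finsupp.sum_congr fun j _ => ?_
      simp only [block_apply, Matrix.add_apply, Matrix.smul_apply, smul_eq_mul, star_mul']
      linear_combination (star (x i) * M (i, b) (j, b) * x j) * hw
    rw [hz] at h
    exact h

theorem preSlice_mem {A R : Sys} (C : Set R.Ω) (a b : R.ι) (X : Pre (prod A R))
    (hX : X ∈ V (prod A R)) : preSlice C a b X ∈ V A := by
  suffices h : V (prod A R) ≤ (V A).comap (preSlice C a b) from h hX
  refine Submodule.span_le.mpr fun ρ hρ => ?_
  change preSlice C a b ρ ∈ V A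
  set D : Set (A.Ω × R.Ω) := Prod.snd ⁻¹' C
  have hap : ∀ (c d : R.ι) (B : Set A.Ω),
      preSlice C c d ρ B = block c d (((ρ.restrict D).map Prod.fst) B) := fun _ _ _ => rfl
  have hpos : ∀ B : Set A.Ω, (((ρ.restrict D).map Prod.fst) B).PosSemidef := by
    intro B
    by_cases hB : MeasurableSet B
    · rw [VectorMeasure.map_apply _ measurable_fst hB]
      by_cases hD : MeasurableSet D
      · rw [VectorMeasure.restrict_apply _ hD (measurable_fst hB)]
        exact hρ.posSemidef _
      · rw [VectorMeasure.restrict_not_measurable _ hD]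
        exact Matrix.PosSemidef.zero
    · rw [VectorMeasure.not_measurable _ hB]
      exact Matrix.PosSemidef.zero
  have hle : ∀ p : A.ι × R.ι, ((ρ.restrict D).map Prod.fst) Set.univ p p ≤ ρ Set.univ p p := by
    intro p
    rw [VectorMeasure.map_apply _ measurable_fst MeasurableSet.univ, Set.preimage_univ]
    by_cases hD : MeasurableSet D
    · rw [VectorMeasure.restrict_apply _ hD MeasurableSet.univ, Set.univ_inter]
      have h1 := VectorMeasure.of_add_of_sdiff (v := ρ) hD MeasurableSet.univ (Set.subset_univ D)
      rw [← h1, Matrix.add_apply]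
      exact le_add_of_nonneg_right (hρ.posSemidef _).diag_nonneg
    · rw [VectorMeasure.restrict_not_measurable _ hD]
      exact (hρ.posSemidef _).diag_nonneg
  have hsum : ∀ c : R.ι, Summable fun i => preSlice C c c ρ Set.univ i i := by
    intro c
    have hs : Summable fun i : A.ι => ρ Set.univ (i, c) (i, c) :=
      hρ.trace_eq.summable.comp_injective (i := fun i : A.ι => (i, c))
        (fun i j hij => congrArg Prod.fst hij)
    refine Summable.of_norm_bounded hs.norm fun i => ?_
    exact CStarAlgebra.norm_le_norm_of_nonneg_of_le (hpos Set.univ).diag_nonneg (hle (i, c))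
  let Y : ℂ → Pre A := fun w => preSlice C a a ρ + w • preSlice C a b ρ
    + star w • preSlice C b a ρ + preSlice C b b ρ
  have hYap : ∀ w B, Y w B = block a a (((ρ.restrict D).map Prod.fst) B)
      + w • block a b (((ρ.restrict D).map Prod.fst) B)
      + star w • block b a (((ρ.restrict D).map Prod.fst) B)
      + block b b (((ρ.restrict D).map Prod.fst) B) := by
    intro w B
    simp only [Y, ← hap]
    simp
  have hYpos : ∀ w, star w * w = 1 → ∀ B, (Y w B).PosSemidef := by
    intro w hw B
    rw [hYap]
    exact block_polar_posSemidef a b w hw (hpos B)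
  have hY : ∀ w, star w * w = 1 → Y w ∈ V A := by
    intro w hw
    refine mem_V_of_posSemidef _ (hYpos w hw) ?_
    have h2 := (((hsum a).add (hsum b)).mul_left 2)
    refine Summable.of_norm_bounded h2.norm fun i => ?_
    refine CStarAlgebra.norm_le_norm_of_nonneg_of_le (hYpos w hw _).diag_nonneg ?_
    have h3 := (hYpos (-w) (by simpa using hw) Set.univ).diag_nonneg (i := i)
    have h4 : 2 * (preSlice C a a ρ Set.univ i i + preSlice C b b ρ Set.univ i i)
        = Y w Set.univ i i + Y (-w) Set.univ i i := by
      rw [hYap, hYap, hap, hap]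
      simp only [Matrix.add_apply, Matrix.smul_apply, smul_eq_mul, star_neg]
      ring
    rw [h4]
    exact le_add_of_nonneg_right h3
  have hfin : preSlice C a b ρ = (1 / 4 : ℂ) • ((Y 1 - Y (-1))
      - Complex.I • (Y Complex.I - Y (-Complex.I))) := by
    have hI : Complex.I * Complex.I = -1 := Complex.I_mul_I
    simp only [Y, Complex.star_def, Complex.conj_I, map_neg, map_one]
    match_scalars <;>
      first | ring1 | linear_combination (1 / 2 : ℂ) * hI | linear_combination (-1 / 2 : ℂ) * hI
  rw [hfin]
  refine (V A).smul_mem _ ((V A).sub_mem ((V A).sub_mem (hY _ ?_) (hY _ ?_))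
    ((V A).smul_mem _ ((V A).sub_mem (hY _ ?_) (hY _ ?_)))) <;> simp

/-- `preSlice` on the state spaces. -/
def slice {A R : Sys} (C : Set R.Ω) (a b : R.ι) : Map (prod A R) A :=
  (preSlice C a b).restrict (preSlice_mem C a b)

/-- Renaming alphabet and basis. -/
def preRelabel {A B : Sys} (e : A.Ω ≃ᵐ B.Ω) (f : A.ι ≃ B.ι) : Pre A →ₗ[ℂ] Pre B :=
  VectorMeasure.mapRangeₗ (Matrix.reindexLinearEquiv ℂ ℂ f f).toLinearMap
    (Continuous.matrix_submatrix continuous_id _ _) ∘ₗ VectorMeasure.mapₗ e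

theorem preRelabel_isState {A B : Sys} (e : A.Ω ≃ᵐ B.Ω) (f : A.ι ≃ B.ι) {X : Pre A}
    (hX : IsState X) : IsState (preRelabel e f X) := by
  have h (S : Set B.Ω) : preRelabel e f X S = ((X.map e) S).submatrix f.symm f.symm := rfl
  constructor
  · intro S
    rw [h]
    refine Matrix.PosSemidef.submatrix ?_ _
    by_cases hS : MeasurableSet S
    · rw [VectorMeasure.map_apply _ e.measurable hS]; exact hX.posSemidef _
    · rw [VectorMeasure.not_measurable _ hS]; exact Matrix.PosSemidef.zero
  · rw [h, VectorMeasure.map_apply _ e.measurable MeasurableSet.univ]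
    exact (f.symm.hasSum_iff (f := fun i => X Set.univ i i)).mpr hX.trace_eq

theorem preRelabel_mem {A B : Sys} (e : A.Ω ≃ᵐ B.Ω) (f : A.ι ≃ B.ι) (X : Pre A) (hX : X ∈ V A) :
    preRelabel e f X ∈ V B := by
  have h : V A ≤ (V B).comap (preRelabel e f) :=
    Submodule.span_le.mpr fun Y hY => Submodule.subset_span (preRelabel_isState e f hY)
  exact h hX

/-- `preRelabel` on the state spaces. -/
def relabel {A B : Sys} (e : A.Ω ≃ᵐ B.Ω) (f : A.ι ≃ B.ι) : Map A B :=
  (preRelabel e f).restrict (preRelabel_mem e f)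

/-- The exchange of the two factors. -/
def swap (A R : Sys) : Map (prod A R) (prod R A) :=
  relabel (A := prod A R) (B := prod R A) MeasurableEquiv.prodComm (Equiv.prodComm _ _)

/-- The identification of `A` with `A ⊗ 1`. -/
def unitor (A : Sys) : Map A (prod A unit) :=
  relabel (A := A) (B := prod A unit)
    { toEquiv := (Equiv.prodPUnit A.Ω).symm
      measurable_toFun := measurable_id.prodMk measurable_const
      measurable_invFun := measurable_fst }
    (Equiv.prodPUnit A.ι).symm

/-! ### Channels and tensor products -/

/-- `Θ = Φ ⊗ id_R`: on every slice along `R`, `Θ` acts as `Φ`.  Since the elements of `V (prod B R)`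
are determined by their slices, there is at most one such `Θ`. -/
def IsAmplification {A B : Sys} (Φ : Map A B) (R : Sys) (Θ : Map (prod A R) (prod B R)) : Prop :=
  ∀ (X : V (prod A R)) (C : Set R.Ω), MeasurableSet C → ∀ a b : R.ι,
    slice C a b (Θ X) = Φ (slice C a b X)

/-- Channels (completely positive trace preserving maps): linear maps that send states to states and
whose amplification by any ancilla system again sends states to states. -/
structure IsChannel {A B : Sys} (Φ : Map A B) : Prop where
  map_state : ∀ X : V A, IsState X.1 → IsState (Φ X).1
  map_state_ancilla : ∀ R : Sys, ∃ Θ : Map (prod A R) (prod B R), IsAmplification Φ R Θ ∧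
    ∀ X : V (prod A R), IsState X.1 → IsState (Θ X).1

/-- Tangent vectors of the set of channels: the real multiples of differences of channels, which form
the real span of the differences.  (In the case of states these are precisely the self-adjoint
elements of trace zero.) -/
def IsTangent {A B : Sys} (Δ : Map A B) : Prop :=
  ∃ (c : ℝ) (Ψ₁ Ψ₂ : Map A B), IsChannel Ψ₁ ∧ IsChannel Ψ₂ ∧ Δ = (c : ℂ) • (Ψ₁ - Ψ₂)

open Classical in
/-- `Φ ⊗ id_R`; it exists for linear combinations of channels. -/
def amp {A B : Sys} (Φ : Map A B) (R : Sys) : Map (prod A R) (prod B R) :=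
  if h : ∃ Θ, IsAmplification Φ R Θ then h.choose else 0

/-- `Φ ⊗ Ψ = (Φ ⊗ id) ∘ (id ⊗ Ψ)`. -/
def tensor {A B A' B' : Sys} (Φ : Map A B) (Ψ : Map A' B') : Map (prod A A') (prod B B') :=
  amp Φ B' ∘ₗ swap B' A ∘ₗ amp Ψ A ∘ₗ swap A A'

/-- `Φ^{⊗ n}`. -/
def tpow {A B : Sys} (Φ : Map A B) : (n : ℕ) → Map (pow A n) (pow B n)
  | 0 => LinearMap.id
  | n + 1 => tensor Φ (tpow Φ n)

/-- `Δ^{(n)} = Δ ⊗ Φ^{⊗ (n-1)} + Φ ⊗ Δ ⊗ Φ^{⊗ (n-2)} + ⋯ + Φ^{⊗ (n-1)} ⊗ Δ`. -/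
def dpow {A B : Sys} (Φ Δ : Map A B) : (n : ℕ) → Map (pow A n) (pow B n)
  | 0 => 0
  | n + 1 => tensor Δ (tpow Φ n) + tensor Φ (dpow Φ Δ n)

/-- An element `x` of the state space of `S` as a map with trivial input: `1 ↦ x`.  This is how a
state, and a tangent vector at a state, is regarded as a channel and a tangent vector at it. -/
def prep {S : Sys} (x : V S) : Map unit S where
  toFun X := (X.1 Set.univ () ()) • x
  map_add' X Y := by simp [add_smul]
  map_smul' c X := by simp [mul_smul]

/-- `I_A ⊗ x`, that is `X ↦ X ⊗ x`. -/
def attach (A : Sys) {S : Sys} (x : V S) : Map A (prod A S) :=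
  tensor LinearMap.id (prep x) ∘ₗ unitor A

/-! ### Norms -/

/-- Trace norm of a self-adjoint element `X` of the state space: the least `s + t` such that
`X = s ρ - t σ` with states `ρ`, `σ` and `s, t ≥ 0` (attained by the Jordan decomposition).  The value
is `⊤` if `X` is not self-adjoint. -/
def traceNorm {A : Sys} (X : V A) : ℝ≥0∞ :=
  ⨅ (s : ℝ≥0) (t : ℝ≥0) (ρ : V A) (σ : V A) (_ : IsState ρ.1) (_ : IsState σ.1)
    (_ : X = ((s : ℝ) : ℂ) • ρ - ((t : ℝ) : ℂ) • σ), ((s + t : ℝ≥0) : ℝ≥0∞)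

/-- The completely bounded norm `sup_k ‖D ⊗ id_{M_k}‖` (with respect to trace norms) of a
self-adjointness preserving map `D`, where the operator norms may be computed on self-adjoint elements
(pass from `M_k` to `M_{2k}` by `X ↦ [[0, X], [Xᴴ, 0]] / 2`). -/
def cbNorm {A B : Sys} (D : Map A B) : ℝ≥0∞ :=
  ⨆ (k : ℕ) (X : V (prod A (quantum (Fin (k + 1))))) (_ : traceNorm X ≤ 1),
    traceNorm (amp D (quantum (Fin (k + 1))) X)

/-! ### Classical systems: Fisher information and Gaussian shifts -/

/-- Real part of an element of the state space of a classical system, as a signed measure. -/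
def toSigned {Ω : Type} [MeasurableSpace Ω] [Nonempty Ω] (x : V (classical Ω)) : SignedMeasure Ω :=
  VectorMeasure.mapRange x.1
    (Complex.reAddGroupHom.comp (Matrix.entryAddMonoidHom ℂ () ()))
    (Complex.continuous_re.comp (Continuous.matrix_elem continuous_id () ()))

open Classical in
/-- Classical Fisher information `J_p(δ) = ∫ (dδ/dp)² dp`, which is `∞` unless `δ ≪ p`.  For a
probability measure `p` its total variation measure is `p` itself, as a measure. -/
def fisher {Ω : Type} [MeasurableSpace Ω] [Nonempty Ω] (p δ : V (classical Ω)) : ℝ≥0∞ :=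
  if (toSigned δ).totalVariation ≪ (toSigned p).totalVariation then
    ∫⁻ x, ENNReal.ofReal (((toSigned δ).rnDeriv (toSigned p).totalVariation x) ^ 2)
      ∂(toSigned p).totalVariation
  else ⊤

/-- A signed measure as a matrix valued measure with `1 × 1` matrices. -/
def preOfSigned {Ω : Type} [MeasurableSpace Ω] [Nonempty Ω] (s : SignedMeasure Ω) :
    Pre (classical Ω) :=
  VectorMeasure.mapRange s
    ({ toFun := fun r => Matrix.of fun _ _ => (r : ℂ)
       map_zero' := by ext; simp
       map_add' := fun _ _ => by ext; simp } : ℝ →+ Matrix Unit Unit ℂ)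
    (continuous_matrix fun _ _ => Complex.continuous_ofReal)

theorem preOfSigned_mem {Ω : Type} [MeasurableSpace Ω] [Nonempty Ω] (s : SignedMeasure Ω) :
    preOfSigned s ∈ V (classical Ω) := by
  have h : ∀ μ : Measure Ω, ∀ _ : IsFiniteMeasure μ, preOfSigned μ.toSignedMeasure ∈ V (classical Ω) := by
    intro μ _
    refine mem_V_of_posSemidef _ (fun B => ?_) (Summable.of_finite)
    have h1 : preOfSigned μ.toSignedMeasure B
        = Matrix.diagonal fun _ => ((μ.toSignedMeasure B : ℝ) : ℂ) := by
      ext i j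
      simp [preOfSigned]
    rw [h1]
    refine Matrix.PosSemidef.diagonal fun i => ?_
    have h2 : 0 ≤ μ.toSignedMeasure B := by
      rw [Measure.toSignedMeasure_apply]
      split_ifs <;> positivity
    exact Complex.zero_le_real.mpr h2
  have h3 := s.toSignedMeasure_toJordanDecomposition
  have h4 : preOfSigned s = preOfSigned s.toJordanDecomposition.posPart.toSignedMeasure
      - preOfSigned s.toJordanDecomposition.negPart.toSignedMeasure := by
    nth_rw 1 [← h3]
    ext B _ i j
    simp [preOfSigned, JordanDecomposition.toSignedMeasure]
  rw [h4]
  exact (V _).sub_mem (h _ inferInstance) (h _ inferInstance)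

/-- A signed measure as an element of the state space of a classical system. -/
def ofSigned {Ω : Type} [MeasurableSpace Ω] [Nonempty Ω] (s : SignedMeasure Ω) : V (classical Ω) :=
  ⟨preOfSigned s, preOfSigned_mem s⟩

/-- The Gaussian distribution `N(a, v)` with mean `a` and variance `v`. -/
def gauss (a : ℝ) (v : ℝ≥0) : V line :=
  ofSigned (gaussianReal a v).toSignedMeasure

/-- `δN(a, v)`: the signed measure with Lebesgue density `(x - a) / v` times the density of
`N(a, v)`. -/
def dgauss (a : ℝ) (v : ℝ≥0) : V line :=
  ofSigned (volume.withDensityᵥ fun x => (x - a) / v * gaussianPDFReal a v x)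

/-! ### Axioms for metrics -/

/-- A function `G` assigning to `Φ` and `Δ` a number `G_Φ(Δ)` in `[0, ∞]`.  Only channels `Φ` and
tangent vectors `Δ` matter. -/
abbrev MetricFn : Type 1 := ∀ ⦃A B : Sys⦄, Map A B → Map A B → ℝ≥0∞

/-- `G_Φ` is the square of a norm (with values in `[0, ∞]`) on tangent vectors. -/
structure IsMetric (G : MetricFn) : Prop where
  smul : ∀ {A B : Sys} (Φ Δ : Map A B), IsChannel Φ → IsTangent Δ → ∀ c : ℝ,
    G Φ ((c : ℂ) • Δ) = ENNReal.ofReal (c ^ 2) * G Φ Δ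
  triangle : ∀ {A B : Sys} (Φ Δ Δ' : Map A B), IsChannel Φ → IsTangent Δ → IsTangent Δ' →
    (G Φ (Δ + Δ')) ^ (1 / 2 : ℝ) ≤ (G Φ Δ) ^ (1 / 2 : ℝ) + (G Φ Δ') ^ (1 / 2 : ℝ)
  definite : ∀ {A B : Sys} (Φ Δ : Map A B), IsChannel Φ → IsTangent Δ → G Φ Δ = 0 → Δ = 0

/-- (M) Monotonicity under concatenation of channels before and after. -/
structure AxiomM (G : MetricFn) : Prop where
  pre : ∀ {A B C : Sys} (Φ Δ : Map B C) (Ψ : Map A B), IsChannel Φ → IsTangent Δ → IsChannel Ψ →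
    G (Φ ∘ₗ Ψ) (Δ ∘ₗ Ψ) ≤ G Φ Δ
  post : ∀ {A B C : Sys} (Φ Δ : Map A B) (Ψ : Map B C), IsChannel Φ → IsTangent Δ → IsChannel Ψ →
    G (Ψ ∘ₗ Φ) (Ψ ∘ₗ Δ) ≤ G Φ Δ

/-- (E) Invariance under tensoring with an identity channel. -/
def AxiomE (G : MetricFn) : Prop :=
  ∀ {A B : Sys} (Φ Δ : Map A B) (R : Sys), IsChannel Φ → IsTangent Δ →
    G (amp Φ R) (amp Δ R) = G Φ Δ

/-- (A1) Parallel asymptotic weak additivity: `lim (1/n) G_{Φ^{⊗n}}(Δ^{(n)}) = G_Φ(Δ)`. -/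
def AxiomA1 (G : MetricFn) : Prop :=
  ∀ {A B : Sys} (Φ Δ : Map A B), IsChannel Φ → IsTangent Δ →
    Tendsto (fun n : ℕ => G (tpow Φ n) (dpow Φ Δ n) / n) atTop (𝓝 (G Φ Δ))

/-- (C1) Parallel weak asymptotic continuity: if `‖Φⁿ - Φ^{⊗n}‖_cb → 0` and
`‖Δⁿ - Δ^{(n)}‖_cb / √n → 0`, then `liminf (1/n) (G_{Φⁿ}(Δⁿ) - G_{Φ^{⊗n}}(Δ^{(n)})) ≥ 0`.
The `liminf` is unfolded: for each `ε > 0`, eventually `G_{Φ^{⊗n}}(Δ^{(n)}) ≤ G_{Φⁿ}(Δⁿ) + n ε`.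
Since the values may be infinite, the left side is cut off at `n K`, with `K < ∞` arbitrary; under (A1)
this has no effect if `G_Φ(Δ) < ∞`, and if `G_Φ(Δ) = ∞` it says that `(1/n) G_{Φⁿ}(Δⁿ) → ∞`. -/
def AxiomC1 (G : MetricFn) : Prop :=
  ∀ {A B : Sys} (Φ Δ : Map A B), IsChannel Φ → IsTangent Δ →
    ∀ Φn Δn : (n : ℕ) → Map (pow A n) (pow B n),
      (∀ n, IsChannel (Φn n)) → (∀ n, IsTangent (Δn n)) →
      Tendsto (fun n => cbNorm (Φn n - tpow Φ n)) atTop (𝓝 0) →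
      Tendsto (fun n => cbNorm (Δn n - dpow Φ Δ n) / ENNReal.ofReal √(n : ℝ)) atTop (𝓝 0) →
      ∀ ε K : ℝ≥0, 0 < ε → ∀ᶠ n : ℕ in atTop,
        min (G (tpow Φ n) (dpow Φ Δ n)) (n * K) ≤ G (Φn n) (Δn n) + n * ε

/-- (N') Normalization on the standard Gaussian shift: `g_{N(0,1)}(δN(0,1)) = 1`. -/
def AxiomN' (G : MetricFn) : Prop :=
  G (prep (gauss 0 1)) (prep (dgauss 0 1)) = 1

/-! ### The extremal quantities -/

/-- `G^min_Φ(Δ)`: the supremum of the Fisher information of the outcome distributions, over all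
Hilbert spaces `ℓ²(κ)`, input states `ρ` on the input system times `ℓ²(κ)`, and measurements `M`
(channels to a classical system) at the output. -/
def GMin {A B : Sys} (Φ Δ : Map A B) : ℝ≥0∞ :=
  ⨆ (κ : Type) (_ : Nonempty κ) (ρ : V (prod A (quantum κ))) (_ : IsState ρ.1)
    (Ω : Type) (_ : MeasurableSpace Ω) (_ : Nonempty Ω)
    (M : Map (prod B (quantum κ)) (classical Ω)) (_ : IsChannel M),
    fisher (M (amp Φ (quantum κ) ρ)) (M (amp Δ (quantum κ) ρ))

/-- `G^{p,min}_Φ(Δ) = lim (1/n) G^min_{Φ^{⊗n}}(Δ^{(n)})`.  (By superadditivity the limit exists; writing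
the upper limit makes the definition meaningful without this.) -/
def GpMin {A B : Sys} (Φ Δ : Map A B) : ℝ≥0∞ :=
  limsup (fun n : ℕ => GMin (tpow Φ n) (dpow Φ Δ n) / n) atTop

/-- An asymptotic parallel classical tangent simulation of `(Φ, Δ)` by the Gaussian shifts
`qⁿ = N(aₙ, vₙ)`, `δⁿ = cₙ δN(aₙ, vₙ)` and the channels `Λⁿ`:
`‖Φ^{⊗n} - Λⁿ ∘ (I ⊗ qⁿ)‖_cb → 0` and `‖Δ^{(n)} - Λⁿ ∘ (I ⊗ δⁿ)‖_cb / √n → 0`. -/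
structure IsGaussianSimulation {A B : Sys} (Φ Δ : Map A B) (a : ℕ → ℝ) (v : ℕ → ℝ≥0) (c : ℕ → ℝ)
    (Λ : (n : ℕ) → Map (prod (pow A n) line) (pow B n)) : Prop where
  pos : ∀ n, 0 < v n
  channel : ∀ n, IsChannel (Λ n)
  approx : Tendsto (fun n => cbNorm (tpow Φ n - Λ n ∘ₗ attach (pow A n) (gauss (a n) (v n))))
    atTop (𝓝 0)
  approx_tangent : Tendsto (fun n => cbNorm (dpow Φ Δ n -
      Λ n ∘ₗ attach (pow A n) ((c n : ℂ) • dgauss (a n) (v n))) / ENNReal.ofReal √(n : ℝ))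
    atTop (𝓝 0)

/-- `G̃^{p,max}_Φ(Δ)`: the infimum of `lim (1/n) J_{qⁿ}(δⁿ)` over all asymptotic simulations by Gaussian
shifts.  With the lower limit every simulation takes part, whether or not the limit exists. -/
def GpMaxTilde {A B : Sys} (Φ Δ : Map A B) : ℝ≥0∞ :=
  ⨅ (a : ℕ → ℝ) (v : ℕ → ℝ≥0) (c : ℕ → ℝ)
    (Λ : (n : ℕ) → Map (prod (pow A n) line) (pow B n)) (_ : IsGaussianSimulation Φ Δ a v c Λ),
    liminf (fun n : ℕ => fisher (gauss (a n) (v n)) ((c n : ℂ) • dgauss (a n) (v n)) / n) atTop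

end

end ChannelMetric

open ChannelMetric

/-!
The theorem compares an arbitrary metric with two extremal quantities; both comparisons use the
axioms only through simulations by, or of, Gaussian shift models, for which (N') fixes the metric.

**Lower bound.** By (A1) it is enough to show that the metric of every tensor power dominates its
one-copy minimal quantity (`GMin_le_metric`). By (E) and (M) the metric of a channel is at least
that of the outcome distribution of any measurement on any input state with ancilla, so the claim
is that on classical systems the metric dominates the Fisher information (`fisher_le_metric`).
This follows from a Cauchy-Schwarz inequality `(∫ f dδ)² ≤ ∫ f² dp · G_p(δ)` for bounded `f`
(`sq_integral_le_metric`): indicator functions of null sets show `δ ≪ p` if `G_p(δ)` is finite,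
and truncations of the density `dδ/dp` exhaust the Fisher information.

The inequality is the place where the central limit theorem enters. After processing by `f`,
centred and rescaled, the model lives on the real line, with mean zero and variance `u < 1` at
`p`. The normalized sum of `n` samples, with Gaussian noise of variance `w = 1 - u` added, tends
to `N(0, 1)` in total variation, at rate `1/√n` (`exists_abs_cpow_sub_gaussianReal_le`), while the
perturbation by `δ` of one sample, summed over the samples, is `√n · c · δN(0, 1)` up to a bounded
error, where `c` is the mean under `δ` (`exists_abs_conv_cpow_sub_le`). Both are proved by
replacing the summands one after the other by Gaussian ones: the noise makes the probability of a
fixed event a smooth function of the sum of the summands, with derivatives controlled by the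
Cauchy estimates for its entire extension, so that Taylor expansion to third order suffices. A
sequence of rotations of the plane (`spread`) transforms `N(0, 1)` into `N(0, 1)^{⊗ n}` and `√n ·
δN(0, 1)` into its tangent vector `δN(0, 1)^{(n)}`. Thus `n` samples of the model asymptotically
simulate `n` copies of the standard Gaussian shift scaled by `c`, and (C1) at the Gaussian shift,
(A1) and (N') give `c² ≤ G_p(δ)` (`ofReal_sq_mean_le_metric`).

**Upper bound.** A Gaussian shift `(N(a, v), c · δN(a, v))` is an affine image of `(N(0, 1), c/√v
· δN(0, 1))`, so its metric is at most `c²/v`, its Fisher information (`metric_gauss_le`,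
`le_fisher_gauss`). By (E) and (M) the same bound holds for every channel that is obtained by
attaching the shift to the input and processing the result. If such channels approximate the
powers of `(Φ, Δ)`, then (C1) and (A1) bound the metric of `(Φ, Δ)` (`metric_le_GpMaxTilde`).

To let states act as channels of trivial input one needs that a product of states is a state
(`exists_product_state`). Finite blocks of an operator valued measure have a positive semidefinite
matrix density with respect to a finite measure, and the blocks of the product are integrals of
Kronecker products of the densities.
-/

namespace ChannelMetric

noncomputable section

/-! ### Amplifications and channels -/

/-- The additive group of a state space, in the form in which instance search finds it for systems
that are given by explicit data, such as composite systems. -/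
instance instAddCommGroupVMk (Ω ι : Type) [MeasurableSpace Ω] [Nonempty Ω] [Nonempty ι] :
    AddCommGroup (V ⟨Ω, ι⟩) :=
  instAddCommGroupSubtypePreMemSubmoduleComplexV ⟨Ω, ι⟩

theorem slice_apply {A R : Sys} {C : Set R.Ω} (hC : MeasurableSet C) (a b : R.ι)
    (X : V (prod A R)) {B : Set A.Ω} (hB : MeasurableSet B) (i j : A.ι) :
    (slice C a b X).1 B i j = X.1 (B ×ˢ C) (i, a) (j, b) :=
  preSlice_apply hC a b X.1 hB i j

theorem pre_ext {A : Sys} {X Y : V A}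
    (h : ∀ B, MeasurableSet B → ∀ i j, X.1 B i j = Y.1 B i j) : X = Y :=
  Subtype.ext (VectorMeasure.ext fun B hB => Matrix.ext fun i j => h B hB i j)

/-- An element of the state space of a composite system is determined by its values on measurable
rectangles. -/
theorem prod_ext {A R : Sys} {X Y : V (prod A R)}
    (h : ∀ B, MeasurableSet B → ∀ C, MeasurableSet C → ∀ i a j b,
      X.1 (B ×ˢ C) (i, a) (j, b) = Y.1 (B ×ˢ C) (i, a) (j, b)) : X = Y := by
  refine Subtype.ext (VectorMeasure.ext_of_generateFrom _ ?_ generateFrom_prod.symm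
    isPiSystem_prod ?_)
  · rintro _ ⟨B, hB, C, hC, rfl⟩
    exact Matrix.ext fun ⟨i, a⟩ ⟨j, b⟩ => h B hB C hC i a j b
  · rw [← Set.univ_prod_univ]
    exact Matrix.ext fun ⟨i, a⟩ ⟨j, b⟩ => h _ MeasurableSet.univ _ MeasurableSet.univ i a j b

theorem slice_ext {A R : Sys} {X Y : V (prod A R)}
    (h : ∀ C, MeasurableSet C → ∀ a b, slice C a b X = slice C a b Y) : X = Y := by
  refine prod_ext fun B hB C hC i a j b => ?_
  rw [← slice_apply hC a b X hB, ← slice_apply hC a b Y hB, h C hC a b]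

/-- `Φ ⊗ id_R` exists for every ancilla `R`. -/
def Amplifiable {A B : Sys} (Φ : Map A B) : Prop := ∀ R, ∃ Θ, IsAmplification Φ R Θ

theorem IsAmplification.unique {A B R : Sys} {Φ : Map A B} {Θ Θ' : Map (prod A R) (prod B R)}
    (h : IsAmplification Φ R Θ) (h' : IsAmplification Φ R Θ') : Θ = Θ' :=
  LinearMap.ext fun X => slice_ext fun C hC a b => (h X C hC a b).trans (h' X C hC a b).symm

theorem amp_eq {A B R : Sys} {Φ : Map A B} {Θ : Map (prod A R) (prod B R)}
    (h : IsAmplification Φ R Θ) : amp Φ R = Θ := by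
  have h1 : ∃ Θ, IsAmplification Φ R Θ := ⟨Θ, h⟩
  rw [amp, dif_pos h1]
  exact h1.choose_spec.unique h

theorem Amplifiable.spec {A B : Sys} {Φ : Map A B} (h : Amplifiable Φ) (R : Sys) :
    IsAmplification Φ R (amp Φ R) := by
  obtain ⟨Θ, hΘ⟩ := h R
  rwa [amp_eq hΘ]

theorem IsAmplification.add {A B R : Sys} {Φ Ψ : Map A B} {Θ Ξ : Map (prod A R) (prod B R)}
    (h : IsAmplification Φ R Θ) (h' : IsAmplification Ψ R Ξ) :
    IsAmplification (Φ + Ψ) R (Θ + Ξ) := fun X C hC a b => by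
  rw [LinearMap.add_apply, map_add, h X C hC, h' X C hC, LinearMap.add_apply]

theorem IsAmplification.smul {A B R : Sys} {Φ : Map A B} {Θ : Map (prod A R) (prod B R)}
    (c : ℂ) (h : IsAmplification Φ R Θ) : IsAmplification (c • Φ) R (c • Θ) := fun X C hC a b => by
  rw [LinearMap.smul_apply, map_smul, h X C hC, LinearMap.smul_apply]

theorem IsAmplification.sub {A B R : Sys} {Φ Ψ : Map A B} {Θ Ξ : Map (prod A R) (prod B R)}
    (h : IsAmplification Φ R Θ) (h' : IsAmplification Ψ R Ξ) :
    IsAmplification (Φ - Ψ) R (Θ - Ξ) := fun X C hC a b => by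
  rw [LinearMap.sub_apply, map_sub, h X C hC, h' X C hC, LinearMap.sub_apply]

theorem IsAmplification.comp {A B C R : Sys} {Φ : Map A B} {Ψ : Map B C}
    {Θ : Map (prod A R) (prod B R)} {Ξ : Map (prod B R) (prod C R)}
    (h' : IsAmplification Ψ R Ξ) (h : IsAmplification Φ R Θ) :
    IsAmplification (Ψ ∘ₗ Φ) R (Ξ ∘ₗ Θ) := fun X C hC a b => by
  rw [LinearMap.comp_apply, h' _ C hC, h X C hC, LinearMap.comp_apply]

theorem isAmplification_id (A R : Sys) :
    IsAmplification (LinearMap.id : Map A A) R LinearMap.id := fun _ _ _ _ _ => rfl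

theorem Amplifiable.add {A B : Sys} {Φ Ψ : Map A B} (h : Amplifiable Φ) (h' : Amplifiable Ψ) :
    Amplifiable (Φ + Ψ) := fun R => ⟨_, (h.spec R).add (h'.spec R)⟩

theorem Amplifiable.smul {A B : Sys} {Φ : Map A B} (c : ℂ) (h : Amplifiable Φ) :
    Amplifiable (c • Φ) := fun R => ⟨_, (h.spec R).smul c⟩

theorem Amplifiable.sub {A B : Sys} {Φ Ψ : Map A B} (h : Amplifiable Φ) (h' : Amplifiable Ψ) :
    Amplifiable (Φ - Ψ) := fun R => ⟨_, (h.spec R).sub (h'.spec R)⟩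

theorem Amplifiable.comp {A B C : Sys} {Φ : Map A B} {Ψ : Map B C} (h' : Amplifiable Ψ)
    (h : Amplifiable Φ) : Amplifiable (Ψ ∘ₗ Φ) := fun R => ⟨_, (h'.spec R).comp (h.spec R)⟩

theorem amp_add {A B : Sys} {Φ Ψ : Map A B} (h : Amplifiable Φ) (h' : Amplifiable Ψ) (R : Sys) :
    amp (Φ + Ψ) R = amp Φ R + amp Ψ R := amp_eq ((h.spec R).add (h'.spec R))

theorem amp_smul {A B : Sys} {Φ : Map A B} (c : ℂ) (h : Amplifiable Φ) (R : Sys) :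
    amp (c • Φ) R = c • amp Φ R := amp_eq ((h.spec R).smul c)

theorem amp_sub {A B : Sys} {Φ Ψ : Map A B} (h : Amplifiable Φ) (h' : Amplifiable Ψ) (R : Sys) :
    amp (Φ - Ψ) R = amp Φ R - amp Ψ R := amp_eq ((h.spec R).sub (h'.spec R))

theorem amp_comp {A B C : Sys} {Φ : Map A B} {Ψ : Map B C} (h' : Amplifiable Ψ)
    (h : Amplifiable Φ) (R : Sys) : amp (Ψ ∘ₗ Φ) R = amp Ψ R ∘ₗ amp Φ R :=
  amp_eq ((h'.spec R).comp (h.spec R))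

theorem amp_id (A R : Sys) : amp (LinearMap.id : Map A A) R = LinearMap.id :=
  amp_eq (isAmplification_id A R)

theorem IsChannel.amplifiable {A B : Sys} {Φ : Map A B} (h : IsChannel Φ) : Amplifiable Φ :=
  fun R => ⟨_, (h.map_state_ancilla R).choose_spec.1⟩

theorem IsChannel.amp_state {A B : Sys} {Φ : Map A B} (h : IsChannel Φ) (R : Sys)
    (X : V (prod A R)) (hX : IsState X.1) : IsState (amp Φ R X).1 := by
  obtain ⟨Θ, hΘ, h2⟩ := h.map_state_ancilla R
  rw [amp_eq hΘ]
  exact h2 X hX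

theorem IsChannel.comp {A B C : Sys} {Φ : Map A B} {Ψ : Map B C} (h' : IsChannel Ψ)
    (h : IsChannel Φ) : IsChannel (Ψ ∘ₗ Φ) where
  map_state X hX := h'.map_state _ (h.map_state X hX)
  map_state_ancilla R := ⟨_, (h'.amplifiable.spec R).comp (h.amplifiable.spec R),
    fun X hX => h'.amp_state R _ (h.amp_state R X hX)⟩

theorem isChannel_id (A : Sys) : IsChannel (LinearMap.id : Map A A) where
  map_state _ hX := hX
  map_state_ancilla R := ⟨_, isAmplification_id A R, fun _ hX => hX⟩

theorem IsState.convex {A : Sys} {X Y : Pre A} (hX : IsState X) (hY : IsState Y) {s t : ℝ}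
    (hs : 0 ≤ s) (ht : 0 ≤ t) (hst : s + t = 1) : IsState ((s : ℂ) • X + (t : ℂ) • Y) := by
  constructor
  · intro B
    have h1 : ((s : ℂ) • X + (t : ℂ) • Y) B = (s : ℂ) • X B + (t : ℂ) • Y B := by simp
    rw [h1]
    exact ((hX.posSemidef B).smul (Complex.zero_le_real.mpr hs)).add
      ((hY.posSemidef B).smul (Complex.zero_le_real.mpr ht))
  · have h2 := (hX.trace_eq.mul_left (s : ℂ)).add (hY.trace_eq.mul_left (t : ℂ))
    have h3 : (s : ℂ) * 1 + t * 1 = 1 := by rw [mul_one, mul_one]; exact_mod_cast hst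
    rw [h3] at h2
    exact h2.congr_fun (fun i => by simp)

theorem IsChannel.convex {A B : Sys} {Φ Ψ : Map A B} (hΦ : IsChannel Φ) (hΨ : IsChannel Ψ)
    {s t : ℝ} (hs : 0 ≤ s) (ht : 0 ≤ t) (hst : s + t = 1) :
    IsChannel ((s : ℂ) • Φ + (t : ℂ) • Ψ) where
  map_state X hX := (hΦ.map_state X hX).convex (hΨ.map_state X hX) hs ht hst
  map_state_ancilla R := ⟨_, ((hΦ.amplifiable.spec R).smul _).add ((hΨ.amplifiable.spec R).smul _),
    fun X hX => (hΦ.amp_state R X hX).convex (hΨ.amp_state R X hX) hs ht hst⟩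

/-! ### Tangent vectors -/

theorem IsTangent.amplifiable {A B : Sys} {Δ : Map A B} (h : IsTangent Δ) : Amplifiable Δ := by
  obtain ⟨c, Ψ₁, Ψ₂, h1, h2, rfl⟩ := h
  exact (h1.amplifiable.sub h2.amplifiable).smul _

theorem IsTangent.smul {A B : Sys} {Δ : Map A B} (r : ℝ) (h : IsTangent Δ) :
    IsTangent ((r : ℂ) • Δ) := by
  obtain ⟨c, Ψ₁, Ψ₂, h1, h2, rfl⟩ := h
  exact ⟨r * c, Ψ₁, Ψ₂, h1, h2, by rw [smul_smul]; push_cast; rfl⟩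

theorem IsTangent.comp_left {A B C : Sys} {Δ : Map A B} {Ψ : Map B C} (hΨ : IsChannel Ψ)
    (h : IsTangent Δ) : IsTangent (Ψ ∘ₗ Δ) := by
  obtain ⟨c, Ψ₁, Ψ₂, h1, h2, rfl⟩ := h
  exact ⟨c, Ψ ∘ₗ Ψ₁, Ψ ∘ₗ Ψ₂, hΨ.comp h1, hΨ.comp h2, by
    rw [LinearMap.comp_smul, LinearMap.comp_sub]⟩

theorem IsTangent.comp_right {A B C : Sys} {Δ : Map B C} {Ψ : Map A B} (h : IsTangent Δ)
    (hΨ : IsChannel Ψ) : IsTangent (Δ ∘ₗ Ψ) := by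
  obtain ⟨c, Ψ₁, Ψ₂, h1, h2, rfl⟩ := h
  exact ⟨c, Ψ₁ ∘ₗ Ψ, Ψ₂ ∘ₗ Ψ, h1.comp hΨ, h2.comp hΨ, by
    rw [LinearMap.smul_comp, LinearMap.sub_comp]⟩

theorem IsTangent.exists_nonneg {A B : Sys} {Δ : Map A B} (h : IsTangent Δ) :
    ∃ (c : ℝ) (Ψ₁ Ψ₂ : Map A B), 0 ≤ c ∧ IsChannel Ψ₁ ∧ IsChannel Ψ₂ ∧
      Δ = (c : ℂ) • (Ψ₁ - Ψ₂) := by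
  obtain ⟨c, Ψ₁, Ψ₂, h1, h2, rfl⟩ := h
  rcases le_total 0 c with hc | hc
  · exact ⟨c, Ψ₁, Ψ₂, hc, h1, h2, rfl⟩
  · refine ⟨-c, Ψ₂, Ψ₁, neg_nonneg.mpr hc, h2, h1, ?_⟩
    push_cast
    module

theorem IsTangent.add {A B : Sys} {Δ Δ' : Map A B} (h : IsTangent Δ) (h' : IsTangent Δ') :
    IsTangent (Δ + Δ') := by
  obtain ⟨c, Ψ₁, Ψ₂, hc, h1, h2, rfl⟩ := h.exists_nonneg
  obtain ⟨d, Ξ₁, Ξ₂, hd, h3, h4, rfl⟩ := h'.exists_nonneg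
  rcases (add_nonneg hc hd).eq_or_lt with h0 | h0
  · refine ⟨0, Ψ₁, Ψ₂, h1, h2, ?_⟩
    have hc0 : c = 0 := by linarith
    have hd0 : d = 0 := by linarith
    simp [hc0, hd0]
  · have hs : c / (c + d) + d / (c + d) = 1 := by rw [← add_div, div_self h0.ne']
    have hc' : 0 ≤ c / (c + d) := by positivity
    have hd' : 0 ≤ d / (c + d) := by positivity
    refine ⟨c + d, _, _, h1.convex h3 hc' hd' hs, h2.convex h4 hc' hd' hs, ?_⟩
    have e1 : ((c + d : ℝ) : ℂ) * ((c / (c + d) : ℝ) : ℂ) = c := by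
      rw [← Complex.ofReal_mul, mul_div_cancel₀ _ h0.ne']
    have e2 : ((c + d : ℝ) : ℂ) * ((d / (c + d) : ℝ) : ℂ) = d := by
      rw [← Complex.ofReal_mul, mul_div_cancel₀ _ h0.ne']
    rw [smul_sub ((c + d : ℝ) : ℂ), smul_add, smul_add, smul_smul, smul_smul, smul_smul, smul_smul,
      e1, e2]
    module

theorem isTangent_zero {A B : Sys} {Φ : Map A B} (h : IsChannel Φ) : IsTangent (0 : Map A B) :=
  ⟨0, Φ, Φ, h, h, by simp⟩

/-! ### Push-forward channels -/

/-- Push-forward along a measurable map of the alphabets, together with a renaming of the basis. -/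
def prePush {A B : Sys} (g : A.Ω → B.Ω) (f : A.ι ≃ B.ι) : Pre A →ₗ[ℂ] Pre B :=
  VectorMeasure.mapRangeₗ (Matrix.reindexLinearEquiv ℂ ℂ f f).toLinearMap
    (Continuous.matrix_submatrix continuous_id _ _) ∘ₗ VectorMeasure.mapₗ g

theorem prePush_apply {A B : Sys} {g : A.Ω → B.Ω} (hg : Measurable g) (f : A.ι ≃ B.ι) (X : Pre A)
    {S : Set B.Ω} (hS : MeasurableSet S) :
    prePush g f X S = (X (g ⁻¹' S)).submatrix f.symm f.symm := by
  have h : prePush g f X S = ((X.map g) S).submatrix f.symm f.symm := rfl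
  rw [h, VectorMeasure.map_apply _ hg hS]

theorem prePush_isState {A B : Sys} {g : A.Ω → B.Ω} (hg : Measurable g) (f : A.ι ≃ B.ι) {X : Pre A}
    (hX : IsState X) : IsState (prePush g f X) := by
  constructor
  · intro S
    by_cases hS : MeasurableSet S
    · rw [prePush_apply hg f X hS]; exact (hX.posSemidef _).submatrix _
    · rw [VectorMeasure.not_measurable _ hS]; exact Matrix.PosSemidef.zero
  · rw [prePush_apply hg f X MeasurableSet.univ]
    exact (f.symm.hasSum_iff (f := fun i => X Set.univ i i)).mpr hX.trace_eq

theorem prePush_mem {A B : Sys} {g : A.Ω → B.Ω} (hg : Measurable g) (f : A.ι ≃ B.ι) (X : Pre A)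
    (hX : X ∈ V A) : prePush g f X ∈ V B := by
  have h : V A ≤ (V B).comap (prePush g f) :=
    Submodule.span_le.mpr fun Y hY => Submodule.subset_span (prePush_isState hg f hY)
  exact h hX

/-- Push-forward along a measurable map of the alphabets on the state spaces. -/
def push {A B : Sys} (g : A.Ω → B.Ω) (hg : Measurable g) (f : A.ι ≃ B.ι) : Map A B :=
  (prePush g f).restrict (prePush_mem hg f)

theorem push_apply {A B : Sys} {g : A.Ω → B.Ω} (hg : Measurable g) (f : A.ι ≃ B.ι) (X : V A)
    {S : Set B.Ω} (hS : MeasurableSet S) (i j : B.ι) :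
    (push g hg f X).1 S i j = X.1 (g ⁻¹' S) (f.symm i) (f.symm j) :=
  congrFun (congrFun (prePush_apply hg f X.1 hS) i) j

theorem relabel_eq_push {A B : Sys} (e : A.Ω ≃ᵐ B.Ω) (f : A.ι ≃ B.ι) :
    relabel e f = push e e.measurable f := rfl

theorem isAmplification_push {A B : Sys} {g : A.Ω → B.Ω} (hg : Measurable g) (f : A.ι ≃ B.ι)
    (R : Sys) : IsAmplification (push g hg f) R
      (push (A := prod A R) (B := prod B R) (Prod.map g id) (hg.prodMap measurable_id)
        (f.prodCongr (Equiv.refl _))) := by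
  intro X C hC a b
  refine pre_ext fun S hS i j => ?_
  rw [slice_apply hC a b _ hS, push_apply (A := prod A R) (B := prod B R) _ _ _ (hS.prod hC),
    push_apply _ _ _ hS, slice_apply hC a b _ (hg hS)]
  rfl

theorem isChannel_push {A B : Sys} {g : A.Ω → B.Ω} (hg : Measurable g) (f : A.ι ≃ B.ι) :
    IsChannel (push g hg f) where
  map_state _ hX := prePush_isState hg f hX
  map_state_ancilla R := ⟨_, isAmplification_push hg f R, fun _ hX =>
    prePush_isState (A := prod A R) (B := prod B R) (hg.prodMap measurable_id) _ hX⟩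

theorem isChannel_swap (A R : Sys) : IsChannel (swap A R) :=
  isChannel_push (A := prod A R) (B := prod R A) (MeasurableEquiv.measurable _) _

theorem isChannel_unitor (A : Sys) : IsChannel (unitor A) :=
  isChannel_push (A := A) (B := prod A unit) (MeasurableEquiv.measurable _) _

/-! ### Tensor products of channels -/

/-- The identification of `(A ⊗ R) ⊗ S` with `A ⊗ (R ⊗ S)`. -/
def assoc (A R S : Sys) : Map (prod (prod A R) S) (prod A (prod R S)) :=
  push (A := prod (prod A R) S) (B := prod A (prod R S)) MeasurableEquiv.prodAssoc
    MeasurableEquiv.prodAssoc.measurable (Equiv.prodAssoc _ _ _)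

/-- The identification of `A ⊗ (R ⊗ S)` with `(A ⊗ R) ⊗ S`. -/
def assocSymm (A R S : Sys) : Map (prod A (prod R S)) (prod (prod A R) S) :=
  push (A := prod A (prod R S)) (B := prod (prod A R) S) MeasurableEquiv.prodAssoc.symm
    MeasurableEquiv.prodAssoc.symm.measurable (Equiv.prodAssoc _ _ _).symm

theorem isChannel_assoc (A R S : Sys) : IsChannel (assoc A R S) :=
  isChannel_push (A := prod (prod A R) S) (B := prod A (prod R S))
    (MeasurableEquiv.measurable _) _

theorem isChannel_assocSymm (A R S : Sys) : IsChannel (assocSymm A R S) :=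
  isChannel_push (A := prod A (prod R S)) (B := prod (prod A R) S)
    (MeasurableEquiv.measurable _) _

/-- Slicing along `S` and then along `R` is slicing along `R ⊗ S`. -/
theorem slice_slice {A R S : Sys} (X : V (prod (prod A R) S)) {C : Set R.Ω} (hC : MeasurableSet C)
    {D : Set S.Ω} (hD : MeasurableSet D) (a b : R.ι) (c d : S.ι) :
    slice C a b (slice (A := prod A R) D c d X)
      = slice (A := A) (R := prod R S) (C ×ˢ D) (a, c) (b, d) (assoc A R S X) := by
  refine pre_ext fun B hB i j => ?_
  rw [slice_apply hC a b _ hB, slice_apply hD c d _ (hB.prod hC),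
    slice_apply (A := A) (R := prod R S) (hC.prod hD) _ _ _ hB, assoc,
    push_apply (A := prod (prod A R) S) (B := prod A (prod R S)) _ _ _ (hB.prod (hC.prod hD))]
  refine congrFun (congrFun (congrArg (X.1 : Set _ → _) ?_) _) _
  ext ⟨⟨x, y⟩, z⟩
  simp [MeasurableEquiv.prodAssoc, and_assoc]

theorem slice_slice_assocSymm {A R S : Sys} (X : V (prod A (prod R S))) {C : Set R.Ω}
    (hC : MeasurableSet C) {D : Set S.Ω} (hD : MeasurableSet D) (a b : R.ι) (c d : S.ι) :
    slice C a b (slice (A := prod A R) D c d (assocSymm A R S X))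
      = slice (A := A) (R := prod R S) (C ×ˢ D) (a, c) (b, d) X := by
  refine pre_ext fun B hB i j => ?_
  rw [slice_apply hC a b _ hB, slice_apply hD c d _ (hB.prod hC),
    slice_apply (A := A) (R := prod R S) (hC.prod hD) _ _ _ hB, assocSymm,
    push_apply (A := prod A (prod R S)) (B := prod (prod A R) S) _ _ _ ((hB.prod hC).prod hD)]
  refine congrFun (congrFun (congrArg (X.1 : Set _ → _) ?_) _) _
  ext ⟨x, y, z⟩
  simp [MeasurableEquiv.prodAssoc]

/-- `(Φ ⊗ id_R) ⊗ id_S` is `Φ ⊗ id_{R ⊗ S}`. -/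
theorem isAmplification_amp {A B : Sys} {Φ : Map A B} (h : Amplifiable Φ) (R S : Sys) :
    IsAmplification (amp Φ R) S (assocSymm B R S ∘ₗ amp Φ (prod R S) ∘ₗ assoc A R S) := by
  intro X D hD c d
  refine slice_ext fun C hC a b => ?_
  rw [LinearMap.comp_apply, LinearMap.comp_apply, slice_slice_assocSymm _ hC hD,
    h.spec (prod R S) _ _ (hC.prod hD), h.spec R _ C hC, slice_slice _ hC hD]

theorem IsChannel.amp {A B : Sys} {Φ : Map A B} (h : IsChannel Φ) (R : Sys) :
    IsChannel (amp Φ R) where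
  map_state X hX := h.amp_state R X hX
  map_state_ancilla S := ⟨_, isAmplification_amp h.amplifiable R S, fun _ hX =>
    (isChannel_assocSymm B R S).map_state _ (h.amp_state _ _ ((isChannel_assoc A R S).map_state _ hX))⟩

theorem IsTangent.amp {A B : Sys} {Δ : Map A B} (h : IsTangent Δ) (R : Sys) :
    IsTangent (amp Δ R) := by
  obtain ⟨c, Ψ₁, Ψ₂, h1, h2, rfl⟩ := h
  refine ⟨c, ChannelMetric.amp Ψ₁ R, ChannelMetric.amp Ψ₂ R, h1.amp R, h2.amp R, ?_⟩
  rw [amp_smul _ (h1.amplifiable.sub h2.amplifiable), amp_sub h1.amplifiable h2.amplifiable]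

theorem IsChannel.tensor {A B A' B' : Sys} {Φ : Map A B} {Ψ : Map A' B'} (hΦ : IsChannel Φ)
    (hΨ : IsChannel Ψ) : IsChannel (tensor Φ Ψ) :=
  (hΦ.amp B').comp ((isChannel_swap _ _).comp ((hΨ.amp A).comp (isChannel_swap _ _)))

theorem IsTangent.tensor_left {A B A' B' : Sys} {Δ : Map A B} {Ψ : Map A' B'} (hΔ : IsTangent Δ)
    (hΨ : IsChannel Ψ) : IsTangent (tensor Δ Ψ) :=
  (hΔ.amp B').comp_right ((isChannel_swap _ _).comp ((hΨ.amp A).comp (isChannel_swap _ _)))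

theorem IsTangent.tensor_right {A B A' B' : Sys} {Φ : Map A B} {Δ : Map A' B'} (hΦ : IsChannel Φ)
    (hΔ : IsTangent Δ) : IsTangent (tensor Φ Δ) :=
  ((((hΔ.amp A).comp_right (isChannel_swap _ _)).comp_left (isChannel_swap _ _))).comp_left
    (hΦ.amp B')

theorem IsChannel.tpow {A B : Sys} {Φ : Map A B} (h : IsChannel Φ) :
    ∀ n, IsChannel (tpow Φ n)
  | 0 => isChannel_id _
  | n + 1 => h.tensor (h.tpow n)

theorem IsTangent.dpow {A B : Sys} {Φ Δ : Map A B} (hΔ : IsTangent Δ) (hΦ : IsChannel Φ) :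
    ∀ n, IsTangent (dpow Φ Δ n)
  | 0 => isTangent_zero (isChannel_id _)
  | n + 1 => (hΔ.tensor_left (hΦ.tpow n)).add ((hΔ.dpow hΦ n).tensor_right hΦ)

/-! ### Products of states -/

/-- A complex measure has a density with respect to any finite measure that dominates its real and
imaginary parts. -/
theorem exists_density {X : Type} [MeasurableSpace X] (c : ComplexMeasure X) (τ : Measure X)
    [IsFiniteMeasure τ] (hre : (ComplexMeasure.re c).totalVariation ≪ τ)
    (him : (ComplexMeasure.im c).totalVariation ≪ τ) :
    ∃ h : X → ℂ, Integrable h τ ∧ ∀ B, MeasurableSet B → c B = ∫ x in B, h x ∂τ := by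
  have key : ∀ s : SignedMeasure X, s.totalVariation ≪ τ → ∀ B, MeasurableSet B →
      ∫ x in B, s.rnDeriv τ x ∂τ = s B := by
    intro s hs B hB
    have h1 : s ≪ᵥ τ.toENNRealVectorMeasure := by
      rw [SignedMeasure.absolutelyContinuous_ennreal_iff,
        VectorMeasure.ennrealToMeasure_toENNRealVectorMeasure]
      exact hs
    rw [← withDensityᵥ_apply (SignedMeasure.integrable_rnDeriv _ _) hB,
      SignedMeasure.withDensityᵥ_rnDeriv_eq s τ h1]
  refine ⟨c.rnDeriv τ, c.integrable_rnDeriv τ, fun B hB => ?_⟩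
  apply Complex.ext
  · rw [← RCLike.re_eq_complex_re, ← integral_re (c.integrable_rnDeriv τ).integrableOn]
    exact (key _ hre B hB).symm
  · rw [← RCLike.im_eq_complex_im, ← integral_im (c.integrable_rnDeriv τ).integrableOn]
    exact (key _ him B hB).symm

/-- The entry of a matrix valued measure at a pair of indices. -/
def entry {A : Sys} (X : Pre A) (i j : A.ι) : ComplexMeasure A.Ω :=
  VectorMeasure.mapRange X (Matrix.entryAddMonoidHom ℂ i j)
    (Continuous.matrix_elem continuous_id i j)

theorem entry_apply {A : Sys} (X : Pre A) (i j : A.ι) (B : Set A.Ω) : entry X i j B = X B i j := rfl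

/-- The variation of the block of a matrix valued measure that belongs to a finite set of indices. -/
def blockVar {A : Sys} (X : Pre A) (s : Finset A.ι) : Measure A.Ω :=
  ∑ i ∈ s, ∑ j ∈ s, ((ComplexMeasure.re (entry X i j)).totalVariation
    + (ComplexMeasure.im (entry X i j)).totalVariation)

theorem isFiniteMeasure_totalVariation {X : Type} [MeasurableSpace X] (s : SignedMeasure X) :
    IsFiniteMeasure s.totalVariation := by
  unfold SignedMeasure.totalVariation; infer_instance

instance {A : Sys} (X : Pre A) (s : Finset A.ι) : IsFiniteMeasure (blockVar X s) := by
  have := @isFiniteMeasure_totalVariation A.Ω _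
  unfold blockVar
  infer_instance

/-- A finite block of a matrix valued measure has a density with respect to a finite measure. -/
theorem exists_block_density {A : Sys} (X : Pre A) (s : Finset A.ι) :
    ∃ H : A.Ω → Matrix s s ℂ, (∀ i j, Integrable (fun x => H x i j) (blockVar X s)) ∧
      ∀ B, MeasurableSet B → ∀ i j : s, X B i j = ∫ x in B, H x i j ∂(blockVar X s) := by
  have h1 : ∀ i j : s, ((ComplexMeasure.re (entry X i j)).totalVariation
      + (ComplexMeasure.im (entry X i j)).totalVariation) ≤ blockVar X s := by
    intro i j
    unfold blockVar
    refine le_trans ?_ (Finset.single_le_sum (f := fun i => ∑ j ∈ s,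
      ((ComplexMeasure.re (entry X i j)).totalVariation
        + (ComplexMeasure.im (entry X i j)).totalVariation)) (fun _ _ => Measure.zero_le _) i.2)
    exact (Finset.single_le_sum (f := fun j => ((ComplexMeasure.re (entry X i j)).totalVariation
        + (ComplexMeasure.im (entry X i j)).totalVariation)) (fun _ _ => Measure.zero_le _) j.2)
  have h2 : ∀ i j : s, ∃ h : A.Ω → ℂ, Integrable h (blockVar X s) ∧
      ∀ B, MeasurableSet B → entry X i j B = ∫ x in B, h x ∂(blockVar X s) := fun i j =>
    exists_density _ _
      (Measure.absolutelyContinuous_of_le ((Measure.le_add_right le_rfl).trans (h1 i j)))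
      (Measure.absolutelyContinuous_of_le ((Measure.le_add_left le_rfl).trans (h1 i j)))
  choose h hint hB using h2
  exact ⟨fun x => Matrix.of fun i j => h i j x, hint, fun B hBm i j => hB i j B hBm⟩

theorem dotProduct_mulVec_integral {X n : Type} [MeasurableSpace X] [Fintype n] {τ : Measure X}
    {H : X → Matrix n n ℂ} (hint : ∀ i j, Integrable (fun x => H x i j) τ) (v : n → ℂ) :
    Integrable (fun x => star v ⬝ᵥ (H x).mulVec v) τ ∧
      star v ⬝ᵥ (Matrix.of fun i j => ∫ x, H x i j ∂τ).mulVec v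
        = ∫ x, star v ⬝ᵥ (H x).mulVec v ∂τ := by
  simp only [dotProduct, Matrix.mulVec, Matrix.of_apply]
  have h1 : ∀ i, Integrable (fun x => ∑ j, H x i j * v j) τ := fun i =>
    integrable_finsetSum _ fun j _ => (hint i j).mul_const _
  refine ⟨integrable_finsetSum _ fun i _ => (h1 i).const_mul _, ?_⟩
  rw [integral_finsetSum _ fun i _ => (h1 i).const_mul _]
  refine Finset.sum_congr rfl fun i _ => ?_
  rw [integral_const_mul, integral_finsetSum _ fun j _ => (hint i j).mul_const _]
  congr 1
  exact Finset.sum_congr rfl fun j _ => (integral_mul_const _ _).symm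

/-- If all integrals of a matrix valued function are positive, then so are almost all its values:
by density, countably many vectors suffice to test positivity. -/
theorem ae_posSemidef {X n : Type} [MeasurableSpace X] [Fintype n] {τ : Measure X}
    {H : X → Matrix n n ℂ} (hint : ∀ i j, Integrable (fun x => H x i j) τ)
    (hpos : ∀ B, MeasurableSet B → (Matrix.of fun i j => ∫ x in B, H x i j ∂τ).PosSemidef) :
    ∀ᵐ x ∂τ, (H x).PosSemidef := by
  have hherm : ∀ i j, ∀ᵐ x ∂τ, star (H x j i) - H x i j = 0 := by
    intro i j
    have hi : Integrable (fun x => star (H x j i)) τ := by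
      exact Complex.conjCLE.toContinuousLinearMap.integrable_comp (hint j i)
    refine (hi.sub (hint i j)).ae_eq_zero_of_forall_setIntegral_eq_zero fun B hB _ => ?_
    have h1 := (hpos B hB).1.apply i j
    simp only [Matrix.of_apply] at h1
    rw [integral_sub' hi.integrableOn (hint i j).integrableOn, sub_eq_zero, ← h1]
    exact integral_conj
  have hv : ∀ v : n → ℂ, ∀ᵐ x ∂τ, 0 ≤ star v ⬝ᵥ (H x).mulVec v := by
    intro v
    have h0 := (dotProduct_mulVec_integral hint v).1
    have h1 : ∀ B, MeasurableSet B → 0 ≤ ∫ x in B, star v ⬝ᵥ (H x).mulVec v ∂τ := by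
      intro B hB
      rw [← (dotProduct_mulVec_integral (τ := τ.restrict B) (fun i j => (hint i j).integrableOn)
        v).2]
      exact (hpos B hB).dotProduct_mulVec_nonneg v
    have hre : ∀ᵐ x ∂τ, 0 ≤ (star v ⬝ᵥ (H x).mulVec v).re := by
      refine ae_nonneg_of_forall_setIntegral_nonneg h0.re fun B hB _ => ?_
      have h2 := (Complex.nonneg_iff.mp (h1 B hB)).1
      rw [← RCLike.re_eq_complex_re, ← integral_re h0.integrableOn] at h2
      exact h2
    have him : ∀ᵐ x ∂τ, (star v ⬝ᵥ (H x).mulVec v).im = 0 := by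
      refine h0.im.ae_eq_zero_of_forall_setIntegral_eq_zero fun B hB _ => ?_
      have h2 := (Complex.nonneg_iff.mp (h1 B hB)).2
      rw [← RCLike.im_eq_complex_im, ← integral_im h0.integrableOn] at h2
      exact h2.symm
    filter_upwards [hre, him] with x h2 h3
    exact Complex.nonneg_iff.mpr ⟨h2, h3.symm⟩
  have hherm' : ∀ᵐ x ∂τ, ∀ i j, star (H x j i) - H x i j = 0 := by
    rw [ae_all_iff]; intro i; rw [ae_all_iff]; exact hherm i
  have hv' : ∀ᵐ x ∂τ, ∀ k, 0 ≤ star (TopologicalSpace.denseSeq (n → ℂ) k) ⬝ᵥ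
      (H x).mulVec (TopologicalSpace.denseSeq (n → ℂ) k) := by
    rw [ae_all_iff]; exact fun k => hv _
  filter_upwards [hherm', hv'] with x h1 h2
  refine Matrix.PosSemidef.of_dotProduct_mulVec_nonneg ?_ fun v => ?_
  · ext i j; exact sub_eq_zero.mp (h1 i j)
  · refine (TopologicalSpace.denseRange_denseSeq (n → ℂ)).induction_on
      (p := fun v => 0 ≤ star v ⬝ᵥ (H x).mulVec v) v ?_ h2
    refine isClosed_Ici.preimage (f := fun v : n → ℂ => star v ⬝ᵥ (H x).mulVec v) ?_
    simp only [dotProduct, Matrix.mulVec]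
    fun_prop

theorem posSemidef_integral {X n : Type} [MeasurableSpace X] [Fintype n] {τ : Measure X}
    {H : X → Matrix n n ℂ} (hint : ∀ i j, Integrable (fun x => H x i j) τ)
    (hpos : ∀ᵐ x ∂τ, (H x).PosSemidef) :
    (Matrix.of fun i j => ∫ x, H x i j ∂τ).PosSemidef := by
  refine Matrix.PosSemidef.of_dotProduct_mulVec_nonneg ?_ fun v => ?_
  · ext i j
    simp only [Matrix.conjTranspose_apply, Matrix.of_apply]
    refine integral_conj.symm.trans (integral_congr_ae ?_)
    filter_upwards [hpos] with x hx using hx.1.apply i j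
  · rw [(dotProduct_mulVec_integral hint v).2]
    refine integral_nonneg_of_ae ?_
    filter_upwards [hpos] with x hx using hx.dotProduct_mulVec_nonneg v

/-- Positivity of a matrix on a product index set is tested on finite rectangles. -/
theorem posSemidef_of_submatrix {ι κ : Type} (M : Matrix (ι × κ) (ι × κ) ℂ)
    (h : ∀ (s : Finset ι) (t : Finset κ),
      (M.submatrix (fun p : s × t => ((p.1 : ι), (p.2 : κ))) fun p => (p.1, p.2)).PosSemidef) :
    M.PosSemidef := by
  classical
  constructor
  · ext ⟨i, a⟩ ⟨j, b⟩
    have h1 := (h {i, j} {a, b}).1.apply (⟨i, by simp⟩, ⟨a, by simp⟩) (⟨j, by simp⟩, ⟨b, by simp⟩)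
    exact h1
  · intro x
    let s := x.support.image Prod.fst
    let t := x.support.image Prod.snd
    let f : s × t → ι × κ := fun p => (p.1, p.2)
    have hf : Function.Injective f := by
      rintro ⟨p, q⟩ ⟨p', q'⟩ hpq
      simp only [f, Prod.mk.injEq] at hpq
      exact Prod.ext (Subtype.ext hpq.1) (Subtype.ext hpq.2)
    have hx : (x.support : Set (ι × κ)) ⊆ Set.range f := fun p hp =>
      ⟨(⟨p.1, Finset.mem_image_of_mem _ hp⟩, ⟨p.2, Finset.mem_image_of_mem _ hp⟩), rfl⟩
    have h1 := (h s t).2 (x.comapDomain f hf.injOn)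
    rw [← Finsupp.mapDomain_comapDomain f hf x hx]
    rw [Finsupp.sum_mapDomain_index (by simp)
      (by intros; simp only [star_add, add_mul, Finsupp.sum_add])]
    have h2 : ∀ (p : s × t) (u : ℂ),
        ((Finsupp.mapDomain f (x.comapDomain f hf.injOn)).sum fun j xj => star u * M (f p) j * xj)
        = (x.comapDomain f hf.injOn).sum fun j xj => star u * M (f p) (f j) * xj := fun p u => by
      rw [Finsupp.sum_mapDomain_index (by simp) (by intros; ring)]
    simp only [h2]
    exact h1

/-- The product of two complex measures. -/
theorem exists_prod_entry {X Y : Type} [MeasurableSpace X] [MeasurableSpace Y]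
    (c : ComplexMeasure X) (d : ComplexMeasure Y) : ∃ e : ComplexMeasure (X × Y),
      ∀ B, MeasurableSet B → ∀ C, MeasurableSet C → e (B ×ˢ C) = c B * d C := by
  have : ∀ {X : Type} [MeasurableSpace X] (c : ComplexMeasure X), ∃ (τ : Measure X) (h : X → ℂ),
      IsFiniteMeasure τ ∧ Integrable h τ ∧ ∀ B, MeasurableSet B → c B = ∫ x in B, h x ∂τ := by
    intro X _ c
    have := isFiniteMeasure_totalVariation (ComplexMeasure.re c)
    have := isFiniteMeasure_totalVariation (ComplexMeasure.im c)
    obtain ⟨h, hh⟩ := exists_density c ((ComplexMeasure.re c).totalVariation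
      + (ComplexMeasure.im c).totalVariation)
      (Measure.absolutelyContinuous_of_le (Measure.le_add_right le_rfl))
      (Measure.absolutelyContinuous_of_le (Measure.le_add_left le_rfl))
    exact ⟨_, h, inferInstance, hh⟩
  obtain ⟨τ, h, _, hi, hc⟩ := this c
  obtain ⟨σ, k, _, ki, kd⟩ := this d
  refine ⟨(τ.prod σ).withDensityᵥ fun z => h z.1 * k z.2, fun B hB C hC => ?_⟩
  rw [withDensityᵥ_apply (hi.mul_prod ki) (hB.prod hC), setIntegral_prod_mul, hc B hB, kd C hC]

/-- A product of positive matrix valued measures is positive on all measurable sets, not only on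
rectangles: on finitely many indices its density is a Kronecker product of positive matrices. -/
theorem posSemidef_of_rectangles {A R : Sys} {x : Pre A} {y : Pre R}
    (hx : ∀ B, (x B).PosSemidef) (hy : ∀ C, (y C).PosSemidef) {z : Pre (prod A R)}
    (hz : ∀ B, MeasurableSet B → ∀ C, MeasurableSet C → ∀ i a j b,
      z (B ×ˢ C) (i, a) (j, b) = x B i j * y C a b) (E : Set (A.Ω × R.Ω)) : (z E).PosSemidef := by
  by_cases hE : MeasurableSet E
  swap
  · rw [VectorMeasure.not_measurable _ hE]; exact Matrix.PosSemidef.zero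
  refine posSemidef_of_submatrix _ fun s t => ?_
  have block_pos : ∀ {S : Sys} (u : Pre S) (_ : ∀ B, (u B).PosSemidef) (s : Finset S.ι)
      (H : S.Ω → Matrix s s ℂ), (∀ i j, Integrable (fun x => H x i j) (blockVar u s)) →
      (∀ B, MeasurableSet B → ∀ i j : s, u B i j = ∫ x in B, H x i j ∂(blockVar u s)) →
      ∀ᵐ w ∂(blockVar u s), (H w).PosSemidef := by
    intro S u hu s H Hint Hd
    refine ae_posSemidef Hint fun B hB => ?_
    have h1 : (Matrix.of fun i j => ∫ w in B, H w i j ∂(blockVar u s))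
        = (u B).submatrix (fun i : s => (i : S.ι)) (fun i : s => (i : S.ι)) := by
      ext i j; exact (Hd B hB i j).symm
    rw [h1]
    exact (hu B).submatrix _
  obtain ⟨H, Hint, Hd⟩ := exists_block_density x s
  obtain ⟨K, Kint, Kd⟩ := exists_block_density y t
  let L : A.Ω × R.Ω → Matrix (s × t) (s × t) ℂ := fun w =>
    Matrix.kroneckerMap (· * ·) (H w.1) (K w.2)
  have Lint : ∀ p q, Integrable (fun w => L w p q) ((blockVar x s).prod (blockVar y t)) :=
    fun p q => (Hint p.1 q.1).mul_prod (Kint p.2 q.2)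
  have Lpos : ∀ᵐ w ∂(blockVar x s).prod (blockVar y t), (L w).PosSemidef := by
    filter_upwards [Measure.quasiMeasurePreserving_fst.ae (block_pos x hx s H Hint Hd),
      Measure.quasiMeasurePreserving_snd.ae (block_pos y hy t K Kint Kd)] with w h1 h2
    exact h1.kronecker h2
  have Leq : ∀ p q : s × t, entry z (p.1, p.2) (q.1, q.2)
      = ((blockVar x s).prod (blockVar y t)).withDensityᵥ fun w => L w p q := by
    intro p q
    have hrect : ∀ B, MeasurableSet B → ∀ C, MeasurableSet C →
        entry z (p.1, p.2) (q.1, q.2) (B ×ˢ C)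
        = ((blockVar x s).prod (blockVar y t)).withDensityᵥ (fun w => L w p q) (B ×ˢ C) := by
      intro B hB C hC
      rw [entry_apply, hz B hB C hC, withDensityᵥ_apply (Lint p q) (hB.prod hC), Hd B hB, Kd C hC]
      exact (setIntegral_prod_mul _ _ _ _).symm
    refine VectorMeasure.ext_of_generateFrom _ ?_ generateFrom_prod.symm isPiSystem_prod ?_
    · rintro _ ⟨B, hB, C, hC, rfl⟩
      exact hrect B hB C hC
    · rw [← Set.univ_prod_univ]
      exact hrect _ MeasurableSet.univ _ MeasurableSet.univ
  have h3 : ((z E).submatrix (fun p : s × t => ((p.1 : A.ι), (p.2 : R.ι))) fun p => (p.1, p.2))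
      = Matrix.of fun p q => ∫ w in E, L w p q ∂(blockVar x s).prod (blockVar y t) := by
    ext p q
    rw [Matrix.submatrix_apply, ← entry_apply, Leq p q, withDensityᵥ_apply (Lint p q) hE,
      Matrix.of_apply]
  rw [h3]
  exact posSemidef_integral (fun p q => (Lint p q).integrableOn) (ae_restrict_of_ae Lpos)

theorem hasSum_prod_one {ι κ : Type} {f : ι → ℂ} {g : κ → ℂ} (hf : HasSum f 1) (hg : HasSum g 1) :
    HasSum (fun p : ι × κ => f p.1 * g p.2) 1 := by
  have h := hf.mul hg (summable_mul_of_summable_norm hf.summable.norm hg.summable.norm)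
  rwa [one_mul] at h

/-- The product of two states. -/
theorem exists_product_state {A R : Sys} {x : Pre A} {y : Pre R} (hx : IsState x)
    (hy : IsState y) : ∃ z : Pre (prod A R), IsState z ∧
      ∀ B, MeasurableSet B → ∀ C, MeasurableSet C → ∀ i a j b,
        z (B ×ˢ C) (i, a) (j, b) = x B i j * y C a b := by
  choose e he using fun p q : A.ι × R.ι =>
    exists_prod_entry (entry x p.1 q.1) (entry y p.2 q.2)
  let z : Pre (prod A R) :=
    { measureOf' := fun E => Matrix.of fun p q => e p q E
      empty' := by ext; simp
      not_measurable' := fun E hE => by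
        ext p q; exact (e p q).not_measurable hE
      m_iUnion' := fun f hf hd => by
        refine Pi.hasSum.mpr fun p => Pi.hasSum.mpr fun q => ?_
        exact (e p q).m_iUnion hf hd }
  have hz : ∀ B, MeasurableSet B → ∀ C, MeasurableSet C → ∀ i a j b,
        z (B ×ˢ C) (i, a) (j, b) = x B i j * y C a b := fun B hB C hC i a j b =>
    he (i, a) (j, b) B hB C hC
  refine ⟨z, ⟨posSemidef_of_rectangles hx.posSemidef hy.posSemidef hz, ?_⟩, hz⟩
  have h2 : (fun p : A.ι × R.ι => z Set.univ p p)
      = fun p => x Set.univ p.1 p.1 * y Set.univ p.2 p.2 := by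
    funext p
    rw [← hz _ MeasurableSet.univ _ MeasurableSet.univ, Set.univ_prod_univ]
  have h3 := hasSum_prod_one hx.trace_eq hy.trace_eq
  rw [← h2] at h3
  exact h3

/-! ### States as channels, and product elements -/

/-- An amplification can be specified on states: the uniqueness of the elements with prescribed
slices makes it linear. -/
theorem exists_isAmplification {A B R : Sys} (Φ : Map A B)
    (h : ∀ X : V (prod A R), IsState X.1 → ∃ Y : V (prod B R), IsState Y.1 ∧
      ∀ C, MeasurableSet C → ∀ a b, slice C a b Y = Φ (slice C a b X)) :
    ∃ Θ, IsAmplification Φ R Θ ∧ ∀ X : V (prod A R), IsState X.1 → IsState (Θ X).1 := by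
  have h1 : ∀ X : V (prod A R), ∃ Y : V (prod B R),
      ∀ C, MeasurableSet C → ∀ a b, slice C a b Y = Φ (slice C a b X) := by
    rintro ⟨X, hX⟩
    refine Submodule.span_induction (p := fun X hX => ∃ Y : V (prod B R),
      ∀ C, MeasurableSet C → ∀ a b, slice C a b Y = Φ (slice C a b ⟨X, hX⟩)) ?_ ?_ ?_ ?_ hX
    · intro X hX
      obtain ⟨Y, _, hY⟩ := h ⟨X, Submodule.subset_span hX⟩ hX
      exact ⟨Y, hY⟩
    · refine ⟨0, fun C hC a b => ?_⟩
      have h0 : (⟨0, Submodule.zero_mem _⟩ : V (prod A R)) = 0 := rfl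
      rw [h0, map_zero, map_zero, map_zero]
    · rintro X X' hX hX' ⟨Y, hY⟩ ⟨Y', hY'⟩
      refine ⟨Y + Y', fun C hC a b => ?_⟩
      have h0 : (⟨X + X', Submodule.add_mem _ hX hX'⟩ : V (prod A R)) = ⟨X, hX⟩ + ⟨X', hX'⟩ := rfl
      rw [h0, map_add, map_add, map_add, hY C hC, hY' C hC]
    · rintro c X hX ⟨Y, hY⟩
      refine ⟨c • Y, fun C hC a b => ?_⟩
      have h0 : (⟨c • X, Submodule.smul_mem _ c hX⟩ : V (prod A R)) = c • ⟨X, hX⟩ := rfl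
      rw [h0, map_smul, map_smul, map_smul, hY C hC]
  choose Θ hΘ using h1
  refine ⟨{ toFun := Θ, map_add' := fun X Y => slice_ext fun C hC a b => ?_,
            map_smul' := fun c X => slice_ext fun C hC a b => ?_ }, fun X C hC a b => hΘ X C hC a b,
    fun X hX => ?_⟩
  · rw [hΘ _ C hC, map_add, map_add, map_add, hΘ _ C hC, hΘ _ C hC]
  · rw [hΘ _ C hC, map_smul, map_smul, RingHom.id_apply, map_smul, hΘ _ C hC]
  · obtain ⟨Y, hY, hY'⟩ := h X hX
    have h2 : Θ X = Y := slice_ext fun C hC a b => (hΘ X C hC a b).trans (hY' C hC a b).symm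
    exact (congrArg (fun Z : V (prod B R) => IsState Z.1) h2).mpr hY

/-- The identification of `1 ⊗ R` with `R`. -/
def dropUnit (R : Sys) : Map (prod unit R) R :=
  push (A := prod unit R) (B := R) Prod.snd measurable_snd (Equiv.punitProd R.ι)

/-- The identification of `R` with `1 ⊗ R`. -/
def addUnit (R : Sys) : Map R (prod unit R) :=
  push (A := R) (B := prod unit R) (fun w => ((), w)) (measurable_const.prodMk measurable_id)
    (Equiv.punitProd R.ι).symm

theorem isChannel_dropUnit (R : Sys) : IsChannel (dropUnit R) :=
  isChannel_push (A := prod unit R) (B := R) measurable_snd _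

theorem dropUnit_apply {R : Sys} (X : V (prod unit R)) {C : Set R.Ω} (hC : MeasurableSet C)
    (a b : R.ι) : (dropUnit R X).1 C a b = X.1 (Set.univ ×ˢ C) ((), a) ((), b) := by
  rw [dropUnit, push_apply (A := prod unit R) (B := R) _ _ _ hC, Set.univ_prod]
  rfl

theorem addUnit_apply {R : Sys} (X : V R) {C : Set R.Ω} (hC : MeasurableSet C)
    (a b : R.ι) : (addUnit R X).1 (Set.univ ×ˢ C) ((), a) ((), b) = X.1 C a b := by
  rw [addUnit, push_apply (A := R) (B := prod unit R) _ _ _ (MeasurableSet.univ.prod hC)]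
  have h : ((fun w => ((), w)) ⁻¹' (Set.univ ×ˢ C) : Set R.Ω) = C := by ext; simp
  rw [h]
  rfl

theorem prep_apply {S : Sys} (x : V S) (X : V unit) :
    prep x X = (X.1 Set.univ () ()) • x := rfl

theorem prep_add {S : Sys} (x y : V S) : prep (x + y) = prep x + prep y :=
  LinearMap.ext fun _ => smul_add _ _ _

theorem prep_sub {S : Sys} (x y : V S) : prep (x - y) = prep x - prep y :=
  LinearMap.ext fun _ => smul_sub _ _ _

theorem prep_smul {S : Sys} (c : ℂ) (x : V S) : prep (c • x) = c • prep x :=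
  LinearMap.ext fun _ => smul_comm _ _ _

theorem comp_prep {S T : Sys} (Φ : Map S T) (x : V S) : Φ ∘ₗ prep x = prep (Φ x) :=
  LinearMap.ext fun _ => map_smul Φ _ x

/-- States are channels with trivial input. -/
theorem isChannel_prep {S : Sys} {x : V S} (hx : IsState x.1) : IsChannel (prep x) where
  map_state X hX := by
    have h : HasSum (fun i : Unit => X.1 Set.univ i i) (X.1 Set.univ () ()) := hasSum_unique _
    have h1 : X.1 Set.univ () () = 1 := h.unique hX.trace_eq
    rw [prep_apply, h1, one_smul]
    exact hx
  map_state_ancilla R := by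
    refine exists_isAmplification _ fun X hX => ?_
    obtain ⟨z, hz, hz'⟩ := exists_product_state hx ((isChannel_dropUnit R).map_state X hX)
    refine ⟨⟨z, Submodule.subset_span hz⟩, hz, fun C hC a b => pre_ext fun B hB i j => ?_⟩
    rw [slice_apply hC a b _ hB, hz' B hB C hC, dropUnit_apply X hC, prep_apply,
      ← slice_apply hC a b X MeasurableSet.univ, mul_comm]
    rfl

theorem amplifiable_prep {S : Sys} (x : V S) : Amplifiable (prep x) := by
  obtain ⟨x, hx⟩ := x
  refine Submodule.span_induction (p := fun x hx => Amplifiable (prep (⟨x, hx⟩ : V S)))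
    ?_ ?_ ?_ ?_ hx
  · intro x hx
    exact (isChannel_prep (x := ⟨x, _⟩) hx).amplifiable
  · intro R
    refine ⟨0, fun X C hC a b => ?_⟩
    rw [LinearMap.zero_apply, map_zero]
    exact (smul_zero (A := V S) _).symm
  · intro x y hx hy h1 h2
    have h := h1.add h2
    rw [← prep_add] at h
    exact h
  · intro c x hx h1
    have h := h1.smul c
    rw [← prep_smul] at h
    exact h

/-- The product element `x ⊗ y`. -/
def tprod {A R : Sys} (x : V A) (y : V R) : V (prod A R) := amp (prep x) R (addUnit R y)

theorem slice_tprod {A R : Sys} (x : V A) (y : V R) {C : Set R.Ω} (hC : MeasurableSet C)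
    (a b : R.ι) : slice C a b (tprod x y) = (y.1 C a b) • x := by
  rw [tprod, (amplifiable_prep x).spec R _ C hC, prep_apply, slice_apply hC _ _ _ MeasurableSet.univ,
    addUnit_apply y hC]

theorem tprod_apply {A R : Sys} (x : V A) (y : V R) {B : Set A.Ω} (hB : MeasurableSet B)
    {C : Set R.Ω} (hC : MeasurableSet C) (i j : A.ι) (a b : R.ι) :
    (tprod x y).1 (B ×ˢ C) (i, a) (j, b) = x.1 B i j * y.1 C a b := by
  rw [← slice_apply hC a b _ hB, slice_tprod x y hC, mul_comm]
  rfl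

theorem tprod_isState {A R : Sys} {x : V A} {y : V R} (hx : IsState x.1) (hy : IsState y.1) :
    IsState (tprod x y).1 :=
  (isChannel_prep hx).amp_state R _
    ((isChannel_push (A := R) (B := prod unit R) _ _).map_state _ hy)

theorem tprod_add {A R : Sys} (x : V A) (y z : V R) :
    tprod x (y + z) = tprod x y + tprod x z := by
  rw [tprod, map_add, map_add]; rfl

theorem tprod_smul {A R : Sys} (c : ℂ) (x : V A) (y : V R) :
    tprod x (c • y) = c • tprod x y := by
  rw [tprod, map_smul, map_smul]; rfl

theorem tprod_zero {A R : Sys} (x : V A) : tprod x (0 : V R) = 0 := by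
  rw [tprod, map_zero, map_zero]

theorem add_tprod {A R : Sys} (x y : V A) (z : V R) :
    tprod (x + y) z = tprod x z + tprod y z := by
  rw [tprod, prep_add, amp_add (amplifiable_prep x) (amplifiable_prep y)]; rfl

theorem smul_tprod {A R : Sys} (c : ℂ) (x : V A) (y : V R) :
    tprod (c • x) y = c • tprod x y := by
  rw [tprod, prep_smul, amp_smul _ (amplifiable_prep x)]; rfl

theorem amp_tprod {A B R : Sys} {Φ : Map A B} (h : Amplifiable Φ) (x : V A) (y : V R) :
    amp Φ R (tprod x y) = tprod (Φ x) y := by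
  refine slice_ext fun C hC a b => ?_
  rw [h.spec R _ C hC, slice_tprod _ _ hC, slice_tprod _ _ hC, map_smul]

theorem swap_tprod {A R : Sys} (x : V A) (y : V R) : swap A R (tprod x y) = tprod y x := by
  refine prod_ext fun B hB C hC i a j b => ?_
  rw [tprod_apply y x hB hC, swap, relabel_eq_push,
    push_apply (A := prod A R) (B := prod R A) _ _ _ (hB.prod hC), mul_comm,
    ← tprod_apply x y hC hB]
  refine congrFun (congrFun (congrArg ((tprod x y).1 : Set _ → _) ?_) _) _
  ext ⟨u, v⟩
  simp [MeasurableEquiv.prodComm]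

theorem tensor_tprod {A B A' B' : Sys} {Φ : Map A B} {Ψ : Map A' B'} (hΦ : Amplifiable Φ)
    (hΨ : Amplifiable Ψ) (x : V A) (y : V A') :
    tensor Φ Ψ (tprod x y) = tprod (Φ x) (Ψ y) := by
  rw [tensor, LinearMap.comp_apply, LinearMap.comp_apply, LinearMap.comp_apply, swap_tprod,
    amp_tprod hΨ, swap_tprod, amp_tprod hΦ]

/-! ### Systems with a single point -/

/-- On a system whose alphabet and basis have a single point, every element is a multiple of a
given state. -/
theorem eq_smul_of_subsingleton {S : Sys} [Subsingleton S.Ω] [Subsingleton S.ι] {Y : V S}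
    (hY : IsState Y.1) (i : S.ι) (X : V S) : X = (X.1 Set.univ i i) • Y := by
  refine pre_ext fun B hB j k => ?_
  have : Unique S.ι := ⟨⟨i⟩, fun _ => Subsingleton.elim _ _⟩
  have h : HasSum (fun i : S.ι => Y.1 Set.univ i i) (Y.1 Set.univ i i) := by
    have := hasSum_unique (fun i : S.ι => Y.1 Set.univ i i)
    rwa [Subsingleton.elim (default : S.ι) i] at this
  have h1 : Y.1 Set.univ i i = 1 := h.unique hY.trace_eq
  rw [Subsingleton.elim j i, Subsingleton.elim k i]
  have h2 : ((X.1 Set.univ i i) • Y).1 B i i = X.1 Set.univ i i * Y.1 B i i := rfl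
  rw [h2]
  rcases Set.eq_empty_or_nonempty B with hB | hB
  · rw [hB, VectorMeasure.empty, VectorMeasure.empty]
    exact (mul_zero _).symm
  · rw [Subsingleton.eq_univ_of_nonempty hB, h1, mul_one]

theorem subsingleton_pow_unit (n : ℕ) :
    Subsingleton (pow unit n).Ω ∧ Subsingleton (pow unit n).ι := by
  induction n with
  | zero => exact ⟨inferInstanceAs (Subsingleton Unit), inferInstanceAs (Subsingleton Unit)⟩
  | succ n ih =>
    obtain ⟨h1, h2⟩ := ih
    exact ⟨inferInstanceAs (Subsingleton (Unit × (pow unit n).Ω)),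
      inferInstanceAs (Subsingleton (Unit × (pow unit n).ι))⟩

/-- The state of the trivial system. -/
def one : V unit := ⟨(exists_state unit).choose, Submodule.subset_span (exists_state unit).choose_spec⟩

theorem isState_one : IsState one.1 := (exists_state unit).choose_spec

theorem one_apply : one.1 Set.univ () () = 1 := by
  have h : HasSum (fun i : Unit => one.1 Set.univ i i) (one.1 Set.univ () ()) := hasSum_unique _
  exact h.unique isState_one.trace_eq

theorem prep_one {S : Sys} (x : V S) : prep x one = x := by
  rw [prep_apply, one_apply, one_smul]

/-! ### Powers of states -/

/-- The state `x^{⊗ n}`. -/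
def spow {A : Sys} (x : V A) : (n : ℕ) → V (pow A n)
  | 0 => one
  | n + 1 => tprod x (spow x n)

/-- The element `∑ₖ x^{⊗ (k-1)} ⊗ δ ⊗ x^{⊗ (n-k)}`. -/
def sdpow {A : Sys} (x δ : V A) : (n : ℕ) → V (pow A n)
  | 0 => 0
  | n + 1 => tprod δ (spow x n) + tprod x (sdpow x δ n)

theorem spow_isState {A : Sys} {x : V A} (hx : IsState x.1) : ∀ n, IsState (spow x n).1
  | 0 => isState_one
  | n + 1 => tprod_isState hx (spow_isState hx n)

theorem sdpow_smul {A : Sys} (x δ : V A) (c : ℂ) : ∀ n, sdpow x (c • δ) n = c • sdpow x δ n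
  | 0 => (smul_zero _).symm
  | n + 1 =>
    (congrArg₂ (· + ·) (smul_tprod c δ (spow x n))
      ((congrArg (tprod x) (sdpow_smul x δ c n)).trans (tprod_smul c x _))).trans
      (smul_add c (tprod δ (spow x n)) (tprod x (sdpow x δ n))).symm

theorem tpow_spow {A B : Sys} {Φ : Map A B} (hΦ : IsChannel Φ) (x : V A) :
    ∀ n, tpow Φ n (spow x n) = spow (Φ x) n
  | 0 => rfl
  | n + 1 => (tensor_tprod hΦ.amplifiable (hΦ.tpow n).amplifiable x (spow x n)).trans
      (congrArg (tprod (Φ x)) (tpow_spow hΦ x n))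

theorem dpow_spow {A B : Sys} {Φ Δ : Map A B} (hΦ : IsChannel Φ) (hΔ : IsTangent Δ) (x : V A) :
    ∀ n, dpow Φ Δ n (spow x n) = sdpow (Φ x) (Δ x) n
  | 0 => rfl
  | n + 1 => congrArg₂ (· + ·)
      ((tensor_tprod hΔ.amplifiable (hΦ.tpow n).amplifiable x (spow x n)).trans
        (congrArg (tprod (Δ x)) (tpow_spow hΦ x n)))
      ((tensor_tprod hΦ.amplifiable (hΔ.dpow hΦ n).amplifiable x (spow x n)).trans
        (congrArg (tprod (Φ x)) (dpow_spow hΦ hΔ x n)))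

/-- The identification of `1^{⊗ n}` with the trivial system. -/
def collapse : (n : ℕ) → Map (pow unit n) unit
  | 0 => LinearMap.id
  | n + 1 => dropUnit unit ∘ₗ tensor LinearMap.id (collapse n)

theorem isChannel_collapse : ∀ n, IsChannel (collapse n)
  | 0 => isChannel_id _
  | n + 1 => (isChannel_dropUnit unit).comp ((isChannel_id unit).tensor (isChannel_collapse n))

theorem unit_ext {x y : V unit} (h : x.1 Set.univ () () = y.1 Set.univ () ()) : x = y := by
  rw [eq_smul_of_subsingleton isState_one () x, eq_smul_of_subsingleton isState_one () y, h]

theorem collapse_spow : ∀ n, collapse n (spow one n) = one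
  | 0 => rfl
  | n + 1 => by
    refine (congrArg (dropUnit unit) ((tensor_tprod (isChannel_id unit).amplifiable
      (isChannel_collapse n).amplifiable one (spow one n)).trans
      (congrArg (tprod _) (collapse_spow n)))).trans (unit_ext ?_)
    rw [dropUnit_apply _ MeasurableSet.univ, tprod_apply _ _ MeasurableSet.univ MeasurableSet.univ,
      LinearMap.id_apply, one_apply, one_mul]

/-- The powers of the trivial system are one-dimensional. -/
theorem pow_unit_ext {S : Sys} {n : ℕ} {Φ Ψ : Map (pow unit n) S}
    (h : Φ (spow one n) = Ψ (spow one n)) : Φ = Ψ := by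
  obtain ⟨h1, h2⟩ := subsingleton_pow_unit n
  obtain ⟨i⟩ := (pow unit n).nonemptyι
  refine LinearMap.ext fun X => ?_
  rw [eq_smul_of_subsingleton (spow_isState isState_one n) i X, map_smul, map_smul, h]

/-! ### Attaching a state -/

theorem attach_apply {A S : Sys} (x : V S) (y : V A) : attach A x y = tprod y x := by
  have h : unitor A y = tprod y one := by
    refine prod_ext fun B hB C hC i a j b => ?_
    rw [tprod_apply _ _ hB hC, unitor, relabel_eq_push,
      push_apply (A := A) (B := prod A unit) _ _ _ (hB.prod hC)]
    rcases Set.eq_empty_or_nonempty C with h | h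
    · subst h
      rw [Set.prod_empty, Set.preimage_empty, VectorMeasure.empty, VectorMeasure.empty]
      exact (mul_zero _).symm
    · rw [Subsingleton.eq_univ_of_nonempty h, one_apply, mul_one]
      refine congrFun (congrFun (congrArg (y.1 : Set _ → _) ?_) _) _
      exact Set.ext fun w => and_iff_left (Set.mem_univ ())
  rw [attach, LinearMap.comp_apply, h, tensor_tprod (isChannel_id A).amplifiable
    (amplifiable_prep x), prep_one]
  rfl

theorem isChannel_attach (A : Sys) {S : Sys} {x : V S} (hx : IsState x.1) :
    IsChannel (attach A x) :=
  ((isChannel_id A).tensor (isChannel_prep hx)).comp (isChannel_unitor A)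

theorem isTangent_attach (A : Sys) {S : Sys} {x : V S} (hx : IsTangent (prep x)) :
    IsTangent (attach A x) :=
  (IsTangent.tensor_right (isChannel_id A) hx).comp_right (isChannel_unitor A)

/-! ### Trace norm and completely bounded norm -/

theorem traceNorm_le {A : Sys} {X ρ σ : V A} (hρ : IsState ρ.1) (hσ : IsState σ.1) {s t : ℝ≥0}
    (h : X = ((s : ℝ) : ℂ) • ρ - ((t : ℝ) : ℂ) • σ) : traceNorm X ≤ ((s + t : ℝ≥0) : ℝ≥0∞) := by
  unfold traceNorm
  exact iInf_le_of_le s (iInf_le_of_le t (iInf_le_of_le ρ (iInf_le_of_le σ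
    (iInf_le_of_le hρ (iInf_le_of_le hσ (iInf_le_of_le h le_rfl))))))

theorem exists_of_traceNorm_lt {A : Sys} {X : V A} {r : ℝ≥0∞} (h : traceNorm X < r) :
    ∃ (s t : ℝ≥0) (ρ σ : V A), IsState ρ.1 ∧ IsState σ.1 ∧
      X = ((s : ℝ) : ℂ) • ρ - ((t : ℝ) : ℂ) • σ ∧ ((s + t : ℝ≥0) : ℝ≥0∞) < r := by
  unfold traceNorm at h
  simp only [iInf_lt_iff] at h
  obtain ⟨s, t, ρ, σ, hρ, hσ, h1, h2⟩ := h
  exact ⟨s, t, ρ, σ, hρ, hσ, h1, h2⟩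

theorem IsChannel.traceNorm_le {A B : Sys} {Φ : Map A B} (hΦ : IsChannel Φ) (X : V A) :
    traceNorm (Φ X) ≤ traceNorm X := by
  refine le_of_forall_gt fun r hr => ?_
  obtain ⟨s, t, ρ, σ, hρ, hσ, h1, h2⟩ := exists_of_traceNorm_lt hr
  refine (ChannelMetric.traceNorm_le (hΦ.map_state ρ hρ) (hΦ.map_state σ hσ) (s := s) (t := t)
    ?_).trans_lt h2
  rw [h1, map_sub, map_smul, map_smul]

/-- Nonnegative combinations of two states are multiples of states. -/
theorem exists_state_combination {A : Sys} {ρ σ : V A} (hρ : IsState ρ.1) (hσ : IsState σ.1)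
    (a b : ℝ≥0) : ∃ τ : V A, IsState τ.1 ∧
      ((a : ℝ) : ℂ) • ρ + ((b : ℝ) : ℂ) • σ = (((a + b : ℝ≥0) : ℝ) : ℂ) • τ := by
  rcases eq_or_ne (a + b) 0 with h0 | h0
  · refine ⟨ρ, hρ, ?_⟩
    obtain ⟨ha, hb⟩ := add_eq_zero.mp h0
    simp [ha, hb]
  · have h1 : ((a + b : ℝ≥0) : ℝ) ≠ 0 := by exact_mod_cast h0
    refine ⟨(((a / (a + b) : ℝ) : ℂ) • ρ + ((b / (a + b) : ℝ) : ℂ) • σ), ?_, ?_⟩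
    · refine hρ.convex hσ (by positivity) (by positivity) ?_
      rw [← add_div]
      exact div_self (by simpa using h1)
    · rw [smul_add, smul_smul, smul_smul, ← Complex.ofReal_mul, ← Complex.ofReal_mul]
      push_cast at h1 ⊢
      rw [mul_div_cancel₀ _ (by exact_mod_cast h1), mul_div_cancel₀ _ (by exact_mod_cast h1)]

/-- Preparing `x` next to an ancilla has operator norm at most the trace norm of `x`. -/
theorem traceNorm_amp_prep_le {S R : Sys} (x : V S) {X : V (prod unit R)} (hX : traceNorm X ≤ 1) :
    traceNorm (amp (prep x) R X) ≤ traceNorm x := by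
  rw [← mul_one (traceNorm x)]
  refine ENNReal.le_mul_of_forall_lt (Or.inr ENNReal.one_ne_top) (Or.inr one_ne_zero)
    fun a ha b hb => ?_
  obtain ⟨u, v, α, β, hα, hβ, hx, huv⟩ := exists_of_traceNorm_lt ha
  obtain ⟨s, t, ρ, σ, hρ, hσ, hX', hst⟩ := exists_of_traceNorm_lt (hX.trans_lt hb)
  have h1 : prep x = ((u : ℝ) : ℂ) • prep α - ((v : ℝ) : ℂ) • prep β := by
    rw [hx, prep_sub, prep_smul, prep_smul]
  have cα := isChannel_prep hα
  have cβ := isChannel_prep hβ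
  have h2 : amp (prep x) R X = ((u : ℝ) : ℂ) • amp (prep α) R X - ((v : ℝ) : ℂ) • amp (prep β) R X := by
    rw [h1, amp_sub (cα.amplifiable.smul _) (cβ.amplifiable.smul _), amp_smul _ cα.amplifiable,
      amp_smul _ cβ.amplifiable]
    rfl
  obtain ⟨τ, hτ, e1⟩ := exists_state_combination (cα.amp_state R ρ hρ) (cβ.amp_state R σ hσ)
    (u * s) (v * t)
  obtain ⟨τ', hτ', e2⟩ := exists_state_combination (cα.amp_state R σ hσ) (cβ.amp_state R ρ hρ)
    (u * t) (v * s)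
  have h3 : amp (prep x) R X = (((u * s + v * t : ℝ≥0) : ℝ) : ℂ) • τ
      - (((u * t + v * s : ℝ≥0) : ℝ) : ℂ) • τ' := by
    rw [← e1, ← e2, h2, hX', map_sub, map_sub, map_smul, map_smul, map_smul, map_smul]
    push_cast
    module
  refine (traceNorm_le hτ hτ' h3).trans ?_
  calc (((u * s + v * t) + (u * t + v * s) : ℝ≥0) : ℝ≥0∞) = ((u + v : ℝ≥0) : ℝ≥0∞) * (s + t : ℝ≥0) := by
        norm_cast; ring
    _ ≤ a * b := mul_le_mul' huv.le hst.le

/-- An error that factors through the preparation of `x` is bounded in completely bounded norm by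
the trace norm of `x`. -/
theorem cbNorm_comp_prep_comp_le {A S B : Sys} {Ψ : Map S B} {Ξ : Map A unit} (hΨ : IsChannel Ψ)
    (hΞ : IsChannel Ξ) (x : V S) : cbNorm (Ψ ∘ₗ prep x ∘ₗ Ξ) ≤ traceNorm x := by
  refine iSup_le fun k => iSup_le fun X => iSup_le fun hX => ?_
  rw [amp_comp hΨ.amplifiable ((amplifiable_prep x).comp hΞ.amplifiable),
    amp_comp (amplifiable_prep x) hΞ.amplifiable, LinearMap.comp_apply, LinearMap.comp_apply]
  exact ((hΨ.amp _).traceNorm_le _).trans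
    (traceNorm_amp_prep_le x (((hΞ.amp _).traceNorm_le _).trans hX))

/-! ### Classical systems -/

section Classical

variable {Ω Ω' : Type} [MeasurableSpace Ω] [Nonempty Ω] [MeasurableSpace Ω'] [Nonempty Ω']

theorem ofSigned_apply (s : SignedMeasure Ω) (B : Set Ω) (i j : Unit) :
    (ofSigned s).1 B i j = (s B : ℂ) := rfl

theorem ofSigned_sub (s t : SignedMeasure Ω) : ofSigned (s - t) = ofSigned s - ofSigned t :=
  pre_ext fun B _ _ _ => Complex.ofReal_sub (s B) (t B)

theorem ofSigned_smul (c : ℝ) (s : SignedMeasure Ω) : ofSigned (c • s) = (c : ℂ) • ofSigned s :=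
  pre_ext fun B _ _ _ => Complex.ofReal_mul c (s B)

theorem toSigned_apply (x : V (classical Ω)) (B : Set Ω) : toSigned x B = (x.1 B () ()).re := rfl

theorem toSigned_ofSigned (s : SignedMeasure Ω) : toSigned (ofSigned s) = s :=
  VectorMeasure.ext fun B _ => Complex.ofReal_re (s B)

/-- A finite measure as an element of the state space of a classical system. -/
def ofMeasure (μ : Measure Ω) [IsFiniteMeasure μ] : V (classical Ω) := ofSigned μ.toSignedMeasure

theorem ofMeasure_apply (μ : Measure Ω) [IsFiniteMeasure μ] {B : Set Ω} (hB : MeasurableSet B)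
    (i j : Unit) : (ofMeasure μ).1 B i j = (μ.real B : ℂ) := by
  rw [ofMeasure, ofSigned_apply, Measure.toSignedMeasure_apply_measurable hB]

theorem isState_ofMeasure (μ : Measure Ω) [IsProbabilityMeasure μ] :
    IsState (ofMeasure μ).1 := by
  constructor
  · intro B
    have h1 : (ofMeasure μ).1 B = Matrix.diagonal fun _ => ((μ.toSignedMeasure B : ℝ) : ℂ) := by
      ext i j
      rw [Subsingleton.elim j i, Matrix.diagonal_apply_eq]
      rfl
    rw [h1]
    refine Matrix.PosSemidef.diagonal fun i => Complex.zero_le_real.mpr ?_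
    rw [Measure.toSignedMeasure_apply]
    split_ifs <;> positivity
  · have h : HasSum (fun i : Unit => (ofMeasure μ).1 Set.univ i i)
        ((ofMeasure μ).1 Set.univ () ()) := hasSum_unique _
    rw [ofMeasure_apply μ MeasurableSet.univ, probReal_univ, Complex.ofReal_one] at h
    exact h

/-- The states of a classical system are the probability measures. -/
theorem exists_ofMeasure {x : V (classical Ω)} (hx : IsState x.1) :
    ∃ (μ : Measure Ω) (_ : IsProbabilityMeasure μ), x = ofMeasure μ := by
  have hreal : ∀ B, (((x.1 B () ()).re : ℝ) : ℂ) = x.1 B () () := fun B =>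
    Complex.ext rfl (Complex.nonneg_iff.mp (hx.posSemidef B).diag_nonneg).2
  have h0 : 0 ≤[Set.univ] toSigned x := by
    rw [VectorMeasure.le_restrict_univ_iff_le]
    intro B _
    exact (Complex.nonneg_iff.mp (hx.posSemidef B).diag_nonneg).1
  let μ := (toSigned x).toMeasureOfZeroLE Set.univ MeasurableSet.univ h0
  have hμ : μ.toSignedMeasure = toSigned x := SignedMeasure.toMeasureOfZeroLE_toSignedMeasure _ h0
  have hx' : x = ofMeasure μ := by
    refine pre_ext fun B _ i j => ?_
    rw [ofMeasure, hμ, ofSigned_apply, toSigned_apply, hreal]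
  refine ⟨μ, ⟨?_⟩, hx'⟩
  have h1 : HasSum (fun i : Unit => x.1 Set.univ i i) (x.1 Set.univ () ()) := hasSum_unique _
  have h2 := h1.unique hx.trace_eq
  rw [hx', ofMeasure_apply μ MeasurableSet.univ] at h2
  have h3 : μ.real Set.univ = 1 := by exact_mod_cast h2
  rw [measureReal_def] at h3
  rw [← ENNReal.ofReal_toReal (measure_ne_top μ Set.univ), h3, ENNReal.ofReal_one]

theorem exists_smul_state (μ : Measure Ω) [IsFiniteMeasure μ] : ∃ ρ : V (classical Ω),
    IsState ρ.1 ∧ ofMeasure μ = (((μ Set.univ).toNNReal : ℝ) : ℂ) • ρ := by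
  rcases eq_or_ne μ 0 with h0 | h0
  · obtain ⟨X, hX⟩ := exists_state (classical Ω)
    refine ⟨⟨X, Submodule.subset_span hX⟩, hX, ?_⟩
    refine pre_ext fun B hB i j => ?_
    rw [ofMeasure_apply μ hB]
    simp [h0]
  · have : NeZero μ := ⟨h0⟩
    refine ⟨ofMeasure ((μ Set.univ)⁻¹ • μ), isState_ofMeasure _, ?_⟩
    refine pre_ext fun B hB i j => ?_
    have h1 : (((((μ Set.univ).toNNReal : ℝ) : ℂ) • ofMeasure ((μ Set.univ)⁻¹ • μ)).1) B i j
        = ((μ Set.univ).toNNReal : ℝ) * (ofMeasure ((μ Set.univ)⁻¹ • μ)).1 B i j := rfl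
    rw [h1, ofMeasure_apply μ hB, ofMeasure_apply _ hB, ← Complex.ofReal_mul]
    congr 1
    rw [measureReal_ennreal_smul_apply, ENNReal.toReal_inv, ← mul_assoc]
    have h2 : (μ Set.univ).toReal ≠ 0 :=
      ENNReal.toReal_ne_zero.mpr ⟨NeZero.ne _, measure_ne_top _ _⟩
    rw [ENNReal.coe_toNNReal_eq_toReal, mul_inv_cancel₀ h2, one_mul]

/-- The trace norm of a signed measure is controlled by its values on measurable sets, by the Hahn
decomposition. -/
theorem traceNorm_ofSigned_le (s : SignedMeasure Ω) {ε : ℝ} (h : ∀ B, MeasurableSet B → |s B| ≤ ε) :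
    traceNorm (ofSigned s) ≤ ENNReal.ofReal (2 * ε) := by
  obtain ⟨P, hP, h1, h2⟩ := s.exists_compl_positive_negative
  let μ := s.toMeasureOfZeroLE P hP h1
  let ν := s.toMeasureOfLEZero Pᶜ hP.compl h2
  have hs : s = μ.toSignedMeasure - ν.toSignedMeasure := by
    ext B hB
    rw [Measure.toSignedMeasure_sub_apply hB, SignedMeasure.toMeasureOfZeroLE_real_apply _ h1 hP hB,
      SignedMeasure.toMeasureOfLEZero_real_apply _ h2 hP.compl hB, sub_neg_eq_add,
      ← VectorMeasure.of_union _ (hP.inter hB) (hP.compl.inter hB), ← Set.union_inter_distrib_right,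
      Set.union_compl_self, Set.univ_inter]
    exact (disjoint_compl_right).mono Set.inter_subset_left Set.inter_subset_left
  obtain ⟨ρ, hρ, e1⟩ := exists_smul_state μ
  obtain ⟨σ, hσ, e2⟩ := exists_smul_state ν
  have e3 : ofSigned s = (((μ Set.univ).toNNReal : ℝ) : ℂ) • ρ
      - (((ν Set.univ).toNNReal : ℝ) : ℂ) • σ := by
    rw [← e1, ← e2]
    exact (congrArg ofSigned hs).trans (ofSigned_sub _ _)
  refine (traceNorm_le hρ hσ e3).trans ?_
  rw [ENNReal.coe_add, ENNReal.coe_toNNReal (measure_ne_top _ _),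
    ENNReal.coe_toNNReal (measure_ne_top _ _), two_mul,
    ENNReal.ofReal_add ((abs_nonneg _).trans (h P hP)) ((abs_nonneg _).trans (h P hP))]
  refine add_le_add ?_ ?_
  · rw [← ENNReal.ofReal_toReal (measure_ne_top μ Set.univ)]
    refine ENNReal.ofReal_le_ofReal ?_
    rw [← measureReal_def, SignedMeasure.toMeasureOfZeroLE_real_apply _ h1 hP MeasurableSet.univ]
    exact (le_abs_self _).trans (h _ (hP.inter MeasurableSet.univ))
  · rw [← ENNReal.ofReal_toReal (measure_ne_top ν Set.univ)]
    refine ENNReal.ofReal_le_ofReal ?_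
    rw [← measureReal_def, SignedMeasure.toMeasureOfLEZero_real_apply _ h2 hP.compl
      MeasurableSet.univ]
    exact (neg_le_abs _).trans (h _ (hP.compl.inter MeasurableSet.univ))

end Classical

/-! ### Processing of classical data -/

section Classical

variable {Ω Ω' : Type} [MeasurableSpace Ω] [Nonempty Ω] [MeasurableSpace Ω'] [Nonempty Ω']

/-- The application of a measurable function to classical data. -/
def cpush (g : Ω → Ω') (hg : Measurable g) : Map (classical Ω) (classical Ω') :=
  push (A := classical Ω) (B := classical Ω') g hg (Equiv.refl _)

theorem isChannel_cpush {g : Ω → Ω'} (hg : Measurable g) : IsChannel (cpush g hg) :=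
  isChannel_push (A := classical Ω) (B := classical Ω') hg _

theorem cpush_ofSigned {g : Ω → Ω'} (hg : Measurable g) (s : SignedMeasure Ω) :
    cpush g hg (ofSigned s) = ofSigned (s.map g) := by
  refine pre_ext fun B hB i j => ?_
  rw [cpush, push_apply (A := classical Ω) (B := classical Ω') hg _ _ hB, ofSigned_apply,
    ofSigned_apply, VectorMeasure.map_apply _ hg hB]

theorem ofMeasure_congr {μ ν : Measure Ω} [IsFiniteMeasure μ] [IsFiniteMeasure ν] (h : μ = ν) :
    ofMeasure μ = ofMeasure ν := by
  subst h; rfl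

theorem cpush_ofMeasure {g : Ω → Ω'} (hg : Measurable g) (μ : Measure Ω) [IsFiniteMeasure μ] :
    cpush g hg (ofMeasure μ) = ofMeasure (μ.map g) := by
  refine (cpush_ofSigned hg _).trans (congrArg ofSigned ?_)
  ext B hB
  rw [VectorMeasure.map_apply _ hg hB, Measure.toSignedMeasure_apply_measurable (hg hB),
    Measure.toSignedMeasure_apply_measurable hB, map_measureReal_apply hg hB]

theorem map_withDensityᵥ_comp {Ω Ω' : Type} [MeasurableSpace Ω] [MeasurableSpace Ω']
    {μ : Measure Ω} {g : Ω → Ω'} (hg : Measurable g) {f : Ω' → ℝ}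
    (hf : Integrable f (μ.map g)) :
    (μ.withDensityᵥ (f ∘ g)).map g = (μ.map g).withDensityᵥ f := by
  ext B hB
  rw [VectorMeasure.map_apply _ hg hB, withDensityᵥ_apply (hf.comp_measurable hg) (hg hB),
    withDensityᵥ_apply hf hB, setIntegral_map hB hf.aestronglyMeasurable hg.aemeasurable]
  rfl

/-- A pair of classical data as data of a composite system. -/
def split (Ω Ω' : Type) [MeasurableSpace Ω] [Nonempty Ω] [MeasurableSpace Ω'] [Nonempty Ω'] :
    Map (classical (Ω × Ω')) (prod (classical Ω) (classical Ω')) :=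
  push (A := classical (Ω × Ω')) (B := prod (classical Ω) (classical Ω')) id measurable_id
    (Equiv.prodPUnit Unit).symm

/-- The data of a pair of classical systems as a single piece of data. -/
def merge (Ω Ω' : Type) [MeasurableSpace Ω] [Nonempty Ω] [MeasurableSpace Ω'] [Nonempty Ω'] :
    Map (prod (classical Ω) (classical Ω')) (classical (Ω × Ω')) :=
  push (A := prod (classical Ω) (classical Ω')) (B := classical (Ω × Ω')) id measurable_id
    (Equiv.prodPUnit Unit)

theorem isChannel_split : IsChannel (split Ω Ω') :=
  isChannel_push (A := classical (Ω × Ω')) (B := prod (classical Ω) (classical Ω')) _ _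

theorem isChannel_merge : IsChannel (merge Ω Ω') :=
  isChannel_push (A := prod (classical Ω) (classical Ω')) (B := classical (Ω × Ω')) _ _

theorem merge_split (X : V (classical (Ω × Ω'))) : merge Ω Ω' (split Ω Ω' X) = X := by
  refine pre_ext fun B hB i j => ?_
  exact (push_apply (A := prod (classical Ω) (classical Ω')) (B := classical (Ω × Ω'))
    measurable_id _ _ hB i j).trans (push_apply (A := classical (Ω × Ω'))
    (B := prod (classical Ω) (classical Ω')) measurable_id _ X hB _ _)

/-- Product signed measures are determined by their values on rectangles. -/
theorem tprod_eq_split {s : SignedMeasure Ω} {t : SignedMeasure Ω'} {u : SignedMeasure (Ω × Ω')}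
    (h : ∀ B, MeasurableSet B → ∀ C, MeasurableSet C → u (B ×ˢ C) = s B * t C) :
    tprod (ofSigned s) (ofSigned t) = split Ω Ω' (ofSigned u) := by
  refine prod_ext fun B hB C hC i a j b => ?_
  rw [tprod_apply _ _ hB hC, split, push_apply (A := classical (Ω × Ω'))
    (B := prod (classical Ω) (classical Ω')) measurable_id _ _ (hB.prod hC), ofSigned_apply,
    ofSigned_apply, ← Complex.ofReal_mul, ← h B hB C hC]
  rfl

theorem tprod_ofMeasure (μ : Measure Ω) [IsFiniteMeasure μ] (ν : Measure Ω') [IsFiniteMeasure ν] :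
    tprod (ofMeasure μ) (ofMeasure ν) = split Ω Ω' (ofMeasure (μ.prod ν)) := by
  refine tprod_eq_split fun B hB C hC => ?_
  rw [Measure.toSignedMeasure_apply_measurable hB, Measure.toSignedMeasure_apply_measurable hC,
    Measure.toSignedMeasure_apply_measurable (hB.prod hC), measureReal_prod_prod]

theorem tprod_withDensityᵥ_left {μ : Measure Ω} [IsFiniteMeasure μ] {ν : Measure Ω'}
    [IsFiniteMeasure ν] {f : Ω → ℝ} (hf : Integrable f μ) :
    tprod (ofSigned (μ.withDensityᵥ f)) (ofMeasure ν)
      = split Ω Ω' (ofSigned ((μ.prod ν).withDensityᵥ fun z => f z.1)) := by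
  refine tprod_eq_split fun B hB C hC => ?_
  have h := setIntegral_prod_mul (μ := μ) (ν := ν) f (fun _ => (1 : ℝ)) B C
  simp only [mul_one, setIntegral_const, smul_eq_mul] at h
  rw [withDensityᵥ_apply (hf.comp_fst ν) (hB.prod hC), withDensityᵥ_apply hf hB,
    Measure.toSignedMeasure_apply_measurable hC, h]

theorem tprod_withDensityᵥ_right {μ : Measure Ω} [IsFiniteMeasure μ] {ν : Measure Ω'}
    [IsFiniteMeasure ν] {f : Ω' → ℝ} (hf : Integrable f ν) :
    tprod (ofMeasure μ) (ofSigned (ν.withDensityᵥ f))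
      = split Ω Ω' (ofSigned ((μ.prod ν).withDensityᵥ fun z => f z.2)) := by
  refine tprod_eq_split fun B hB C hC => ?_
  have h := setIntegral_prod_mul (μ := μ) (ν := ν) (fun _ => (1 : ℝ)) f B C
  simp only [one_mul, mul_one, setIntegral_const, smul_eq_mul] at h
  rw [withDensityᵥ_apply (hf.comp_snd μ) (hB.prod hC), withDensityᵥ_apply hf hC,
    Measure.toSignedMeasure_apply_measurable hB, h]

end Classical

/-! ### Gaussian shifts -/

theorem gauss_eq (a : ℝ) (v : ℝ≥0) : gauss a v = ofMeasure (gaussianReal a v) := rfl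

theorem isState_gauss (a : ℝ) (v : ℝ≥0) : IsState (gauss a v).1 := isState_ofMeasure _

theorem integrable_id_gaussianReal (a : ℝ) (v : ℝ≥0) : Integrable (fun x => x) (gaussianReal a v) :=
  (memLp_id_gaussianReal 1).integrable (by simp)

theorem integrable_score (a : ℝ) (v : ℝ≥0) :
    Integrable (fun x => (x - a) / v) (gaussianReal a v) :=
  ((integrable_id_gaussianReal a v).sub (integrable_const a)).div_const _

theorem dgauss_eq (a : ℝ) {v : ℝ≥0} (hv : v ≠ 0) :
    dgauss a v = ofSigned ((gaussianReal a v).withDensityᵥ fun x => (x - a) / v) := by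
  have h0 := integrable_score a v
  have h1 : ∀ x, (gaussianPDF a v x).toReal • ((x - a) / v) = (x - a) / v * gaussianPDFReal a v x :=
    fun x => by rw [toReal_gaussianPDF, smul_eq_mul, mul_comm]
  have h2 : Integrable (fun x => (x - a) / v * gaussianPDFReal a v x) := by
    rw [gaussianReal_of_var_ne_zero a hv, integrable_withDensity_iff_integrable_smul'
      (measurable_gaussianPDF a v) (ae_of_all _ fun _ => gaussianPDF_lt_top)] at h0
    simpa only [h1] using h0
  refine congrArg ofSigned (VectorMeasure.ext fun B hB => ?_)
  rw [withDensityᵥ_apply h0 hB, withDensityᵥ_apply h2 hB, gaussianReal_of_var_ne_zero a hv,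
    setIntegral_withDensity_eq_setIntegral_toReal_smul (measurable_gaussianPDF a v)
      (ae_of_all _ fun _ => gaussianPDF_lt_top) _ hB]
  simp only [h1]

theorem dgauss_zero_one : dgauss 0 1 = ofSigned ((gaussianReal 0 1).withDensityᵥ fun x => x) := by
  simpa using dgauss_eq 0 (one_ne_zero (α := ℝ≥0))

/-- Signed measures of total mass zero are tangent vectors. -/
theorem isTangent_prep_ofSigned {Ω : Type} [MeasurableSpace Ω] [Nonempty Ω] {s : SignedMeasure Ω}
    (hs : s Set.univ = 0) : IsTangent (prep (ofSigned s)) := by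
  have h3 := s.toSignedMeasure_toJordanDecomposition
  have h4 : s = s.toJordanDecomposition.posPart.toSignedMeasure
      - s.toJordanDecomposition.negPart.toSignedMeasure := h3.symm
  obtain ⟨ρ, hρ, e1⟩ := exists_smul_state s.toJordanDecomposition.posPart
  obtain ⟨σ, hσ, e2⟩ := exists_smul_state s.toJordanDecomposition.negPart
  have h5 : s.toJordanDecomposition.posPart.real Set.univ
      = s.toJordanDecomposition.negPart.real Set.univ := by
    have h6 := congrArg (fun t : SignedMeasure Ω => t Set.univ) h4
    simp only [hs] at h6
    rw [Measure.toSignedMeasure_sub_apply MeasurableSet.univ] at h6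
    linarith
  refine ⟨((s.toJordanDecomposition.posPart Set.univ).toNNReal : ℝ), _, _, isChannel_prep hρ,
    isChannel_prep hσ, ?_⟩
  have h7 : (((s.toJordanDecomposition.negPart Set.univ).toNNReal : ℝ) : ℂ)
      = ((s.toJordanDecomposition.posPart Set.univ).toNNReal : ℝ) := congrArg _ h5.symm
  rw [← prep_sub, ← prep_smul, smul_sub, ← e1, ← h7, ← e2]
  exact congrArg prep ((congrArg ofSigned h4).trans (ofSigned_sub _ _))

theorem isTangent_prep_dgauss (a : ℝ) {v : ℝ≥0} (hv : v ≠ 0) : IsTangent (prep (dgauss a v)) := by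
  rw [dgauss_eq a hv]
  refine isTangent_prep_ofSigned ?_
  rw [withDensityᵥ_apply (integrable_score a v) MeasurableSet.univ, setIntegral_univ,
    integral_div, integral_sub (integrable_id_gaussianReal a v) (integrable_const a),
    integral_id_gaussianReal]
  simp

/-- The affine map that sends `N(0, 1)` to `N(a, v)`. -/
theorem cpush_gauss (a : ℝ) (v : ℝ≥0) :
    cpush (fun x => √(v : ℝ) * x + a) (by fun_prop) (gauss 0 1) = gauss a v := by
  refine (cpush_ofMeasure _ _).trans (ofMeasure_congr ?_)
  have h1 := Measure.map_map (μ := gaussianReal 0 1) (g := fun x => x + a) (f := fun x => √(v : ℝ) * x)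
    (by fun_prop) (by fun_prop)
  rw [gaussianReal_map_const_mul, gaussianReal_map_add_const] at h1
  refine h1.symm.trans ?_
  congr 1
  · simp
  · ext; simp

theorem cpush_dgauss (a : ℝ) {v : ℝ≥0} (hv : v ≠ 0) :
    cpush (fun x => √(v : ℝ) * x + a) (by fun_prop) (dgauss 0 1) = ((√(v : ℝ) : ℝ) : ℂ) • dgauss a v := by
  have hm : Measurable fun x => √(v : ℝ) * x + a := by fun_prop
  have h1 : (gaussianReal 0 1).map (fun x => √(v : ℝ) * x + a) = gaussianReal a v := by
    have := congrArg toSigned (cpush_gauss a v)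
    rw [gauss_eq, gauss_eq, cpush_ofMeasure, ofMeasure, ofMeasure, toSigned_ofSigned,
      toSigned_ofSigned] at this
    exact Measure.toSignedMeasure_eq_toSignedMeasure_iff.mp this
  have hv' : √(v : ℝ) ≠ 0 := by positivity
  have hvv : √(v : ℝ) * √(v : ℝ) = v := Real.mul_self_sqrt v.2
  have h2 : (fun x : ℝ => x) = (√(v : ℝ) • fun x => (x - a) / (v : ℝ)) ∘ (fun x => √(v : ℝ) * x + a) := by
    funext x
    simp only [Function.comp, Pi.smul_apply, smul_eq_mul, add_sub_cancel_right]
    rw [← mul_div_assoc, ← mul_assoc, hvv, mul_div_cancel_left₀]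
    exact_mod_cast hv
  have h3 : ((gaussianReal 0 1).withDensityᵥ fun x => x).map (fun x => √(v : ℝ) * x + a)
      = √(v : ℝ) • (gaussianReal a v).withDensityᵥ fun x => (x - a) / (v : ℝ) := by
    refine (congrArg (fun f => ((gaussianReal 0 1).withDensityᵥ f).map
      (fun x => √(v : ℝ) * x + a)) h2).trans ?_
    rw [map_withDensityᵥ_comp hm, h1, withDensityᵥ_smul]
    rw [h1]
    exact (integrable_score a v).smul _
  rw [dgauss_zero_one, cpush_ofSigned, h3, dgauss_eq a hv, ofSigned_smul]

/-! ### Splitting a Gaussian shift into independent ones -/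

/-- The angle of the rotation that splits off one of `n + 1` equally informative coordinates. -/
def angle (n : ℕ) : ℝ := -Real.arctan √(n : ℝ)

theorem cos_angle (n : ℕ) : √((n + 1 : ℕ) : ℝ) * Real.cos (angle n) = 1 := by
  have h : √((n + 1 : ℕ) : ℝ) ≠ 0 := by positivity
  rw [angle, Real.cos_neg, Real.cos_arctan, Real.sq_sqrt n.cast_nonneg, add_comm (1 : ℝ)]
  push_cast at h ⊢
  field_simp

theorem sin_angle (n : ℕ) : √((n + 1 : ℕ) : ℝ) * Real.sin (angle n) = -√(n : ℝ) := by
  have h : √((n + 1 : ℕ) : ℝ) ≠ 0 := by positivity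
  rw [angle, Real.sin_neg, Real.sin_arctan, Real.sq_sqrt n.cast_nonneg, add_comm (1 : ℝ)]
  push_cast at h ⊢
  field_simp

/-- The standard Gaussian distribution on the plane. -/
abbrev gaussPlane : Measure (ℝ × ℝ) := (gaussianReal 0 1).prod (gaussianReal 0 1)

theorem map_rotation_gaussPlane (θ : ℝ) :
    gaussPlane.map (ContinuousLinearMap.rotation (E := ℝ) θ) = gaussPlane :=
  IsGaussian.map_rotation_eq_self (by simp) θ

theorem map_rotation_withDensityᵥ_fst (θ : ℝ) :
    (gaussPlane.withDensityᵥ fun z => z.1).map (ContinuousLinearMap.rotation (E := ℝ) θ)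
      = Real.cos θ • (gaussPlane.withDensityᵥ fun z => z.1)
        - Real.sin θ • (gaussPlane.withDensityᵥ fun z => z.2) := by
  have i1 : Integrable (fun z : ℝ × ℝ => z.1) gaussPlane :=
    (integrable_id_gaussianReal 0 1).comp_fst _
  have i2 : Integrable (fun z : ℝ × ℝ => z.2) gaussPlane :=
    (integrable_id_gaussianReal 0 1).comp_snd _
  have hf : Integrable ((Real.cos θ • fun z : ℝ × ℝ => z.1) - Real.sin θ • fun z : ℝ × ℝ => z.2)
      gaussPlane := (i1.smul _).sub (i2.smul _)
  have h2 : (fun z : ℝ × ℝ => z.1)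
      = ((Real.cos θ • fun z : ℝ × ℝ => z.1) - Real.sin θ • fun z : ℝ × ℝ => z.2)
        ∘ ContinuousLinearMap.rotation (E := ℝ) θ := by
    funext z
    simp only [Function.comp, Pi.sub_apply, Pi.smul_apply, ContinuousLinearMap.rotation_apply,
      smul_eq_mul]
    linear_combination (-z.1) * Real.cos_sq_add_sin_sq θ
  conv_lhs => rw [h2]
  rw [map_withDensityᵥ_comp (ContinuousLinearMap.continuous _).measurable
    ((map_rotation_gaussPlane θ).symm ▸ hf), map_rotation_gaussPlane,
    withDensityᵥ_sub (i1.smul _) (i2.smul _), withDensityᵥ_smul, withDensityᵥ_smul]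

/-- The channel that attaches an independent standard Gaussian variable and rotates the plane. -/
def rotate (θ : ℝ) : Map line (prod line line) :=
  split ℝ ℝ ∘ₗ cpush (ContinuousLinearMap.rotation (E := ℝ) θ)
    (ContinuousLinearMap.continuous _).measurable ∘ₗ merge ℝ ℝ ∘ₗ attach line (gauss 0 1)

theorem isChannel_rotate (θ : ℝ) : IsChannel (rotate θ) :=
  isChannel_split.comp ((isChannel_cpush _).comp
    (isChannel_merge.comp (isChannel_attach line (isState_gauss 0 1))))

theorem rotate_gauss (θ : ℝ) : rotate θ (gauss 0 1) = tprod (gauss 0 1) (gauss 0 1) := by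
  rw [rotate, LinearMap.comp_apply, LinearMap.comp_apply, LinearMap.comp_apply, attach_apply,
    gauss_eq, tprod_ofMeasure, merge_split, cpush_ofMeasure,
    ofMeasure_congr (map_rotation_gaussPlane θ)]

theorem rotate_dgauss (θ : ℝ) : rotate θ (dgauss 0 1)
    = (Real.cos θ : ℂ) • tprod (dgauss 0 1) (gauss 0 1)
      - (Real.sin θ : ℂ) • tprod (gauss 0 1) (dgauss 0 1) := by
  rw [rotate, LinearMap.comp_apply, LinearMap.comp_apply, LinearMap.comp_apply, attach_apply,
    gauss_eq, dgauss_zero_one, tprod_withDensityᵥ_left (integrable_id_gaussianReal 0 1),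
    tprod_withDensityᵥ_right (integrable_id_gaussianReal 0 1), merge_split, cpush_ofSigned,
    map_rotation_withDensityᵥ_fst, ofSigned_sub, ofSigned_smul, ofSigned_smul, map_sub, map_smul,
    map_smul]

/-- A channel that turns `N(0, 1)` into `n` independent copies of itself, in such a way that the shift
of the mean is distributed evenly. -/
def spread : (n : ℕ) → Map line (pow line n)
  | 0 => push (A := line) (B := unit) (fun _ => ()) measurable_const (Equiv.refl _)
  | n + 1 => tensor LinearMap.id (spread n) ∘ₗ rotate (angle n)

theorem isChannel_spread : ∀ n, IsChannel (spread n)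
  | 0 => isChannel_push (A := line) (B := unit) _ _
  | n + 1 => ((isChannel_id line).tensor (isChannel_spread n)).comp (isChannel_rotate _)

theorem eq_one_of_isState {x : V unit} (hx : IsState x.1) : x = one := by
  refine unit_ext (Eq.trans ?_ one_apply.symm)
  have h : HasSum (fun i : Unit => x.1 Set.univ i i) (x.1 Set.univ () ()) := hasSum_unique _
  exact h.unique hx.trace_eq

theorem spread_gauss : ∀ n, spread n (gauss 0 1) = spow (gauss 0 1) n
  | 0 => eq_one_of_isState ((isChannel_spread 0).map_state _ (isState_gauss 0 1))
  | n + 1 => (congrArg (tensor LinearMap.id (spread n)) (rotate_gauss (angle n))).trans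
      ((tensor_tprod (isChannel_id line).amplifiable (isChannel_spread n).amplifiable _ _).trans
        (congrArg (tprod (gauss 0 1)) (spread_gauss n)))

theorem spread_dgauss : ∀ n, spread n ((√(n : ℝ) : ℂ) • dgauss 0 1) = sdpow (gauss 0 1) (dgauss 0 1) n
  | 0 => by
    rw [Nat.cast_zero, Real.sqrt_zero, Complex.ofReal_zero, zero_smul, map_zero]; rfl
  | n + 1 => by
    have ht : ∀ x y : V line, tensor LinearMap.id (spread n) (tprod x y) = tprod x (spread n y) :=
      tensor_tprod (isChannel_id line).amplifiable (isChannel_spread n).amplifiable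
    have h0 : spread (n + 1) ((√((n + 1 : ℕ) : ℝ) : ℂ) • dgauss 0 1)
        = (√((n + 1 : ℕ) : ℝ) : ℂ) • tensor LinearMap.id (spread n)
          (rotate (angle n) (dgauss 0 1)) := map_smul (spread (n + 1)) _ _
    have h1 : (√((n + 1 : ℕ) : ℝ) : ℂ) • tensor LinearMap.id (spread n)
        (rotate (angle n) (dgauss 0 1)) = tprod (dgauss 0 1) (spread n (gauss 0 1))
          + tprod (gauss 0 1) (spread n ((√(n : ℝ) : ℂ) • dgauss 0 1)) := by
      rw [rotate_dgauss, map_sub, map_smul, map_smul, ht, ht, map_smul, tprod_smul, smul_sub,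
        smul_smul, smul_smul, ← Complex.ofReal_mul, ← Complex.ofReal_mul, cos_angle, sin_angle,
        Complex.ofReal_one, one_smul, Complex.ofReal_neg, neg_smul, sub_neg_eq_add]
    exact h0.trans (h1.trans (congrArg₂ (· + ·) (congrArg (tprod _) (spread_gauss n))
      (congrArg (tprod _) (spread_dgauss n))))

/-! ### Sums of independent real variables -/

/-- The `n`-fold convolution power. -/
def cpow (μ : Measure ℝ) : ℕ → Measure ℝ
  | 0 => Measure.dirac 0
  | n + 1 => μ ∗ cpow μ n

instance (μ : Measure ℝ) [IsProbabilityMeasure μ] : ∀ n, IsProbabilityMeasure (cpow μ n)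
  | 0 => inferInstanceAs (IsProbabilityMeasure (Measure.dirac 0))
  | n + 1 => by
    have := instIsProbabilityMeasureRealCpow μ n
    exact inferInstanceAs (IsProbabilityMeasure (μ ∗ cpow μ n))

/-- Addition of two real random variables. -/
def plus : Map (prod line line) line := cpush (fun z : ℝ × ℝ => z.1 + z.2) (by fun_prop) ∘ₗ merge ℝ ℝ

theorem isChannel_plus : IsChannel plus := (isChannel_cpush _).comp isChannel_merge

theorem plus_tprod (μ ν : Measure ℝ) [IsProbabilityMeasure μ] [IsProbabilityMeasure ν] :
    plus (tprod (ofMeasure μ) (ofMeasure ν)) = ofMeasure (μ ∗ ν) := by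
  rw [plus, LinearMap.comp_apply, tprod_ofMeasure, merge_split, cpush_ofMeasure]
  rfl

/-- The addition of independent Gaussian noise. -/
def noise (v : ℝ≥0) : Map line line := plus ∘ₗ attach line (gauss 0 v)

theorem isChannel_noise (v : ℝ≥0) : IsChannel (noise v) :=
  isChannel_plus.comp (isChannel_attach line (isState_gauss 0 v))

theorem noise_ofMeasure (v : ℝ≥0) (μ : Measure ℝ) [IsProbabilityMeasure μ] :
    noise v (ofMeasure μ) = ofMeasure (μ ∗ gaussianReal 0 v) := by
  rw [noise, LinearMap.comp_apply, attach_apply, gauss_eq, plus_tprod]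

/-- The sum of `n` real random variables. -/
def total : (n : ℕ) → Map (pow line n) line
  | 0 => prep (ofMeasure (Measure.dirac 0))
  | n + 1 => plus ∘ₗ tensor LinearMap.id (total n)

theorem isChannel_total : ∀ n, IsChannel (total n)
  | 0 => isChannel_prep (isState_ofMeasure _)
  | n + 1 => isChannel_plus.comp ((isChannel_id line).tensor (isChannel_total n))

theorem total_tprod (n : ℕ) (x : V line) (y : V (pow line n)) :
    total (n + 1) (tprod x y) = plus (tprod x (total n y)) :=
  congrArg plus (tensor_tprod (isChannel_id line).amplifiable (isChannel_total n).amplifiable _ _)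

theorem total_spow (μ : Measure ℝ) [IsProbabilityMeasure μ] :
    ∀ n, total n (spow (ofMeasure μ) n) = ofMeasure (cpow μ n)
  | 0 => prep_one _
  | n + 1 => (total_tprod n _ _).trans ((congrArg (fun x => plus (tprod _ x)) (total_spow μ n)).trans
      (plus_tprod _ _))

theorem total_sdpow (μ ν : Measure ℝ) [IsProbabilityMeasure μ] [IsProbabilityMeasure ν] :
    ∀ n, total (n + 1) (sdpow (ofMeasure μ) (ofMeasure ν) (n + 1))
      = ((n + 1 : ℕ) : ℂ) • ofMeasure (ν ∗ cpow μ n)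
  | 0 => by
    have h : sdpow (ofMeasure μ) (ofMeasure ν) 1 = tprod (ofMeasure ν) (spow (ofMeasure μ) 0) :=
      (congrArg (tprod _ _ + ·) (tprod_zero _)).trans (add_zero _)
    rw [h, total_tprod, total_spow, plus_tprod, Nat.cast_one, one_smul]
  | n + 1 => by
    have h : total (n + 2) (sdpow (ofMeasure μ) (ofMeasure ν) (n + 2))
        = total (n + 2) (tprod (ofMeasure ν) (spow (ofMeasure μ) (n + 1)))
          + total (n + 2) (tprod (ofMeasure μ) (sdpow (ofMeasure μ) (ofMeasure ν) (n + 1))) :=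
      map_add (total (n + 2)) _ _
    have h2 : μ ∗ (ν ∗ cpow μ n) = ν ∗ cpow μ (n + 1) := by
      rw [← Measure.conv_assoc, Measure.conv_comm μ ν, Measure.conv_assoc]; rfl
    rw [h, total_tprod, total_tprod, total_spow, total_sdpow μ ν n, tprod_smul, map_smul, plus_tprod,
      plus_tprod, ofMeasure_congr h2]
    push_cast
    module

theorem sdpow_sub {A : Sys} (x δ δ' : V A) : ∀ n, sdpow x (δ - δ') n = sdpow x δ n - sdpow x δ' n
  | 0 => (sub_zero _).symm
  | n + 1 => by
    have h1 : tprod (δ - δ') (spow x n) = tprod δ (spow x n) - tprod δ' (spow x n) :=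
      eq_sub_of_add_eq ((add_tprod _ _ _).symm.trans (congrArg (tprod · _) (sub_add_cancel δ δ')))
    have h2 : tprod x (sdpow x (δ - δ') n) = tprod x (sdpow x δ n) - tprod x (sdpow x δ' n) := by
      rw [sdpow_sub x δ δ' n]
      exact eq_sub_of_add_eq ((tprod_add _ _ _).symm.trans
        (congrArg (tprod x) (sub_add_cancel (sdpow x δ n) (sdpow x δ' n))))
    exact (congrArg₂ (· + ·) h1 h2).trans (add_sub_add_comm (tprod δ (spow x n)) _ _ _).symm

/-! ### Smoothness of Gaussian probabilities in the mean -/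

/-- The entire function that extends `x ↦ N(x, 1)(P)`. -/
def gaussExt (P : Set ℝ) (z : ℂ) : ℂ :=
  Complex.exp (-z ^ 2 / 2) * complexMGF id ((gaussianReal 0 1).restrict P) z

theorem integrable_exp_mul_restrict (P : Set ℝ) (t : ℝ) :
    Integrable (fun x => Real.exp (t * x)) ((gaussianReal 0 1).restrict P) :=
  (integrable_exp_mul_gaussianReal t).restrict

theorem hasDerivAt_gaussExt (P : Set ℝ) (z : ℂ) :
    HasDerivAt (gaussExt P) (Complex.exp (-z ^ 2 / 2) *
      ((∫ x in P, (x : ℂ) * Complex.exp (z * x) ∂gaussianReal 0 1) - z *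
        complexMGF id ((gaussianReal 0 1).restrict P) z)) z := by
  have hs : integrableExpSet id ((gaussianReal 0 1).restrict P) = Set.univ :=
    Set.eq_univ_of_forall fun t => integrable_exp_mul_restrict P t
  have h1 := hasDerivAt_complexMGF (X := id) (μ := (gaussianReal 0 1).restrict P) (z := z)
    (by rw [hs, interior_univ]; trivial)
  have h2 : HasDerivAt (fun z : ℂ => Complex.exp (-z ^ 2 / 2)) (Complex.exp (-z ^ 2 / 2) * (-z)) z := by
    have h3 : HasDerivAt (fun z : ℂ => -z ^ 2 / 2) (-z) z := by
      have := ((hasDerivAt_pow 2 z).neg).div_const 2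
      convert! this using 1
      push_cast
      ring
    exact h3.cexp
  convert! h2.mul h1 using 1
  simp only [id]
  ring

theorem differentiable_gaussExt (P : Set ℝ) : Differentiable ℂ (gaussExt P) :=
  fun z => (hasDerivAt_gaussExt P z).differentiableAt

theorem norm_gaussExt_le (P : Set ℝ) (z : ℂ) : ‖gaussExt P z‖ ≤ Real.exp (z.im ^ 2 / 2) := by
  have h1 : ‖complexMGF id ((gaussianReal 0 1).restrict P) z‖ ≤ Real.exp (z.re ^ 2 / 2) := by
    refine norm_complexMGF_le_mgf.trans ?_
    have h2 : mgf id (gaussianReal 0 1) z.re = Real.exp (z.re ^ 2 / 2) := by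
      rw [mgf_id_gaussianReal]; simp
    rw [← h2]
    exact setIntegral_le_integral (integrable_exp_mul_gaussianReal _)
      (ae_of_all _ fun x => (Real.exp_pos _).le)
  rw [gaussExt, norm_mul, Complex.norm_exp]
  refine (mul_le_mul_of_nonneg_left h1 (Real.exp_pos _).le).trans_eq ?_
  rw [← Real.exp_add]
  congr 1
  have : (-z ^ 2 / 2).re = (-(z.re ^ 2 - z.im ^ 2)) / 2 := by
    have h3 : -z ^ 2 / 2 = ((-1 / 2 : ℝ) : ℂ) * (z * z) := by push_cast; ring
    rw [h3, Complex.re_ofReal_mul, Complex.mul_re]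
    ring
  rw [this]
  ring

theorem gaussExt_ofReal {P : Set ℝ} (hP : MeasurableSet P) (x : ℝ) :
    gaussExt P x = ((gaussianReal x 1).real P : ℂ) := by
  have h1 : (gaussianReal x 1).real P
      = ∫ z in P, Real.exp (x * z - x ^ 2 / 2) ∂gaussianReal 0 1 := by
    have h2 : (gaussianReal x 1).real P = ∫ _ in P, (1 : ℝ) ∂gaussianReal x 1 := by simp
    rw [h2, gaussianReal_of_var_ne_zero x one_ne_zero, gaussianReal_of_var_ne_zero 0 one_ne_zero,
      setIntegral_withDensity_eq_setIntegral_toReal_smul (measurable_gaussianPDF _ _)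
      (ae_of_all _ fun _ => gaussianPDF_lt_top) _ hP,
      setIntegral_withDensity_eq_setIntegral_toReal_smul (measurable_gaussianPDF _ _)
      (ae_of_all _ fun _ => gaussianPDF_lt_top) _ hP]
    refine integral_congr_ae (ae_of_all _ fun z => ?_)
    simp only [toReal_gaussianPDF, gaussianPDFReal, smul_eq_mul]
    rw [mul_one, mul_assoc (√_)⁻¹, ← Real.exp_add]
    congr 2
    simp only [NNReal.coe_one]
    ring
  rw [gaussExt, complexMGF_ofReal, h1]
  have h3 : Complex.exp (-(x : ℂ) ^ 2 / 2) = ((Real.exp (-x ^ 2 / 2) : ℝ) : ℂ) := by push_cast; rfl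
  rw [h3, ← Complex.ofReal_mul]
  congr 1
  rw [mgf, ← integral_const_mul]
  refine integral_congr_ae (ae_of_all _ fun z => ?_)
  simp only [id]
  rw [← Real.exp_add]
  congr 1
  ring

/-- The functions `x ↦ N(x, 1)(P)` have derivatives of all orders, which are bounded uniformly in `P`:
the entire extension is bounded by `exp (y² / 2)` in the strip of half width `y`, and the Cauchy
estimates apply. -/
theorem exists_deriv_gaussianReal_one {P : Set ℝ} (hP : MeasurableSet P) : ∃ h : ℕ → ℝ → ℝ,
    (∀ x, h 0 x = (gaussianReal x 1).real P) ∧ (∀ k x, HasDerivAt (h k) (h (k + 1) x) x) ∧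
    (∀ k x, |h k x| ≤ 2 * k.factorial) ∧ h 1 0 = ∫ x in P, x ∂gaussianReal 0 1 := by
  refine ⟨fun k x => (iteratedDeriv k (gaussExt P) x).re, fun x => ?_, fun k x => ?_, fun k x => ?_,
    ?_⟩
  · simp only [iteratedDeriv_zero]
    rw [gaussExt_ofReal hP, Complex.ofReal_re]
  · refine HasDerivAt.real_of_complex ?_
    rw [iteratedDeriv_succ]
    exact ((differentiable_gaussExt P).contDiff.differentiable_iteratedDeriv k
      (by exact_mod_cast WithTop.coe_lt_top _) _).hasDerivAt
  · refine (Complex.abs_re_le_norm _).trans ?_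
    have h1 := Complex.norm_iteratedDeriv_le_of_forall_mem_sphere_norm_le (c := x) (R := 1) (C := 2)
      (f := gaussExt P) k one_pos (differentiable_gaussExt P).diffContOnCl fun z hz => ?_
    · simpa [mul_comm] using h1
    · refine (norm_gaussExt_le P z).trans ?_
      have h2 : |z.im| ≤ 1 := by
        have := Complex.abs_im_le_norm (z - x)
        rw [mem_sphere_iff_norm.mp hz] at this
        simpa using this
      have h3 : z.im ^ 2 / 2 ≤ 1 / 2 := by
        have := (sq_le_one_iff_abs_le_one _).mpr h2
        linarith
      refine (Real.exp_le_exp.mpr h3).trans ?_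
      have h4 : Real.exp (1 / 2) * Real.exp (1 / 2) = Real.exp 1 := by rw [← Real.exp_add]; norm_num
      nlinarith [Real.exp_one_lt_d9, Real.exp_pos (1 / 2)]
  · simp only [iteratedDeriv_one]
    rw [Complex.ofReal_zero, (hasDerivAt_gaussExt P 0).deriv]
    simp only [zero_mul, Complex.exp_zero, mul_one, sub_zero]
    rw [integral_complex_ofReal]
    simp

/-- The probability of an event under `N(x, v)` is smooth in `x`, by rescaling to variance one; the
bound on the `k`-th derivative is of order `v^{-k/2}`. -/
theorem exists_deriv_gaussianReal {v : ℝ≥0} (hv : v ≠ 0) {P : Set ℝ} (hP : MeasurableSet P) :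
    ∃ h : ℕ → ℝ → ℝ, (∀ x, h 0 x = (gaussianReal x v).real P) ∧
      (∀ k x, HasDerivAt (h k) (h (k + 1) x) x) ∧
      (∀ k x, |h k x| ≤ 2 * k.factorial / √(v : ℝ) ^ k) := by
  have hv' : 0 < √(v : ℝ) := by positivity
  have hm : Measurable fun x => √(v : ℝ) * x := by fun_prop
  obtain ⟨h, h0, h1, h2, -⟩ := exists_deriv_gaussianReal_one (hm hP)
  refine ⟨fun k x => h k (x / √(v : ℝ)) / √(v : ℝ) ^ k, fun x => ?_, fun k x => ?_, fun k x => ?_⟩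
  · simp only [pow_zero, div_one]
    rw [h0, ← map_measureReal_apply hm hP, gaussianReal_map_const_mul, mul_div_cancel₀ _ hv'.ne']
    congr 2
    ext; simp
  · have h3 := ((h1 k (x / √(v : ℝ))).comp x ((hasDerivAt_id x).div_const √(v : ℝ))).div_const
      (√(v : ℝ) ^ k)
    convert! h3 using 1
    simp only [pow_succ]
    field_simp
  · rw [abs_div, abs_of_pos (pow_pos hv' k)]
    exact div_le_div_of_nonneg_right (h2 k _) (pow_pos hv' k).le

/-! ### Taylor estimates -/

/-- The step from one order of Taylor's formula to the next. -/
theorem abs_le_of_abs_deriv_le {f f' : ℝ → ℝ} {M : ℝ} (p : ℕ) (h : ∀ t, HasDerivAt f (f' t) t)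
    (h0 : f 0 = 0) (hb : ∀ t, |f' t| ≤ M * |t| ^ p) (t : ℝ) : |f t| ≤ M * |t| ^ (p + 1) := by
  have hM : 0 ≤ M := by simpa using (abs_nonneg _).trans (hb 1)
  have h1 := Convex.norm_image_sub_le_of_norm_hasDerivWithin_le (f := f) (f' := f')
    (s := Set.uIcc 0 t) (x := 0) (y := t) (C := M * |t| ^ p) (fun x _ => (h x).hasDerivWithinAt)
    (fun x hx => (hb x).trans (mul_le_mul_of_nonneg_left (pow_le_pow_left₀ (abs_nonneg _) (by
      have := Set.abs_sub_left_of_mem_uIcc hx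
      simpa using this) _) hM))
    (convex_uIcc 0 t) Set.left_mem_uIcc Set.right_mem_uIcc
  rw [h0, sub_zero, sub_zero, Real.norm_eq_abs, Real.norm_eq_abs] at h1
  rwa [pow_succ, ← mul_assoc]

section Taylor

variable {h : ℕ → ℝ → ℝ} (hd : ∀ k x, HasDerivAt (h k) (h (k + 1) x) x)

theorem hasDerivAt_shift (hd : ∀ k x, HasDerivAt (h k) (h (k + 1) x) x) (k : ℕ) (x y : ℝ) :
    HasDerivAt (fun y => h k (x + y)) (h (k + 1) (x + y)) y := (hd k (x + y)).comp_const_add x y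

theorem abs_taylor_one_le (hd : ∀ k x, HasDerivAt (h k) (h (k + 1) x) x) {k : ℕ} {M : ℝ}
    (hM : ∀ x, |h (k + 1) x| ≤ M) (x y : ℝ) :
    |h k (x + y) - h k x| ≤ M * |y| := by
  have h1 := abs_le_of_abs_deriv_le (f := fun y => h k (x + y) - h k x) (M := M) 0
    (fun t => (hasDerivAt_shift hd k x t).sub_const _) (by simp) (fun t => by simpa using hM _) y
  simpa using h1

theorem abs_taylor_two_le (hd : ∀ k x, HasDerivAt (h k) (h (k + 1) x) x) {k : ℕ} {M : ℝ}
    (hM : ∀ x, |h (k + 2) x| ≤ M) (x y : ℝ) :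
    |h k (x + y) - h k x - y * h (k + 1) x| ≤ M * |y| ^ 2 := by
  refine abs_le_of_abs_deriv_le (f := fun y => h k (x + y) - h k x - y * h (k + 1) x)
    (f' := fun y => h (k + 1) (x + y) - 1 * h (k + 1) x) (M := M) 1
    (fun t => ((hasDerivAt_shift hd k x t).sub_const _).sub ((hasDerivAt_id t).mul_const _))
    (by simp) (fun t => ?_) y
  rw [one_mul, pow_one]
  exact abs_taylor_one_le hd hM x t

theorem abs_taylor_three_le (hd : ∀ k x, HasDerivAt (h k) (h (k + 1) x) x) {M : ℝ}
    (hM : ∀ x, |h 3 x| ≤ M) (x y : ℝ) :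
    |h 0 (x + y) - h 0 x - y * h 1 x - y ^ 2 * (h 2 x / 2)| ≤ M * |y| ^ 3 := by
  refine abs_le_of_abs_deriv_le (f := fun y => h 0 (x + y) - h 0 x - y * h 1 x - y ^ 2 * (h 2 x / 2))
    (f' := fun y => h 1 (x + y) - 1 * h 1 x - (2 : ℕ) * y ^ 1 * (h 2 x / 2)) (M := M) 2
    (fun t => (((hasDerivAt_shift hd 0 x t).sub_const _).sub ((hasDerivAt_id t).mul_const _)).sub
      ((hasDerivAt_pow 2 t).mul_const _))
    (by simp) (fun t => ?_) y
  have h1 : h 1 (x + t) - 1 * h 1 x - (2 : ℕ) * t ^ 1 * (h 2 x / 2)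
      = h 1 (x + t) - h 1 x - t * h 2 x := by push_cast; ring
  rw [h1]
  exact abs_taylor_two_le (k := 1) hd hM x t

end Taylor

/-! ### Smooth test functions and convolutions -/

section Test

variable {h : ℕ → ℝ → ℝ} {μ ν : Measure ℝ} [IsProbabilityMeasure μ] [IsProbabilityMeasure ν]

theorem integrable_of_abs_le {g : ℝ → ℝ} (hg : Continuous g) {C : ℝ} (hC : ∀ x, |g x| ≤ C)
    (μ : Measure ℝ) [IsFiniteMeasure μ] : Integrable g μ :=
  Integrable.of_bound hg.aestronglyMeasurable C (ae_of_all _ hC)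

theorem integrable_pow_of_memLp (hμ : MemLp id 3 μ) {k : ℕ} (hk : k ≤ 3) :
    Integrable (fun y => |y| ^ k) μ := by
  have h1 : MemLp (id : ℝ → ℝ) (k : ℝ≥0∞) μ :=
    hμ.mono_exponent (by exact_mod_cast hk)
  simpa using h1.integrable_norm_pow'

theorem integrable_of_memLp (hμ : MemLp id 3 μ) : Integrable (fun y => y) μ :=
  hμ.integrable (by norm_num)

theorem integrable_sq_of_memLp (hμ : MemLp id 3 μ) : Integrable (fun y => y ^ 2) μ := by
  simpa using integrable_pow_of_memLp hμ (k := 2) (by norm_num)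

/-- Translation averages of a smooth function, to first order. -/
theorem abs_integral_taylor_two_le (hd : ∀ k x, HasDerivAt (h k) (h (k + 1) x) x) {C M : ℝ}
    (hC : ∀ x, |h 0 x| ≤ C) (hM : ∀ x, |h 2 x| ≤ M) (hμ : MemLp id 3 μ) (x : ℝ) :
    |∫ y, h 0 (x + y) ∂μ - h 0 x - (∫ y, y ∂μ) * h 1 x| ≤ M * ∫ y, |y| ^ 2 ∂μ := by
  have hc : Continuous fun y => h 0 (x + y) :=
    continuous_iff_continuousAt.mpr fun y => (hasDerivAt_shift hd 0 x y).continuousAt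
  have i0 := integrable_of_abs_le hc (fun y => hC (x + y)) μ
  have i1 := (integrable_of_memLp hμ).mul_const (h 1 x)
  have j : Integrable (fun y => h 0 (x + y) - h 0 x) μ := i0.sub (integrable_const _)
  have h1 : ∫ y, h 0 (x + y) ∂μ - h 0 x - (∫ y, y ∂μ) * h 1 x
      = ∫ y, (h 0 (x + y) - h 0 x - y * h 1 x) ∂μ := by
    rw [integral_sub j i1, integral_sub i0 (integrable_const _), integral_mul_const]
    simp
  rw [h1, ← integral_const_mul]
  exact norm_integral_le_of_norm_le (f := fun y => h 0 (x + y) - h 0 x - y * h 1 x)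
    ((integrable_pow_of_memLp hμ (k := 2) (by norm_num)).const_mul M)
    (ae_of_all _ fun y => abs_taylor_two_le hd hM x y)

theorem abs_integral_taylor_three_le (hd : ∀ k x, HasDerivAt (h k) (h (k + 1) x) x) {C M : ℝ}
    (hC : ∀ x, |h 0 x| ≤ C) (hM : ∀ x, |h 3 x| ≤ M) (hμ : MemLp id 3 μ) (x : ℝ) :
    |∫ y, h 0 (x + y) ∂μ - h 0 x - (∫ y, y ∂μ) * h 1 x - (∫ y, y ^ 2 ∂μ) * (h 2 x / 2)|
      ≤ M * ∫ y, |y| ^ 3 ∂μ := by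
  have hc : Continuous fun y => h 0 (x + y) :=
    continuous_iff_continuousAt.mpr fun y => (hasDerivAt_shift hd 0 x y).continuousAt
  have i0 := integrable_of_abs_le hc (fun y => hC (x + y)) μ
  have i1 := (integrable_of_memLp hμ).mul_const (h 1 x)
  have j : Integrable (fun y => h 0 (x + y) - h 0 x) μ := i0.sub (integrable_const _)
  have i2 := (integrable_sq_of_memLp hμ).mul_const (h 2 x / 2)
  have j' : Integrable (fun y => h 0 (x + y) - h 0 x - y * h 1 x) μ := j.sub i1
  have h1 : ∫ y, h 0 (x + y) ∂μ - h 0 x - (∫ y, y ∂μ) * h 1 x - (∫ y, y ^ 2 ∂μ) * (h 2 x / 2)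
      = ∫ y, (h 0 (x + y) - h 0 x - y * h 1 x - y ^ 2 * (h 2 x / 2)) ∂μ := by
    rw [integral_sub j' i2, integral_sub j i1, integral_sub i0 (integrable_const _),
      integral_mul_const, integral_mul_const]
    simp
  rw [h1, ← integral_const_mul]
  exact norm_integral_le_of_norm_le
    (f := fun y => h 0 (x + y) - h 0 x - y * h 1 x - y ^ 2 * (h 2 x / 2))
    ((integrable_pow_of_memLp hμ le_rfl).const_mul M)
    (ae_of_all _ fun y => abs_taylor_three_le hd hM x y)

/-- Replacing a distribution by another one with the same first two moments. -/
theorem abs_integral_sub_integral_le (hd : ∀ k x, HasDerivAt (h k) (h (k + 1) x) x) {C M : ℝ}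
    (hC : ∀ x, |h 0 x| ≤ C) (hM : ∀ x, |h 3 x| ≤ M) (hμ : MemLp id 3 μ) (hν : MemLp id 3 ν)
    (h1 : ∫ y, y ∂μ = ∫ y, y ∂ν) (h2 : ∫ y, y ^ 2 ∂μ = ∫ y, y ^ 2 ∂ν) (x : ℝ) :
    |∫ y, h 0 (x + y) ∂μ - ∫ y, h 0 (x + y) ∂ν| ≤ M * (∫ y, |y| ^ 3 ∂μ + ∫ y, |y| ^ 3 ∂ν) := by
  have e1 := abs_le.mp (abs_integral_taylor_three_le hd hC hM hμ x)
  have e2 := abs_le.mp (abs_integral_taylor_three_le hd hC hM hν x)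
  rw [h1, h2] at e1
  rw [abs_le]
  constructor <;> linarith [e1.1, e1.2, e2.1, e2.2]

theorem integrable_translate {g : ℝ → ℝ} (hg : Continuous g) {C : ℝ} (hC : ∀ x, |g x| ≤ C)
    (κ μ : Measure ℝ) [IsProbabilityMeasure κ] [IsProbabilityMeasure μ] :
    Integrable (fun x => ∫ y, g (x + y) ∂μ) κ := by
  have h1 : Integrable (fun z : ℝ × ℝ => g (z.1 + z.2)) (κ.prod μ) :=
    Integrable.of_bound (by fun_prop) C (ae_of_all _ fun z => hC _)
  exact h1.integral_prod_left

theorem abs_integral_conv_sub_le {g : ℝ → ℝ} (hg : Continuous g) {C ε : ℝ} (hC : ∀ x, |g x| ≤ C)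
    (h : ∀ x, |∫ y, g (x + y) ∂μ - ∫ y, g (x + y) ∂ν| ≤ ε) (κ : Measure ℝ) [IsProbabilityMeasure κ] :
    |∫ x, g x ∂(κ ∗ μ) - ∫ x, g x ∂(κ ∗ ν)| ≤ ε := by
  rw [integral_conv (integrable_of_abs_le hg hC _), integral_conv (integrable_of_abs_le hg hC _),
    ← integral_sub (integrable_translate hg hC κ μ) (integrable_translate hg hC κ ν)]
  have h1 := norm_integral_le_of_norm_le_const (μ := κ)
    (f := fun x => ∫ y, g (x + y) ∂μ - ∫ y, g (x + y) ∂ν) (ae_of_all _ h)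
  simpa using h1

/-- Lindeberg's replacement of the summands one by one. -/
theorem abs_integral_conv_cpow_sub_le {g : ℝ → ℝ} (hg : Continuous g) {C ε : ℝ}
    (hC : ∀ x, |g x| ≤ C) (h : ∀ x, |∫ y, g (x + y) ∂μ - ∫ y, g (x + y) ∂ν| ≤ ε) (n : ℕ) :
    ∀ (ρ : Measure ℝ) [IsProbabilityMeasure ρ],
      |∫ x, g x ∂(ρ ∗ cpow μ n) - ∫ x, g x ∂(ρ ∗ cpow ν n)| ≤ n * ε := by
  induction n with
  | zero => intro ρ _; simp [cpow]
  | succ n ih =>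
    intro ρ _
    have h1 := ih (ρ ∗ μ)
    have h2 := abs_integral_conv_sub_le hg hC h (ρ ∗ cpow ν n)
    have e1 : ρ ∗ cpow μ (n + 1) = (ρ ∗ μ) ∗ cpow μ n := (Measure.conv_assoc _ _ _).symm
    have e2 : (ρ ∗ cpow ν n) ∗ μ = (ρ ∗ μ) ∗ cpow ν n := by
      rw [Measure.conv_assoc, Measure.conv_comm (cpow ν n) μ, ← Measure.conv_assoc]
    have e3 : (ρ ∗ cpow ν n) ∗ ν = ρ ∗ cpow ν (n + 1) := by
      rw [Measure.conv_assoc, Measure.conv_comm (cpow ν n) ν]; rfl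
    rw [e2, e3] at h2
    rw [e1]
    have := abs_le.mp h1
    have := abs_le.mp h2
    push_cast
    rw [abs_le]
    constructor <;> linarith

end Test

theorem cpow_gaussianReal (u : ℝ≥0) : ∀ n : ℕ, cpow (gaussianReal 0 u) n = gaussianReal 0 (n * u)
  | 0 => by simp [cpow, gaussianReal_zero_var]
  | n + 1 => by
    rw [cpow, cpow_gaussianReal u n, gaussianReal_conv_gaussianReal]
    congr 1
    · simp
    · push_cast; ring

theorem integral_gaussianReal_measureReal (κ : Measure ℝ) [IsProbabilityMeasure κ] (v : ℝ≥0)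
    {S : Set ℝ} (hS : MeasurableSet S) :
    (κ ∗ gaussianReal 0 v).real S = ∫ x, (gaussianReal x v).real S ∂κ := by
  have h1 : Integrable (S.indicator fun _ => (1 : ℝ)) (κ ∗ gaussianReal 0 v) :=
    (integrable_const 1).indicator hS
  rw [← integral_indicator_one hS]
  refine (integral_conv h1).trans (integral_congr_ae (ae_of_all _ fun x => ?_))
  have h2 : gaussianReal x v = (gaussianReal 0 v).map (fun y => x + y) := by
    rw [gaussianReal_map_const_add, zero_add]
  change _ = (gaussianReal x v).real S
  rw [h2, map_measureReal_apply (by fun_prop) hS,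
    ← integral_indicator_one (measurable_const_add x hS)]
  rfl

/-! ### Central limit theorems in total variation -/

section CLT

variable {μ : Measure ℝ} [IsProbabilityMeasure μ] {u w : ℝ≥0}

theorem memLp_three_gaussianReal (a : ℝ) (v : ℝ≥0) : MemLp id 3 (gaussianReal a v) :=
  memLp_id_gaussianReal 3

theorem integral_sq_gaussianReal (v : ℝ≥0) : ∫ y, y ^ 2 ∂gaussianReal 0 v = v := by
  have h := variance_eq_sub (μ := gaussianReal 0 v) (X := id)
    ((memLp_three_gaussianReal 0 v).mono_exponent (by norm_num))
  rw [variance_id_gaussianReal] at h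
  simpa using h.symm

/-- The normalized sum of independent variables with smoothing noise approaches the Gaussian
distribution in total variation, at rate `1 / √n`. -/
theorem exists_abs_cpow_sub_gaussianReal_le (hμ : MemLp id 3 μ) (hμ1 : ∫ y, y ∂μ = 0)
    (hμ2 : ∫ y, y ^ 2 ∂μ = u) (hw : w ≠ 0) : ∃ C : ℝ, ∀ n : ℕ, ∀ S, MeasurableSet S →
      √((n + 1 : ℕ) : ℝ) * |(cpow μ (n + 1) ∗ gaussianReal 0 ((n + 1 : ℕ) * w)).real S
        - (gaussianReal 0 ((n + 1 : ℕ) * (u + w))).real S| ≤ C := by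
  set B := ∫ y, |y| ^ 3 ∂μ + ∫ y, |y| ^ 3 ∂gaussianReal 0 u
  refine ⟨12 / √(w : ℝ) ^ 3 * B, fun n S hS => ?_⟩
  have hN : 0 < ((n + 1 : ℕ) : ℝ) := by positivity
  have hv : ((n + 1 : ℕ) * w : ℝ≥0) ≠ 0 := mul_ne_zero (by positivity) hw
  obtain ⟨h, h0, hd, hb⟩ := exists_deriv_gaussianReal hv hS
  have hc : Continuous (h 0) := continuous_iff_continuousAt.mpr fun y => (hd 0 y).continuousAt
  have key := abs_integral_conv_cpow_sub_le hc (hb 0) (abs_integral_sub_integral_le hd (hb 0) (hb 3) hμ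
    (memLp_three_gaussianReal 0 u) (by rw [hμ1, integral_id_gaussianReal])
    (by rw [hμ2, integral_sq_gaussianReal])) (n + 1) (Measure.dirac 0)
  rw [Measure.dirac_zero_conv, Measure.dirac_zero_conv] at key
  simp only [h0] at key
  rw [← integral_gaussianReal_measureReal _ _ hS, ← integral_gaussianReal_measureReal _ _ hS,
    cpow_gaussianReal, gaussianReal_conv_gaussianReal, add_zero, ← mul_add] at key
  refine (mul_le_mul_of_nonneg_left key (Real.sqrt_nonneg _)).trans_eq ?_
  have e1 : √(((n + 1 : ℕ) * w : ℝ≥0) : ℝ) = √((n + 1 : ℕ) : ℝ) * √(w : ℝ) := by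
    rw [NNReal.coe_mul, NNReal.coe_natCast, Real.sqrt_mul hN.le]
  have e2 : √((n + 1 : ℕ) : ℝ) ^ 2 = ((n + 1 : ℕ) : ℝ) := Real.sq_sqrt hN.le
  have e3 : √((n + 1 : ℕ) : ℝ) ≠ 0 := by positivity
  have e4 : √(w : ℝ) ≠ 0 := by positivity
  rw [e1]
  nth_rw 2 [← e2]
  norm_num [Nat.factorial]
  field_simp
  rfl

/-- The mean of a Gaussian summand acts on a sum as a translation. -/
theorem gaussianReal_one_conv (v : ℝ≥0) (κ : Measure ℝ) [IsProbabilityMeasure κ] {g : ℝ → ℝ}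
    (hg : Continuous g) :
    ∫ x, g x ∂(gaussianReal 1 v ∗ κ) = ∫ x, g (x + 1) ∂(gaussianReal 0 v ∗ κ) := by
  have h1 : gaussianReal 1 v ∗ κ = (gaussianReal 0 v ∗ κ).map (fun x => x + 1) := by
    have h2 : gaussianReal 1 v = Measure.dirac 1 ∗ gaussianReal 0 v := by
      rw [Measure.dirac_conv, gaussianReal_map_const_add, zero_add]
    rw [h2, Measure.conv_assoc, Measure.dirac_conv]
    simp only [add_comm]
  rw [h1, integral_map (by fun_prop) hg.aestronglyMeasurable]

/-- The effect of a perturbation of the distribution of a single summand, summed over the summands,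
approaches the effect of a shift of the mean, up to an error that is bounded uniformly in the number
of summands. -/
theorem exists_abs_conv_cpow_sub_le (hμ : MemLp id 3 μ) (hμ1 : ∫ y, y ∂μ = 0)
    (hμ2 : ∫ y, y ^ 2 ∂μ = u) (hw : w ≠ 0) (huw : u + w = 1) {lam lam' : Measure ℝ}
    [IsProbabilityMeasure lam] [IsProbabilityMeasure lam'] (hl : MemLp id 3 lam)
    (hl' : MemLp id 3 lam') : ∃ C : ℝ, ∀ n : ℕ, ∀ S, MeasurableSet S →
      |((n + 1 : ℕ) : ℝ) * (((lam ∗ cpow μ n) ∗ gaussianReal 0 ((n + 1 : ℕ) * w)).real S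
          - ((lam' ∗ cpow μ n) ∗ gaussianReal 0 ((n + 1 : ℕ) * w)).real S)
        - √((n + 1 : ℕ) : ℝ) * (∫ y, y ∂lam - ∫ y, y ∂lam')
          * ∫ x in (fun x => √((n + 1 : ℕ) : ℝ) * x) ⁻¹' S, x ∂gaussianReal 0 1| ≤ C := by
  set c := ∫ y, y ∂lam - ∫ y, y ∂lam'
  set B := ∫ y, |y| ^ 3 ∂μ + ∫ y, |y| ^ 3 ∂gaussianReal 0 u with hB
  have hB0 : 0 ≤ B := add_nonneg (integral_nonneg fun _ => by positivity)
    (integral_nonneg fun _ => by positivity)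
  set B' := (∫ y, |y| ^ 2 ∂lam + ∫ y, |y| ^ 2 ∂lam')
    + |c| * (∫ y, |y| ^ 2 ∂gaussianReal 1 u + ∫ y, |y| ^ 2 ∂gaussianReal 0 u)
  refine ⟨4 / w * B' + |c| * (48 / (w : ℝ) ^ 2 * B) + |c| * 4, fun n S hS => ?_⟩
  set N : ℝ := ((n + 1 : ℕ) : ℝ) with hNdef
  have hN : 0 < N := by positivity
  have hw' : (0 : ℝ) < w := by positivity
  have hv : ((n + 1 : ℕ) * w : ℝ≥0) ≠ 0 := mul_ne_zero (by positivity) hw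
  have hvs : √(((n + 1 : ℕ) * w : ℝ≥0) : ℝ) ^ 2 = N * w := by
    rw [Real.sq_sqrt (NNReal.coe_nonneg _)]; rfl
  obtain ⟨h, h0, hd, hb⟩ := exists_deriv_gaussianReal hv hS
  have hc : Continuous (h 0) := continuous_iff_continuousAt.mpr fun y => (hd 0 y).continuousAt
  have hval : ∀ κ : Measure ℝ, ∀ _ : IsProbabilityMeasure κ,
      (κ ∗ gaussianReal 0 ((n + 1 : ℕ) * w)).real S = ∫ x, h 0 x ∂κ := fun κ _ => by
    simp only [h0]
    exact integral_gaussianReal_measureReal κ _ hS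
  rw [hval _ inferInstance, hval _ inferInstance]
  -- the bounds on the second and the fourth derivative
  have hb2 : ∀ x, |h 2 x| ≤ 4 / (N * w) := fun x => by
    have := hb 2 x
    rw [hvs] at this
    norm_num [Nat.factorial] at this ⊢
    exact this
  have hb4 : ∀ x, |h 4 x| ≤ 48 / (N * w) ^ 2 := fun x => by
    have := hb 4 x
    rw [show (4 : ℕ) = 2 * 2 from rfl, pow_mul, hvs] at this
    norm_num [Nat.factorial] at this ⊢
    exact this
  -- only the first moment of the perturbation matters
  have hT : ∀ κ : Measure ℝ, ∀ _ : IsProbabilityMeasure κ, ∫ x, h 0 x ∂(κ ∗ cpow μ n)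
      = ∫ x, ∫ y, h 0 (x + y) ∂κ ∂cpow μ n := fun κ _ => by
    rw [Measure.conv_comm, integral_conv (integrable_of_abs_le hc (hb 0) _)]
  have iT : ∀ κ : Measure ℝ, ∀ _ : IsProbabilityMeasure κ,
      Integrable (fun x => ∫ y, h 0 (x + y) ∂κ) (cpow μ n) := fun κ _ =>
    integrable_translate hc (hb 0) (cpow μ n) κ
  have jT : ∀ κ κ' : Measure ℝ, ∀ _ : IsProbabilityMeasure κ, ∀ _ : IsProbabilityMeasure κ',
      Integrable (fun x => ∫ y, h 0 (x + y) ∂κ - ∫ y, h 0 (x + y) ∂κ') (cpow μ n) :=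
    fun κ κ' _ _ => (iT κ inferInstance).sub (iT κ' inferInstance)
  have step1 : |(∫ x, h 0 x ∂(lam ∗ cpow μ n) - ∫ x, h 0 x ∂(lam' ∗ cpow μ n))
      - c * (∫ x, h 0 x ∂(gaussianReal 1 u ∗ cpow μ n) - ∫ x, h 0 x ∂(gaussianReal 0 u ∗ cpow μ n))|
      ≤ 4 / (N * w) * B' := by
    rw [hT _ inferInstance, hT _ inferInstance, hT _ inferInstance, hT _ inferInstance,
      ← integral_sub (iT _ inferInstance) (iT _ inferInstance),
      ← integral_sub (iT _ inferInstance) (iT _ inferInstance), ← integral_const_mul,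
      ← integral_sub (jT lam lam' inferInstance inferInstance)
        ((jT (gaussianReal 1 u) (gaussianReal 0 u) inferInstance inferInstance).const_mul c)]
    have h1 := norm_integral_le_of_norm_le_const (μ := cpow μ n) (C := 4 / (N * w) * B')
      (f := fun x => (∫ y, h 0 (x + y) ∂lam - ∫ y, h 0 (x + y) ∂lam')
        - c * (∫ y, h 0 (x + y) ∂gaussianReal 1 u - ∫ y, h 0 (x + y) ∂gaussianReal 0 u))
      (ae_of_all _ fun x => by
        have t1 := abs_integral_taylor_two_le hd (hb 0) hb2 hl x
        have t2 := abs_integral_taylor_two_le hd (hb 0) hb2 hl' x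
        have t3 := abs_integral_taylor_two_le hd (hb 0) hb2 (memLp_three_gaussianReal 1 u) x
        have t4 := abs_integral_taylor_two_le hd (hb 0) hb2 (memLp_three_gaussianReal 0 u) x
        rw [integral_id_gaussianReal] at t3 t4
        set a1 := ∫ y, h 0 (x + y) ∂lam - h 0 x - (∫ y, y ∂lam) * h 1 x with ha1
        set a2 := ∫ y, h 0 (x + y) ∂lam' - h 0 x - (∫ y, y ∂lam') * h 1 x with ha2
        set a3 := ∫ y, h 0 (x + y) ∂gaussianReal 1 u - h 0 x - 1 * h 1 x with ha3
        set a4 := ∫ y, h 0 (x + y) ∂gaussianReal 0 u - h 0 x - 0 * h 1 x with ha4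
        have e : (∫ y, h 0 (x + y) ∂lam - ∫ y, h 0 (x + y) ∂lam')
            - c * (∫ y, h 0 (x + y) ∂gaussianReal 1 u - ∫ y, h 0 (x + y) ∂gaussianReal 0 u)
            = (a1 - a2) - c * (a3 - a4) := by
          rw [ha1, ha2, ha3, ha4]
          ring
        rw [Real.norm_eq_abs, e]
        calc |(a1 - a2) - c * (a3 - a4)| ≤ (|a1| + |a2|) + |c| * (|a3| + |a4|) := by
              refine (abs_sub _ _).trans (add_le_add (abs_sub _ _) ?_)
              rw [abs_mul]
              exact mul_le_mul_of_nonneg_left (abs_sub _ _) (abs_nonneg c)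
          _ ≤ _ := add_le_add (add_le_add t1 t2)
              (mul_le_mul_of_nonneg_left (add_le_add t3 t4) (abs_nonneg c))
          _ = _ := by ring)
    simpa using h1
  -- the other summands become Gaussian
  have step2 : |(∫ x, h 0 x ∂(gaussianReal 1 u ∗ cpow μ n) - ∫ x, h 0 x ∂(gaussianReal 0 u ∗ cpow μ n))
      - ((gaussianReal 1 (n + 1 : ℕ)).real S - (gaussianReal 0 (n + 1 : ℕ)).real S)|
      ≤ n * (48 / (N * w) ^ 2 * B) := by
    have hdd : ∀ k x, HasDerivAt (fun x => h k (x + 1) - h k x) (h (k + 1) (x + 1) - h (k + 1) x) x :=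
      fun k x => ((hd k (x + 1)).comp_add_const x 1).sub (hd k x)
    have hbb : ∀ x, |h 3 (x + 1) - h 3 x| ≤ 48 / (N * w) ^ 2 := fun x => by
      simpa using abs_taylor_one_le hd hb4 x 1
    have hb0 : ∀ x, |h 0 (x + 1) - h 0 x| ≤ 2 + 2 := fun x =>
      (abs_sub _ _).trans (add_le_add (by simpa using hb 0 (x + 1)) (by simpa using hb 0 x))
    have hc' : Continuous fun x => h 0 (x + 1) - h 0 x := by fun_prop
    have key := abs_integral_conv_cpow_sub_le hc' hb0
      (abs_integral_sub_integral_le (h := fun k x => h k (x + 1) - h k x) hdd hb0 hbb hμ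
      (memLp_three_gaussianReal 0 u) (by rw [hμ1, integral_id_gaussianReal])
      (by rw [hμ2, integral_sq_gaussianReal])) n (gaussianReal 0 u)
    have hsub : ∀ κ : Measure ℝ, ∀ _ : IsProbabilityMeasure κ,
        ∫ x, (h 0 (x + 1) - h 0 x) ∂(gaussianReal 0 u ∗ κ)
          = ∫ x, h 0 x ∂(gaussianReal 1 u ∗ κ) - ∫ x, h 0 x ∂(gaussianReal 0 u ∗ κ) := fun κ _ => by
      rw [gaussianReal_one_conv u κ hc]
      exact integral_sub (integrable_of_abs_le (by fun_prop) (fun x => hb 0 (x + 1)) _)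
        (integrable_of_abs_le hc (hb 0) _)
    rw [hsub _ inferInstance, hsub _ inferInstance, cpow_gaussianReal,
      ← hval (gaussianReal 1 u ∗ gaussianReal 0 (n * u)) inferInstance,
      ← hval (gaussianReal 0 u ∗ gaussianReal 0 (n * u)) inferInstance] at key
    simp only [gaussianReal_conv_gaussianReal, add_zero] at key
    have e : u + n * u + (n + 1 : ℕ) * w = ((n + 1 : ℕ) : ℝ≥0) := by
      have e' : u + n * u + (n + 1 : ℕ) * w = ((n + 1 : ℕ) : ℝ≥0) * (u + w) := by
        push_cast
        ring
      rw [e', huw, mul_one]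
    rw [e] at key
    exact key
  -- the shift of the Gaussian distribution to first order
  have step3 : |((gaussianReal 1 (n + 1 : ℕ)).real S - (gaussianReal 0 (n + 1 : ℕ)).real S)
      - (√N)⁻¹ * ∫ x in (fun x => √N * x) ⁻¹' S, x ∂gaussianReal 0 1| ≤ 4 / N := by
    have hm : Measurable fun x => √N * x := by fun_prop
    obtain ⟨k, k0, kd, kb, k1⟩ := exists_deriv_gaussianReal_one (hm hS)
    have hsN : √N ≠ 0 := by positivity
    have hs : ∀ a : ℝ, (gaussianReal a (n + 1 : ℕ)).real S = k 0 (a / √N) := fun a => by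
      rw [k0, ← map_measureReal_apply hm hS, gaussianReal_map_const_mul, mul_div_cancel₀ _ hsN]
      congr 2
      ext
      simp only [NNReal.coe_mk, mul_one]
      rw [Real.sq_sqrt hN.le]
      rfl
    have t := abs_taylor_two_le (k := 0) kd (M := 4) (fun x => by
      have := kb 2 x
      norm_num [Nat.factorial] at this ⊢
      exact this) 0 (1 / √N)
    rw [zero_add, zero_add, k1, one_div, abs_of_pos (show 0 < (√N)⁻¹ by positivity), inv_pow,
      Real.sq_sqrt hN.le, ← div_eq_mul_inv] at t
    rw [hs, hs, zero_div, one_div]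
    exact t
  set I := ∫ x in (fun x => √N * x) ⁻¹' S, x ∂gaussianReal 0 1
  set D := (∫ x, h 0 x ∂(lam ∗ cpow μ n) - ∫ x, h 0 x ∂(lam' ∗ cpow μ n))
  set E := (∫ x, h 0 x ∂(gaussianReal 1 u ∗ cpow μ n) - ∫ x, h 0 x ∂(gaussianReal 0 u ∗ cpow μ n))
  set F := ((gaussianReal 1 (n + 1 : ℕ)).real S - (gaussianReal 0 (n + 1 : ℕ)).real S)
  have e : N * D - √N * c * I = N * (D - c * E) + N * c * (E - F) + N * c * (F - (√N)⁻¹ * I) := by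
    have hs : N * (√N)⁻¹ = √N := by
      rw [← div_eq_mul_inv, Real.div_sqrt]
    linear_combination (c * I) * hs
  rw [e]
  refine (abs_add_three _ _ _).trans ?_
  rw [abs_mul, abs_mul, abs_mul (N * c), abs_mul N c, abs_of_pos hN]
  refine add_le_add_three ?_ ?_ ?_
  · refine (mul_le_mul_of_nonneg_left step1 hN.le).trans_eq ?_
    field_simp
  · have hnN : (n : ℝ) ≤ N := by rw [hNdef]; push_cast; linarith
    calc N * |c| * |E - F| ≤ N * |c| * (N * (48 / (N * w) ^ 2 * B)) := by
          refine mul_le_mul_of_nonneg_left (step2.trans ?_) (by positivity)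
          exact mul_le_mul_of_nonneg_right hnN (by positivity)
      _ = |c| * (48 / (w : ℝ) ^ 2 * B) := by field_simp
  · refine (mul_le_mul_of_nonneg_left step3 (by positivity)).trans_eq ?_
    field_simp

end CLT

/-! ### Simulation of Gaussian shifts by independent samples -/

/-- The normalized sum of `n` real random variables, with additional Gaussian noise of variance
`w`. -/
def smoothed (w : ℝ≥0) (n : ℕ) : Map (pow line n) line :=
  cpush (fun x => (√(n : ℝ))⁻¹ * x) (by fun_prop) ∘ₗ noise (n * w) ∘ₗ total n

theorem isChannel_smoothed (w : ℝ≥0) (n : ℕ) : IsChannel (smoothed w n) :=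
  (isChannel_cpush _).comp ((isChannel_noise _).comp (isChannel_total n))

section Smoothed

variable {μ lam lam' : Measure ℝ} [IsProbabilityMeasure μ] [IsProbabilityMeasure lam]
  [IsProbabilityMeasure lam'] {u w : ℝ≥0}

theorem smoothed_spow (n : ℕ) : smoothed w n (spow (ofMeasure μ) n)
    = ofMeasure ((cpow μ n ∗ gaussianReal 0 (n * w)).map fun x => (√(n : ℝ))⁻¹ * x) := by
  rw [smoothed, LinearMap.comp_apply, LinearMap.comp_apply, total_spow, noise_ofMeasure,
    cpush_ofMeasure]

theorem smoothed_sdpow (n : ℕ) :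
    smoothed w (n + 1) (sdpow (ofMeasure μ) (ofMeasure lam) (n + 1)) = ((n + 1 : ℕ) : ℂ) •
      ofMeasure (((lam ∗ cpow μ n) ∗ gaussianReal 0 ((n + 1 : ℕ) * w)).map
        fun x => (√((n + 1 : ℕ) : ℝ))⁻¹ * x) := by
  rw [smoothed, LinearMap.comp_apply, LinearMap.comp_apply, total_sdpow, map_smul, map_smul,
    noise_ofMeasure, cpush_ofMeasure]

/-- Processing independent samples of `μ` approximates `N(0, 1)`. -/
theorem exists_traceNorm_smoothed_spow_le (hμ : MemLp id 3 μ) (hμ1 : ∫ y, y ∂μ = 0)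
    (hμ2 : ∫ y, y ^ 2 ∂μ = u) (hw : w ≠ 0) (huw : u + w = 1) : ∃ C : ℝ, ∀ n : ℕ,
      traceNorm (smoothed w (n + 1) (spow (ofMeasure μ) (n + 1)) - gauss 0 1)
        ≤ ENNReal.ofReal (C / √((n + 1 : ℕ) : ℝ)) := by
  obtain ⟨C, hC⟩ := exists_abs_cpow_sub_gaussianReal_le hμ hμ1 hμ2 hw
  refine ⟨2 * C, fun n => ?_⟩
  have hN : 0 < √((n + 1 : ℕ) : ℝ) := by positivity
  have hm : Measurable fun x : ℝ => (√((n + 1 : ℕ) : ℝ))⁻¹ * x := by fun_prop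
  have hg : gauss 0 1 = ofMeasure ((gaussianReal 0 ((n + 1 : ℕ) * (u + w))).map
      fun x : ℝ => (√((n + 1 : ℕ) : ℝ))⁻¹ * x) := by
    refine ofMeasure_congr ?_
    rw [gaussianReal_map_const_mul, mul_zero, huw, mul_one]
    congr 1
    ext
    simp only [NNReal.coe_mul, NNReal.coe_mk, inv_pow, NNReal.coe_natCast, NNReal.coe_one]
    rw [Real.sq_sqrt (by positivity), inv_mul_cancel₀ (by positivity)]
  rw [smoothed_spow, hg, ofMeasure, ofMeasure, ← ofSigned_sub, mul_div_assoc]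
  refine traceNorm_ofSigned_le _ fun B hB => ?_
  rw [Measure.toSignedMeasure_sub_apply hB, map_measureReal_apply hm hB, map_measureReal_apply hm hB,
    le_div_iff₀ hN, mul_comm]
  exact hC n _ (hm hB)

/-- The same processing takes the tangent vector of the samples to a multiple of
`√n · δN(0, 1)`, up to a bounded error. -/
theorem exists_traceNorm_smoothed_sdpow_le (hμ : MemLp id 3 μ) (hμ1 : ∫ y, y ∂μ = 0)
    (hμ2 : ∫ y, y ^ 2 ∂μ = u) (hw : w ≠ 0) (huw : u + w = 1) (hl : MemLp id 3 lam)
    (hl' : MemLp id 3 lam') (c₀ : ℝ) : ∃ C : ℝ, ∀ n : ℕ,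
      traceNorm (smoothed w (n + 1) (sdpow (ofMeasure μ)
          ((c₀ : ℂ) • (ofMeasure lam - ofMeasure lam')) (n + 1))
        - ((√((n + 1 : ℕ) : ℝ) : ℝ) : ℂ) • ((c₀ * (∫ y, y ∂lam - ∫ y, y ∂lam') : ℝ) : ℂ) • dgauss 0 1)
        ≤ ENNReal.ofReal C := by
  obtain ⟨C, hC⟩ := exists_abs_conv_cpow_sub_le hμ hμ1 hμ2 hw huw hl hl'
  refine ⟨2 * (|c₀| * C), fun n => ?_⟩
  have hN : √((n + 1 : ℕ) : ℝ) ≠ 0 := by positivity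
  have hm : Measurable fun x : ℝ => (√((n + 1 : ℕ) : ℝ))⁻¹ * x := by fun_prop
  have hcast : ((n + 1 : ℕ) : ℂ) = (((n + 1 : ℕ) : ℝ) : ℂ) := by push_cast; rfl
  rw [sdpow_smul, sdpow_sub, map_smul, map_sub, smoothed_sdpow, smoothed_sdpow, ofMeasure, ofMeasure,
    dgauss_zero_one, ← smul_sub, ← ofSigned_sub, hcast, ← ofSigned_smul, ← ofSigned_smul,
    ← ofSigned_smul, ← ofSigned_smul, ← ofSigned_sub]
  refine traceNorm_ofSigned_le _ fun B hB => ?_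
  have e : (fun x : ℝ => √((n + 1 : ℕ) : ℝ) * x) ⁻¹' ((fun x : ℝ => (√((n + 1 : ℕ) : ℝ))⁻¹ * x) ⁻¹' B)
      = B := by
    ext x
    simp only [Set.mem_preimage]
    rw [inv_mul_cancel_left₀ hN]
  have h1 := mul_le_mul_of_nonneg_left (hC n _ (hm hB)) (abs_nonneg c₀)
  rw [e, ← abs_mul] at h1
  refine (congrArg abs ?_).trans_le h1
  have h2 : ∀ (a b c : ℝ) (s t r : SignedMeasure ℝ),
      (a • b • (s - t) - √((n + 1 : ℕ) : ℝ) • c • r) B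
        = a * (b * ((s - t) B)) - √((n + 1 : ℕ) : ℝ) * (c * r B) := fun _ _ _ _ _ _ => rfl
  rw [h2, Measure.toSignedMeasure_sub_apply hB, map_measureReal_apply hm hB,
    map_measureReal_apply hm hB, withDensityᵥ_apply (integrable_id_gaussianReal 0 1) hB]
  ring

end Smoothed

/-! ### Consequences of the axioms -/

section Axioms

variable {G : MetricFn}

/-- The use of weak continuity: an eventual bound up to a linear error passes to the limit. -/
theorem le_liminf_of_eventually_min_le {a b : ℕ → ℝ≥0∞} {x : ℝ≥0∞}
    (ha : Tendsto (fun n => a n / n) atTop (𝓝 x))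
    (h : ∀ ε K : ℝ≥0, 0 < ε → ∀ᶠ n : ℕ in atTop, min (a n) (n * K) ≤ b n + n * ε) :
    x ≤ liminf (fun n => b n / n) atTop := by
  have h1 : ∀ K : ℝ≥0, min x K ≤ liminf (fun n => b n / n) atTop := by
    intro K
    refine ENNReal.le_of_forall_pos_le_add fun ε hε _ => ?_
    have h2 : Tendsto (fun n => min (a n / n) (K : ℝ≥0∞)) atTop (𝓝 (min x K)) :=
      ha.min tendsto_const_nhds
    refine tsub_le_iff_right.mp ?_
    rw [← (ENNReal.Tendsto.sub h2 tendsto_const_nhds (Or.inr ENNReal.coe_ne_top)).liminf_eq]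
    refine liminf_le_liminf ?_
    filter_upwards [h ε K hε, eventually_gt_atTop 0] with n hn hn0
    have hn1 : (n : ℝ≥0∞) ≠ 0 := by exact_mod_cast hn0.ne'
    have hn2 : (n : ℝ≥0∞) ≠ ⊤ := ENNReal.natCast_ne_top n
    refine tsub_le_iff_right.mpr ?_
    have h3 : b n / n + ε = (b n + n * ε) / n := by
      rw [ENNReal.add_div, mul_comm, ENNReal.mul_div_cancel_right hn1 hn2]
    rw [h3, ENNReal.le_div_iff_mul_le (Or.inl hn1) (Or.inl hn2)]
    refine le_trans (le_min ?_ ?_) hn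
    · refine (mul_le_mul_left (min_le_left _ _) _).trans_eq ?_
      exact ENNReal.div_mul_cancel hn1 hn2
    · rw [mul_comm]
      exact mul_le_mul_right (min_le_right _ _) _
  refine ENNReal.le_of_forall_nnreal_lt fun K hK => ?_
  simpa [min_eq_right hK.le] using h1 K

theorem tendsto_zero_of_succ_le {f : ℕ → ℝ≥0∞} {g : ℕ → ℝ} (h : ∀ n, f (n + 1) ≤ ENNReal.ofReal (g n))
    (hg : Tendsto g atTop (𝓝 0)) : Tendsto f atTop (𝓝 0) := by
  rw [← tendsto_add_atTop_iff_nat 1]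
  refine tendsto_of_tendsto_of_tendsto_of_le_of_le tendsto_const_nhds ?_ (fun _ => zero_le) h
  simpa using ENNReal.tendsto_ofReal hg

theorem tendsto_div_sqrt_succ (C : ℝ) :
    Tendsto (fun n : ℕ => C / √((n + 1 : ℕ) : ℝ)) atTop (𝓝 0) :=
  (Real.tendsto_sqrt_atTop.comp
    (tendsto_natCast_atTop_atTop.comp (tendsto_add_atTop_nat 1))).const_div_atTop C

theorem metric_gauss_smul (hG : IsMetric G) (hN' : AxiomN' G) (c : ℝ) :
    G (prep (gauss 0 1)) (prep ((c : ℂ) • dgauss 0 1)) = ENNReal.ofReal (c ^ 2) := by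
  rw [prep_smul, hG.smul _ _ (isChannel_prep (isState_gauss 0 1))
    (isTangent_prep_dgauss 0 one_ne_zero), hN', mul_one]

/-- Lower bound for a metric on a classical system, for a real variable with mean zero and variance
less than one: by the central limit theorem, independent samples simulate a Gaussian shift. -/
theorem ofReal_sq_mean_le_metric (hG : IsMetric G) (hM : AxiomM G) (hA1 : AxiomA1 G)
    (hC1 : AxiomC1 G) (hN' : AxiomN' G) {μ lam lam' : Measure ℝ} [IsProbabilityMeasure μ]
    [IsProbabilityMeasure lam] [IsProbabilityMeasure lam'] {u w : ℝ≥0} (hμ : MemLp id 3 μ)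
    (hμ1 : ∫ y, y ∂μ = 0) (hμ2 : ∫ y, y ^ 2 ∂μ = u) (hw : w ≠ 0) (huw : u + w = 1)
    (hl : MemLp id 3 lam) (hl' : MemLp id 3 lam') (c₀ : ℝ) :
    ENNReal.ofReal ((c₀ * (∫ y, y ∂lam - ∫ y, y ∂lam')) ^ 2)
      ≤ G (prep (ofMeasure μ)) (prep ((c₀ : ℂ) • (ofMeasure lam - ofMeasure lam'))) := by
  set c := c₀ * (∫ y, y ∂lam - ∫ y, y ∂lam') with hc
  set δ := (c₀ : ℂ) • (ofMeasure lam - ofMeasure lam') with hδ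
  have hg := isChannel_prep (isState_gauss 0 1)
  have hp := isChannel_prep (isState_ofMeasure μ)
  have hdg : IsTangent (prep ((c : ℂ) • dgauss 0 1)) := by
    rw [prep_smul]
    exact (isTangent_prep_dgauss 0 one_ne_zero).smul c
  have hdp : IsTangent (prep δ) := ⟨c₀, _, _, isChannel_prep (isState_ofMeasure lam),
    isChannel_prep (isState_ofMeasure lam'), by rw [hδ, prep_smul, prep_sub]⟩
  let Q : (n : ℕ) → Map (pow line n) (pow line n) := fun n => spread n ∘ₗ smoothed w n
  have hQ : ∀ n, IsChannel (Q n) := fun n => (isChannel_spread n).comp (isChannel_smoothed w n)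
  have e1 : ∀ n, Q n ∘ₗ tpow (prep (ofMeasure μ)) n - tpow (prep (gauss 0 1)) n
      = spread n ∘ₗ prep (smoothed w n (spow (ofMeasure μ) n) - gauss 0 1) ∘ₗ collapse n := fun n => by
    refine pow_unit_ext ?_
    rw [LinearMap.sub_apply, LinearMap.comp_apply, tpow_spow hp, tpow_spow hg, LinearMap.comp_apply,
      LinearMap.comp_apply, LinearMap.comp_apply, collapse_spow,
      prep_one, prep_one, prep_one, map_sub, spread_gauss]
  have e2 : ∀ n, Q n ∘ₗ dpow (prep (ofMeasure μ)) (prep δ) n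
        - dpow (prep (gauss 0 1)) (prep ((c : ℂ) • dgauss 0 1)) n
      = spread n ∘ₗ prep (smoothed w n (sdpow (ofMeasure μ) δ n)
          - ((√(n : ℝ) : ℝ) : ℂ) • (c : ℂ) • dgauss 0 1) ∘ₗ collapse n := fun n => by
    refine pow_unit_ext ?_
    rw [LinearMap.sub_apply, LinearMap.comp_apply, dpow_spow hp hdp, dpow_spow hg hdg,
      LinearMap.comp_apply, LinearMap.comp_apply, LinearMap.comp_apply, collapse_spow,
      prep_one, prep_one, prep_one, prep_one,
      prep_one, map_sub, sdpow_smul (gauss 0 1), ← spread_dgauss, smul_comm, map_smul (spread n) (c : ℂ)]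
  obtain ⟨C, hC⟩ := exists_traceNorm_smoothed_spow_le hμ hμ1 hμ2 hw huw
  obtain ⟨C', hC'⟩ := exists_traceNorm_smoothed_sdpow_le hμ hμ1 hμ2 hw huw hl hl' c₀
  have t1 : Tendsto (fun n => cbNorm (Q n ∘ₗ tpow (prep (ofMeasure μ)) n - tpow (prep (gauss 0 1)) n))
      atTop (𝓝 0) := by
    refine tendsto_zero_of_succ_le (fun n => ?_) (tendsto_div_sqrt_succ C)
    rw [e1]
    exact (cbNorm_comp_prep_comp_le (isChannel_spread _) (isChannel_collapse _) _).trans (hC n)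
  have t2 : Tendsto (fun n => cbNorm (Q n ∘ₗ dpow (prep (ofMeasure μ)) (prep δ) n
      - dpow (prep (gauss 0 1)) (prep ((c : ℂ) • dgauss 0 1)) n) / ENNReal.ofReal √(n : ℝ))
      atTop (𝓝 0) := by
    refine tendsto_zero_of_succ_le (fun n => ?_) (tendsto_div_sqrt_succ C')
    rw [e2, ENNReal.ofReal_div_of_pos (by positivity)]
    exact ENNReal.div_le_div_right
      ((cbNorm_comp_prep_comp_le (isChannel_spread _) (isChannel_collapse _) _).trans (hC' n)) _
  have key := le_liminf_of_eventually_min_le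
    (b := fun n => G (tpow (prep (ofMeasure μ)) n) (dpow (prep (ofMeasure μ)) (prep δ) n))
    (hA1 _ _ hg hdg) fun ε K hε => by
      filter_upwards [hC1 _ _ hg hdg _ _ (fun n => (hQ n).comp (hp.tpow n))
        (fun n => (hdp.dpow hp n).comp_left (hQ n)) t1 t2 ε K hε] with n hn
      exact hn.trans (add_le_add_left (hM.post _ _ _ (hp.tpow n) (hdp.dpow hp n) (hQ n)) _)
  rwa [(hA1 _ _ hp hdp).liminf_eq, metric_gauss_smul hG hN'] at key

end Axioms

/-! ### Metrics dominate the classical Fisher information -/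

section Fisher

variable {Ω : Type} [MeasurableSpace Ω] [Nonempty Ω] {G : MetricFn}

theorem memLp_map_of_abs_le {Ω : Type} [MeasurableSpace Ω] {P : Measure Ω}
    [IsProbabilityMeasure P] {g : Ω → ℝ} (hg : Measurable g)
    {b : ℝ} (hb : ∀ x, |g x| ≤ b) : MemLp id 3 (P.map g) := by
  rw [memLp_map_measure_iff measurable_id.aestronglyMeasurable hg.aemeasurable]
  exact MemLp.of_bound hg.aestronglyMeasurable b (ae_of_all _ hb)

/-- The Cauchy-Schwarz inequality `(∫ f dδ)² ≤ ∫ f² dp · G_p(δ)` for bounded test functions `f`. -/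
theorem sq_integral_le_metric (hG : IsMetric G) (hM : AxiomM G) (hA1 : AxiomA1 G)
    (hC1 : AxiomC1 G) (hN' : AxiomN' G) {P lam lam' : Measure Ω} [IsProbabilityMeasure P]
    [IsProbabilityMeasure lam] [IsProbabilityMeasure lam'] (c₀ : ℝ)
    (hfin : G (prep (ofMeasure P)) (prep ((c₀ : ℂ) • (ofMeasure lam - ofMeasure lam'))) ≠ ⊤)
    {f : Ω → ℝ} (hf : Measurable f) {b : ℝ} (hb : ∀ x, |f x| ≤ b) :
    (c₀ * (∫ x, f x ∂lam - ∫ x, f x ∂lam')) ^ 2 ≤ (∫ x, f x ^ 2 ∂P) *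
      (G (prep (ofMeasure P)) (prep ((c₀ : ℂ) • (ofMeasure lam - ofMeasure lam')))).toReal := by
  set g := G (prep (ofMeasure P)) (prep ((c₀ : ℂ) • (ofMeasure lam - ofMeasure lam'))) with hg
  have iF : ∀ κ : Measure Ω, ∀ _ : IsProbabilityMeasure κ, Integrable f κ := fun κ _ =>
    Integrable.of_bound hf.aestronglyMeasurable b (ae_of_all _ hb)
  have iF2 : Integrable (fun x => f x ^ 2) P := by
    refine Integrable.of_bound (hf.pow_const 2).aestronglyMeasurable (b ^ 2) (ae_of_all _ fun x => ?_)
    rw [Real.norm_eq_abs, abs_pow]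
    exact pow_le_pow_left₀ (abs_nonneg _) (hb x) 2
  set m := ∫ x, f x ∂P with hm
  have hV : ∫ x, (f x - m) ^ 2 ∂P = ∫ x, f x ^ 2 ∂P - m ^ 2 := by
    have e : ∀ x, (f x - m) ^ 2 = f x ^ 2 - (2 * m) * f x + m ^ 2 := fun x => by ring
    simp only [e]
    have i1 : Integrable (fun x => (2 * m) * f x) P := (iF P inferInstance).const_mul _
    have i2 : Integrable (fun x => f x ^ 2 - (2 * m) * f x) P := iF2.sub i1
    rw [integral_add i2 (integrable_const _), integral_sub iF2 i1, integral_const_mul, ← hm]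
    simp
    ring
  have hV0 : 0 ≤ ∫ x, (f x - m) ^ 2 ∂P := integral_nonneg fun x => sq_nonneg _
  set W := ∫ x, (f x - m) ^ 2 ∂P with hW
  -- rescaling `f - m` to variance less than one
  have key : ∀ ε : ℝ, 0 < ε → (c₀ * (∫ x, f x ∂lam - ∫ x, f x ∂lam')) ^ 2 ≤ (W + ε) * g.toReal := by
    intro ε hε
    have hs : 0 < W + ε := by linarith
    set σ := √(W + ε) with hσ
    have hσ0 : 0 < σ := Real.sqrt_pos.mpr hs
    have hσ2 : σ ^ 2 = W + ε := Real.sq_sqrt hs.le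
    let F : Ω → ℝ := fun x => (f x - m) / σ
    have hF : Measurable F := (hf.sub_const m).div_const σ
    have hFb : ∀ x, |F x| ≤ (b + |m|) / σ := fun x => by
      rw [abs_div, abs_of_pos hσ0]
      exact div_le_div_of_nonneg_right ((abs_sub _ _).trans (add_le_add (hb x) le_rfl)) hσ0.le
    have hmean : ∀ κ : Measure Ω, ∀ _ : IsProbabilityMeasure κ,
        ∫ y, y ∂κ.map F = (∫ x, f x ∂κ - m) / σ := fun κ _ => by
      rw [integral_map hF.aemeasurable (by fun_prop)]
      simp only [F]
      rw [integral_div, integral_sub (iF κ inferInstance) (integrable_const _)]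
      simp
    have hpr : ∀ κ : Measure Ω, ∀ _ : IsProbabilityMeasure κ, IsProbabilityMeasure (κ.map F) :=
      fun κ _ => Measure.isProbabilityMeasure_map hF.aemeasurable
    have := hpr P inferInstance
    have := hpr lam inferInstance
    have := hpr lam' inferInstance
    have hvar : ∫ y, y ^ 2 ∂P.map F = (⟨W / (W + ε), div_nonneg hV0 hs.le⟩ : ℝ≥0) := by
      rw [integral_map hF.aemeasurable (by fun_prop)]
      simp only [F, div_pow]
      rw [integral_div, hσ2]
    have h1 := ofReal_sq_mean_le_metric hG hM hA1 hC1 hN'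
      (w := ⟨ε / (W + ε), div_nonneg hε.le hs.le⟩) (memLp_map_of_abs_le (P := P) hF hFb)
      (by rw [hmean P inferInstance, ← hm, sub_self, zero_div]) hvar
      (by
        intro h0
        exact (div_pos hε hs).ne' (congrArg NNReal.toReal h0))
      (by
        ext
        change W / (W + ε) + ε / (W + ε) = 1
        rw [← add_div, div_self hs.ne'])
      (memLp_map_of_abs_le (P := lam) hF hFb) (memLp_map_of_abs_le (P := lam') hF hFb) c₀
    have h2 := hM.post (prep (ofMeasure P)) (prep ((c₀ : ℂ) • (ofMeasure lam - ofMeasure lam')))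
      (cpush F hF) (isChannel_prep (isState_ofMeasure P))
      ⟨c₀, _, _, isChannel_prep (isState_ofMeasure lam), isChannel_prep (isState_ofMeasure lam'),
        by rw [prep_smul, prep_sub]⟩ (isChannel_cpush hF)
    rw [comp_prep, comp_prep, map_smul, map_sub, cpush_ofMeasure, cpush_ofMeasure,
      cpush_ofMeasure] at h2
    have h3 : _ ≤ g := h1.trans h2
    rw [← ENNReal.ofReal_toReal hfin, ENNReal.ofReal_le_ofReal_iff ENNReal.toReal_nonneg,
      hmean lam inferInstance, hmean lam' inferInstance] at h3
    have e : c₀ * ((∫ x, f x ∂lam - m) / σ - (∫ x, f x ∂lam' - m) / σ)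
        = c₀ * (∫ x, f x ∂lam - ∫ x, f x ∂lam') / σ := by ring
    rw [e, div_pow, hσ2, div_le_iff₀ hs] at h3
    linarith
  have hlim : (c₀ * (∫ x, f x ∂lam - ∫ x, f x ∂lam')) ^ 2 ≤ W * g.toReal := by
    have h4 : Tendsto (fun ε : ℝ => (W + ε) * g.toReal) (𝓝[>] 0) (𝓝 ((W + 0) * g.toReal)) :=
      tendsto_nhdsWithin_of_tendsto_nhds
        ((tendsto_const_nhds.add tendsto_id).mul tendsto_const_nhds)
    rw [add_zero] at h4
    exact ge_of_tendsto h4 (eventually_mem_nhdsWithin.mono fun ε hε => key ε hε)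
  refine hlim.trans (mul_le_mul_of_nonneg_right ?_ ENNReal.toReal_nonneg)
  rw [hV]
  linarith [sq_nonneg m]

theorem totalVariation_toSignedMeasure {Ω : Type} [MeasurableSpace Ω] (P : Measure Ω) [IsFiniteMeasure P] :
    P.toSignedMeasure.totalVariation = P := by
  have h : P.toSignedMeasure.toJordanDecomposition
      = ⟨P, 0, Measure.MutuallySingular.zero_right⟩ :=
    SignedMeasure.toJordanDecomposition_eq (by
      simp [JordanDecomposition.toSignedMeasure])
  rw [SignedMeasure.totalVariation, h, add_zero]

open Classical in
theorem fisher_ofMeasure (P : Measure Ω) [IsFiniteMeasure P] (s : SignedMeasure Ω) :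
    fisher (ofMeasure P) (ofSigned s) = if s.totalVariation ≪ P then
      ∫⁻ x, ENNReal.ofReal ((s.rnDeriv P x) ^ 2) ∂P else ⊤ := by
  rw [fisher, toSigned_ofSigned, ofMeasure, toSigned_ofSigned, totalVariation_toSignedMeasure]

/-- Integration against a signed measure, given as a difference of measures, by means of its
density. -/
theorem integral_sub_eq_integral_mul {Ω : Type} [MeasurableSpace Ω]
    {P lam lam' : Measure Ω} [IsProbabilityMeasure P]
    [IsProbabilityMeasure lam] [IsProbabilityMeasure lam'] {c₀ : ℝ} (hc₀ : 0 ≤ c₀) {r : Ω → ℝ}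
    (hr : Measurable r) (hri : Integrable r P)
    (h : c₀ • (lam.toSignedMeasure - lam'.toSignedMeasure) = P.withDensityᵥ r)
    {f : Ω → ℝ} (hf : Measurable f) {b : ℝ} (hb : ∀ x, |f x| ≤ b) :
    c₀ * (∫ x, f x ∂lam - ∫ x, f x ∂lam') = ∫ x, f x * r x ∂P := by
  let rp : Ω → ℝ≥0 := fun x => (r x).toNNReal
  let rn : Ω → ℝ≥0 := fun x => (-r x).toNNReal
  have hrp : Measurable rp := hr.real_toNNReal
  have hrn : Measurable rn := hr.neg.real_toNNReal
  have hsplit : ∀ x, r x = (rp x : ℝ) - rn x := fun x => by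
    simp only [rp, rn, Real.coe_toNNReal']
    exact (max_zero_sub_eq_self (r x)).symm
  have ip : Integrable (fun x => (rp x : ℝ)) P := by simpa [rp] using hri.pos_part
  have ineg : Integrable (fun x => (rn x : ℝ)) P := by simpa [rn] using hri.neg_part
  have fp : IsFiniteMeasure (P.withDensity fun x => rp x) :=
    isFiniteMeasure_withDensity (by
      have := ip.lintegral_lt_top
      simpa using this.ne)
  have fn : IsFiniteMeasure (P.withDensity fun x => rn x) :=
    isFiniteMeasure_withDensity (by
      have := ineg.lintegral_lt_top
      simpa using this.ne)
  have hdens : ∀ (q : Ω → ℝ≥0), Measurable q → ∀ k : Ω → ℝ,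
      ∫ x, k x ∂P.withDensity (fun x => q x) = ∫ x, (q x : ℝ) * k x ∂P := fun q hq k => by
    rw [integral_withDensity_eq_integral_smul hq]; rfl
  have hμ : c₀.toNNReal • lam + P.withDensity (fun x => rn x)
      = c₀.toNNReal • lam' + P.withDensity (fun x => rp x) := by
    refine Measure.ext fun B hB => ?_
    have h1 : ∀ (q : Ω → ℝ≥0), Measurable q → IsFiniteMeasure (P.withDensity fun x => q x) →
        (P.withDensity fun x => q x).real B = ∫ x in B, (q x : ℝ) ∂P := fun q hq _ => by
      rw [← integral_indicator_one hB, hdens q hq, ← integral_indicator hB]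
      refine integral_congr_ae (ae_of_all _ fun x => ?_)
      by_cases hx : x ∈ B <;> simp [hx]
    have h2 := congrArg (fun s : SignedMeasure Ω => s B) h
    have h3 : (c₀ • (lam.toSignedMeasure - lam'.toSignedMeasure)) B
        = c₀ * (lam.real B - lam'.real B) := by
      rw [← Measure.toSignedMeasure_sub_apply hB]; rfl
    simp only [h3] at h2
    rw [withDensityᵥ_apply hri hB] at h2
    simp only [hsplit] at h2
    rw [integral_sub ip.integrableOn ineg.integrableOn, ← h1 rp hrp fp, ← h1 rn hrn fn] at h2
    rw [← measureReal_eq_measureReal_iff, measureReal_add_apply, measureReal_add_apply,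
      measureReal_nnreal_smul_apply, measureReal_nnreal_smul_apply, Real.coe_toNNReal _ hc₀]
    linarith
  have iF : ∀ κ : Measure Ω, ∀ _ : IsFiniteMeasure κ, Integrable f κ := fun κ _ =>
    Integrable.of_bound hf.aestronglyMeasurable b (ae_of_all _ hb)
  have h4 := congrArg (fun κ : Measure Ω => ∫ x, f x ∂κ) hμ
  rw [integral_add_measure (iF _ inferInstance) (iF _ fn),
    integral_add_measure (iF _ inferInstance) (iF _ fp), integral_smul_nnreal_measure,
    integral_smul_nnreal_measure, hdens rp hrp, hdens rn hrn] at h4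
  simp only [NNReal.smul_def, Real.coe_toNNReal _ hc₀, smul_eq_mul] at h4
  have h5 : ∀ x, f x * r x = rp x * f x - rn x * f x := fun x => by rw [hsplit x]; ring
  simp only [h5]
  rw [integral_sub (ip.mul_bdd (c := b) hf.aestronglyMeasurable (ae_of_all _ hb))
    (ineg.mul_bdd (c := b) hf.aestronglyMeasurable (ae_of_all _ hb))]
  linarith

/-- On classical systems, a metric dominates the Fisher information. -/
theorem fisher_le_metric (hG : IsMetric G) (hM : AxiomM G) (hA1 : AxiomA1 G)
    (hC1 : AxiomC1 G) (hN' : AxiomN' G) {p δ : V (classical Ω)} (hp : IsState p.1)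
    (hδ : IsTangent (prep δ)) : fisher p δ ≤ G (prep p) (prep δ) := by
  obtain ⟨c₀, Ψ₁, Ψ₂, hc₀, h1, h2, hΨ⟩ := hδ.exists_nonneg
  obtain ⟨P, _, rfl⟩ := exists_ofMeasure hp
  obtain ⟨lam, _, e1⟩ := exists_ofMeasure (h1.map_state one isState_one)
  obtain ⟨lam', _, e2⟩ := exists_ofMeasure (h2.map_state one isState_one)
  have hδ' : δ = (c₀ : ℂ) • (ofMeasure lam - ofMeasure lam') := by
    rw [← e1, ← e2, ← prep_one δ, hΨ]; rfl
  set s : SignedMeasure Ω := c₀ • (lam.toSignedMeasure - lam'.toSignedMeasure) with hs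
  have hδs : δ = ofSigned s := by
    rw [hδ', hs, ofSigned_smul, ofSigned_sub]; rfl
  by_cases hfin : G (prep (ofMeasure P)) (prep δ) = ⊤
  · rw [hfin]; exact le_top
  have hsq : ∀ {f : Ω → ℝ}, Measurable f → ∀ {b : ℝ}, (∀ x, |f x| ≤ b) →
      (c₀ * (∫ x, f x ∂lam - ∫ x, f x ∂lam')) ^ 2
        ≤ (∫ x, f x ^ 2 ∂P) * (G (prep (ofMeasure P)) (prep δ)).toReal := fun {f} hf {b} hb => by
    rw [hδ'] at hfin ⊢
    exact sq_integral_le_metric hG hM hA1 hC1 hN' c₀ hfin hf hb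
  have hsB : ∀ B, MeasurableSet B → s B = c₀ * (lam.real B - lam'.real B) := fun B hB => by
    rw [← Measure.toSignedMeasure_sub_apply hB]; rfl
  have hac : s ≪ᵥ P.toENNRealVectorMeasure := by
    refine VectorMeasure.AbsolutelyContinuous.mk fun B hB hPB => ?_
    rw [Measure.toENNRealVectorMeasure_apply_measurable hB] at hPB
    have h3 := hsq (f := B.indicator fun _ => 1) (measurable_const.indicator hB) (b := 1) fun x => by
      by_cases hx : x ∈ B <;> simp [hx]
    have h4 : ∫ x, (B.indicator (fun _ => (1 : ℝ)) x) ^ 2 ∂P = 0 := by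
      have h5 : ∀ x, (B.indicator (fun _ => (1 : ℝ)) x) ^ 2 = B.indicator 1 x := fun x => by
        by_cases hx : x ∈ B <;> simp [hx]
      simp only [h5]
      rw [integral_indicator_one hB, measureReal_def, hPB, ENNReal.toReal_zero]
    have h6 : ∀ κ : Measure Ω, ∫ x, B.indicator (fun _ => (1 : ℝ)) x ∂κ = κ.real B := fun κ =>
      integral_indicator_one hB
    rw [h4, zero_mul, h6, h6, ← hsB B hB] at h3
    exact pow_eq_zero_iff two_ne_zero |>.mp (le_antisymm h3 (sq_nonneg _))
  have hdens := (s.absolutelyContinuous_iff_withDensityᵥ_rnDeriv_eq P).mp hac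
  have hac' : s.totalVariation ≪ P := by
    have := (SignedMeasure.absolutelyContinuous_ennreal_iff s _).mp hac
    rwa [show P.toENNRealVectorMeasure.ennrealToMeasure = P from
      VectorMeasure.equivMeasure.right_inv P] at this
  rw [hδs, fisher_ofMeasure, if_pos hac', ← hδs]
  set r := s.rnDeriv P with hr
  have hrm : Measurable r := SignedMeasure.measurable_rnDeriv s P
  have hri : Integrable r P := SignedMeasure.integrable_rnDeriv s P
  -- truncations of the density as test functions
  let f : ℕ → Ω → ℝ := fun k => {x | |r x| ≤ k}.indicator r
  have hset : ∀ k : ℕ, MeasurableSet {x | |r x| ≤ k} := fun k =>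
    measurableSet_le hrm.abs measurable_const
  have hf : ∀ k, Measurable (f k) := fun k => hrm.indicator (hset k)
  have hfb : ∀ k x, |f k x| ≤ k := fun k x => by
    by_cases hx : |r x| ≤ k <;> simp [f, hx]
  have hfr : ∀ k x, f k x * r x = f k x ^ 2 := fun k x => by
    by_cases hx : |r x| ≤ k <;> simp [f, hx, sq]
  have hbound : ∀ k, ∫⁻ x, ENNReal.ofReal (f k x ^ 2) ∂P ≤ G (prep (ofMeasure P)) (prep δ) := by
    intro k
    have i2 : Integrable (fun x => f k x ^ 2) P := by
      refine Integrable.of_bound ((hf k).pow_const 2).aestronglyMeasurable ((k : ℝ) ^ 2)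
        (ae_of_all _ fun x => ?_)
      rw [Real.norm_eq_abs, abs_pow]
      exact pow_le_pow_left₀ (abs_nonneg _) (hfb k x) 2
    rw [← ofReal_integral_eq_lintegral_ofReal i2 (ae_of_all _ fun x => sq_nonneg _),
      ← ENNReal.ofReal_toReal hfin]
    refine ENNReal.ofReal_le_ofReal ?_
    have h3 := hsq (hf k) (hfb k)
    rw [integral_sub_eq_integral_mul hc₀ hrm hri hdens.symm (hf k) (hfb k)] at h3
    simp only [hfr] at h3
    have h4 : 0 ≤ ∫ x, f k x ^ 2 ∂P := integral_nonneg fun x => sq_nonneg _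
    rcases h4.eq_or_lt with h5 | h5
    · rw [← h5]; exact ENNReal.toReal_nonneg
    · rw [sq] at h3
      exact le_of_mul_le_mul_left h3 h5
  have hlim := lintegral_tendsto_of_tendsto_of_monotone (μ := P)
    (f := fun (k : ℕ) x => ENNReal.ofReal (f k x ^ 2)) (F := fun x => ENNReal.ofReal (r x ^ 2))
    (fun k => ((hf k).pow_const 2).ennreal_ofReal.aemeasurable) (ae_of_all _ fun x k l hkl => by
      refine ENNReal.ofReal_le_ofReal ?_
      by_cases hx : |r x| ≤ k
      · have hx' : |r x| ≤ l := hx.trans (by exact_mod_cast hkl)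
        simp [f, hx, hx']
      · have h0 : f k x = 0 := by simp [f, hx]
        rw [h0]
        simpa using sq_nonneg (f l x)) (ae_of_all _ fun x => by
      refine tendsto_const_nhds.congr' ?_
      filter_upwards [eventually_ge_atTop ⌈|r x|⌉₊] with k hk
      have hx : |r x| ≤ k := Nat.ceil_le.mp hk
      simp [f, hx])
  exact le_of_tendsto' hlim hbound

end Fisher

/-! ### The lower bound -/

/-- Every measured model, obtained from a probe with ancilla, has at most the metric of the channel. -/
theorem GMin_le_metric {G : MetricFn} (hG : IsMetric G) (hM : AxiomM G) (hE : AxiomE G)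
    (hA1 : AxiomA1 G) (hC1 : AxiomC1 G) (hN' : AxiomN' G) {A B : Sys} {Φ Δ : Map A B}
    (hΦ : IsChannel Φ) (hΔ : IsTangent Δ) : GMin Φ Δ ≤ G Φ Δ := by
  refine iSup_le fun κ => iSup_le fun _ => iSup_le fun ρ => iSup_le fun hρ => iSup_le fun Ω =>
    iSup_le fun _ => iSup_le fun _ => iSup_le fun M => iSup_le fun hMc => ?_
  have h1 := isChannel_prep hρ
  have h2 := hΦ.amp (quantum κ)
  have h3 := hΔ.amp (quantum κ)
  have e : ∀ Ψ : Map A B, prep (M (amp Ψ (quantum κ) ρ)) = M ∘ₗ amp Ψ (quantum κ) ∘ₗ prep ρ :=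
    fun Ψ => by rw [comp_prep, comp_prep]
  refine (fisher_le_metric hG hM hA1 hC1 hN' (hMc.map_state _ (h2.map_state _ hρ)) ?_).trans ?_
  · rw [e]
    exact (h3.comp_right h1).comp_left hMc
  · rw [e, e, ← hE Φ Δ (quantum κ) hΦ hΔ]
    exact (hM.post _ _ M (h2.comp h1) (h3.comp_right h1) hMc).trans (hM.pre _ _ _ h2 h3 h1)

theorem GpMin_le_metric {G : MetricFn} (hG : IsMetric G) (hM : AxiomM G) (hE : AxiomE G)
    (hA1 : AxiomA1 G) (hC1 : AxiomC1 G) (hN' : AxiomN' G) {A B : Sys} {Φ Δ : Map A B}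
    (hΦ : IsChannel Φ) (hΔ : IsTangent Δ) : GpMin Φ Δ ≤ G Φ Δ := by
  rw [← (hA1 Φ Δ hΦ hΔ).limsup_eq]
  exact limsup_le_limsup (Eventually.of_forall fun n => ENNReal.div_le_div_right
    (GMin_le_metric hG hM hE hA1 hC1 hN' (hΦ.tpow n) (hΔ.dpow hΦ n)) _)

/-! ### The upper bound -/

/-- A Gaussian shift is an affine image of a multiple of the standard one. -/
theorem metric_gauss_le {G : MetricFn} (hG : IsMetric G) (hM : AxiomM G) (hN' : AxiomN' G) (a c : ℝ)
    {v : ℝ≥0} (hv : v ≠ 0) : G (prep (gauss a v)) (prep ((c : ℂ) • dgauss a v))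
      ≤ ENNReal.ofReal (c ^ 2 / v) := by
  have hsv : √(v : ℝ) ≠ 0 := by positivity
  have h1 := hM.post (prep (gauss 0 1)) (prep (((c / √(v : ℝ) : ℝ) : ℂ) • dgauss 0 1))
    (cpush (fun x => √(v : ℝ) * x + a) (by fun_prop)) (isChannel_prep (isState_gauss 0 1))
    (by rw [prep_smul]; exact (isTangent_prep_dgauss 0 one_ne_zero).smul _) (isChannel_cpush _)
  rw [comp_prep, comp_prep, cpush_gauss, map_smul, cpush_dgauss a hv, smul_smul,
    ← Complex.ofReal_mul, div_mul_cancel₀ _ hsv, metric_gauss_smul hG hN', div_pow,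
    Real.sq_sqrt (NNReal.coe_nonneg v)] at h1
  exact h1

theorem integrable_score_sq (a : ℝ) (v : ℝ≥0) :
    Integrable (fun x => ((x - a) / v) ^ 2) (gaussianReal a v) :=
  (((memLp_id_gaussianReal 2).sub (memLp_const a)).const_mul (v : ℝ)⁻¹).integrable_sq.congr
    (ae_of_all _ fun x => by simp [div_eq_inv_mul])

theorem integral_score_sq (a : ℝ) (v : ℝ≥0) :
    ∫ x, ((x - a) / v) ^ 2 ∂gaussianReal a v = (v : ℝ)⁻¹ := by
  have h1 := variance_eq_integral (μ := gaussianReal a v) (X := id) (by fun_prop)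
  rw [variance_id_gaussianReal] at h1
  simp only [id, integral_id_gaussianReal] at h1
  simp only [div_pow]
  rw [integral_div, ← h1]
  rcases eq_or_ne v 0 with h | h
  · simp [h]
  · have : (v : ℝ) ≠ 0 := by exact_mod_cast h
    field_simp

/-- The Fisher information of a Gaussian shift. -/
theorem le_fisher_gauss (a c : ℝ) {v : ℝ≥0} (hv : v ≠ 0) :
    ENNReal.ofReal (c ^ 2 / v) ≤ fisher (gauss a v) ((c : ℂ) • dgauss a v) := by
  classical
  have hs := (integrable_score a v).smul c
  rw [gauss_eq, dgauss_eq a hv, ← ofSigned_smul, ← withDensityᵥ_smul,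
    fisher_ofMeasure]
  split_ifs
  swap
  · exact le_top
  set s : SignedMeasure ℝ := (gaussianReal a v).withDensityᵥ (c • fun x => (x - a) / (v : ℝ)) with hsdef
  have h1 : (gaussianReal a v).withDensityᵥ (s.rnDeriv (gaussianReal a v)) = s :=
    SignedMeasure.withDensityᵥ_rnDeriv_eq _ _ (Measure.withDensityᵥ_absolutelyContinuous _ _)
  have h2 := (SignedMeasure.integrable_rnDeriv s _).ae_eq_of_withDensityᵥ_eq hs h1
  have h3 : ∫⁻ x, ENNReal.ofReal ((s.rnDeriv (gaussianReal a v) x) ^ 2) ∂gaussianReal a v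
      = ∫⁻ x, ENNReal.ofReal (c ^ 2 * ((x - a) / v) ^ 2) ∂gaussianReal a v := by
    refine lintegral_congr_ae (h2.mono fun x hx => ?_)
    simp only [hx, Pi.smul_apply, smul_eq_mul, mul_pow]
  rw [h3, ← ofReal_integral_eq_lintegral_ofReal ((integrable_score_sq a v).const_mul _)
    (ae_of_all _ fun x => by positivity), integral_const_mul, integral_score_sq, div_eq_mul_inv]

theorem traceNorm_sub_comm {A : Sys} (X Y : V A) : traceNorm (X - Y) = traceNorm (Y - X) := by
  have h : ∀ X Y : V A, traceNorm (X - Y) ≤ traceNorm (Y - X) := fun X Y => by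
    refine le_of_forall_gt fun r hr => ?_
    obtain ⟨s, t, ρ, σ, hρ, hσ, h1, h2⟩ := exists_of_traceNorm_lt hr
    rw [add_comm] at h2
    exact (traceNorm_le hσ hρ (s := t) (t := s) (by rw [← neg_sub Y X, h1, neg_sub])).trans_lt h2
  exact le_antisymm (h X Y) (h Y X)

theorem cbNorm_sub_comm {A B : Sys} {D E : Map A B} (hD : Amplifiable D) (hE : Amplifiable E) :
    cbNorm (D - E) = cbNorm (E - D) := by
  unfold cbNorm
  refine iSup_congr fun k => iSup_congr fun X => iSup_congr fun _ => ?_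
  rw [amp_sub hD hE, amp_sub hE hD, LinearMap.sub_apply, LinearMap.sub_apply, traceNorm_sub_comm]

/-- Attaching a state is no more informative than the state itself. -/
theorem metric_attach_le {G : MetricFn} (hM : AxiomM G) (hE : AxiomE G) {A S : Sys} {x δ : V S}
    (hx : IsState x.1) (hδ : IsTangent (prep δ)) :
    G (attach A x) (attach A δ) ≤ G (prep x) (prep δ) := by
  have e : ∀ y : V S, attach A y
      = swap S A ∘ₗ (amp (prep y) A ∘ₗ (swap A unit ∘ₗ unitor A)) := fun y => by
    rw [attach, tensor, amp_id]; rfl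
  have h1 := (isChannel_prep hx).amp A
  have h2 := hδ.amp A
  have h3 := (isChannel_swap A unit).comp (isChannel_unitor A)
  rw [e, e, ← hE (prep x) (prep δ) A (isChannel_prep hx) hδ]
  exact (hM.post _ _ _ (h1.comp h3) (h2.comp_right h3) (isChannel_swap S A)).trans
    (hM.pre _ _ _ h1 h2 h3)

theorem metric_le_GpMaxTilde {G : MetricFn} (hG : IsMetric G) (hM : AxiomM G) (hE : AxiomE G)
    (hA1 : AxiomA1 G) (hC1 : AxiomC1 G) (hN' : AxiomN' G) {A B : Sys} {Φ Δ : Map A B}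
    (hΦ : IsChannel Φ) (hΔ : IsTangent Δ) : G Φ Δ ≤ GpMaxTilde Φ Δ := by
  refine le_iInf fun a => le_iInf fun v => le_iInf fun c => le_iInf fun Λ => le_iInf fun h => ?_
  refine le_liminf_of_eventually_min_le (hA1 Φ Δ hΦ hΔ) fun ε K hε => ?_
  have hq : ∀ n, IsState (gauss (a n) (v n)).1 := fun n => isState_gauss _ _
  have hd : ∀ n, IsTangent (prep ((c n : ℂ) • dgauss (a n) (v n))) := fun n => by
    rw [prep_smul]
    exact (isTangent_prep_dgauss _ (h.pos n).ne').smul _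
  have cq := fun n => isChannel_attach (pow A n) (hq n)
  have cd := fun n => isTangent_attach (pow A n) (hd n)
  filter_upwards [hC1 Φ Δ hΦ hΔ (fun n => Λ n ∘ₗ attach (pow A n) (gauss (a n) (v n)))
    (fun n => Λ n ∘ₗ attach (pow A n) ((c n : ℂ) • dgauss (a n) (v n)))
    (fun n => (h.channel n).comp (cq n)) (fun n => (cd n).comp_left (h.channel n))
    (h.approx.congr fun n => cbNorm_sub_comm (hΦ.tpow n).amplifiable
      ((h.channel n).comp (cq n)).amplifiable)
    (h.approx_tangent.congr fun n => congrArg (· / _) (cbNorm_sub_comm (hΔ.dpow hΦ n).amplifiable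
      ((cd n).comp_left (h.channel n)).amplifiable)) ε K hε] with n hn
  refine hn.trans (add_le_add_left ?_ _)
  exact (hM.post _ _ _ (cq n) (cd n) (h.channel n)).trans ((metric_attach_le hM hE (hq n) (hd n)).trans
    ((metric_gauss_le hG hM hN' _ _ (h.pos n).ne').trans (le_fisher_gauss _ _ (h.pos n).ne')))

end

end ChannelMetric

theorem mainTheorem8 (G : MetricFn) (hG : IsMetric G) (hM : AxiomM G) (hE : AxiomE G)
    (hA1 : AxiomA1 G) (hC1 : AxiomC1 G) (hN' : AxiomN' G)
    {A B : Sys} (Φ Δ : Map A B) (hΦ : IsChannel Φ) (hΔ : IsTangent Δ) :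
    GpMin Φ Δ ≤ G Φ Δ ∧ G Φ Δ ≤ GpMaxTilde Φ Δ :=
  ⟨GpMin_le_metric hG hM hE hA1 hC1 hN' hΦ hΔ, metric_le_GpMaxTilde hG hM hE hA1 hC1 hN' hΦ hΔ⟩
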